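/- Conventions. Let $M$ be a smooth finite-dimensional manifold (Hausdorff, paracompact, without boundary) and let $S^1=\mathbb R/2\pi\mathbb Z$ with base point $0$. For $n\ge 0$ put $V=\mathbb C^n$ and $G=GL(V)$. Let $LV=C^\infty(S^1,V)$ with its $C^\infty$ Fréchet topology, and let $\Omega G=\{\gamma\in C^\infty(S^1,G):\gamma(0)=1\}$, a Fréchet Lie group under pointwise multiplication that acts on $LV$ by $(\gamma v)(\theta)=\gamma(\theta)(v(\theta))$. Smoothness between Fréchet manifolds means that all iterated Gateaux derivatives exist and are jointly continuous. * $\Omega\mathrm{Vect}_V(M)$ is the groupoid of $\Omega$ vector bundles over $M$ with typical fibre $LV$: smooth Fréchet vector bundles $\mathsf E\to M$ with fibre $LV$ and a preferred family of local trivialisations whose transition functions are smooth $\Omega G$-valued functions acting as above. Frames of $\mathsf E$ are the isomorphisms $\psi_x^{-1}\circ\gamma\colon LV\to\mathsf E_x$ with $\psi$ a preferred trivialisation and $\gamma\in\Omega G$. Morphisms are the smooth, fibrewise linear isomorphisms over $\mathrm{id}_M$, with smooth inverse, that in any frames are given by elements of $\Omega G$. * $\mathrm{frVect}_V(M)$ is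 the groupoid of smooth complex vector bundles $E\to M\times S^1$ with typical fibre $V$ and a distinguished smooth trivialisation over $M\times\{0\}$. Morphisms are vector bundle isomorphisms over the identity that preserve the trivialisations. * $\Omega\mathrm{Vect}(M)$ and $\mathrm{frVect}(M)$ are the disjoint unions of these groupoids over $n\ge0$. * $\mathrm{Bun}_{\Omega G}(M)$ is the groupoid of smooth principal $\Omega G$-bundles over $M$, and $\mathrm{frBun}_G(M)$ is the groupoid of smooth principal $G$-bundles $P\to M\times S^1$ with a smooth section $s_0$ of $P$ over $M\times\{0\}$. Morphisms are bundle maps over the identity, preserving the sections in the second case. * $\mathcal F$ denotes the frame bundle functors $\Omega\mathrm{Vect}_V(M)\to\mathrm{Bun}_{\Omega G}(M)$ and $\mathrm{frVect}_V(M)\to\mathrm{frBun}_G(M)$. In the second case the distinguished trivialisation gives the section of frames over $M\times\{0\}$. * The based caloron transform $\mathcal C\colon\mathrm{Bun}_{\Omega G}(M)\to\mathrm{frBun}_G(M)$ is $\mathcal C(\mathsf Q)=(\mathsf Q\times S^1\times G)/\Omega G$ for the action $(q,\theta,g)\gamma=(q\gamma,\theta,\gamma(\theta)^{-1}g)$,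 with $[q,\theta,g]h=[q,\theta,gh]$, framing $s_0(m,0)=[q,0,1]$ ($q\in\mathsf Q_m$), and $\mathcal C(f)[q,\theta,g]=[f(q),\theta,g]$. * The based inverse caloron transform $\mathcal C^{-1}\colon\mathrm{frBun}_G(M)\to\mathrm{Bun}_{\Omega G}(M)$ sends $P$ to the bundle whose fibre over $m$ is the set of smooth sections $p$ of $P$ over $\{m\}\times S^1$ with $p(0)=s_0(m,0)$, with pointwise $\Omega G$-action. Its local sections over $U\subseteq M$ are the smooth sections of $P$ over $U\times S^1$ that agree with $s_0$ over $U\times\{0\}$. On morphisms, $\mathcal C^{-1}(f)(p)=f\circ p$. * The caloron transform is $\mathcal V(\mathsf E)=\mathcal C(\mathcal F(\mathsf E))\times_G V$, with the distinguished trivialisation $[s_0(m,0)g,v]\mapsto g(v)$ over $M\times\{0\}$ and $\mathcal V(f)[q,v]=[\mathcal C(\mathcal F(f))(q),v]$. The inverse caloron transform is $\mathcal V^{-1}(E)=\mathcal C^{-1}(\mathcal F(E))\times_{\Omega G}LV$ with $\mathcal V^{-1}(f)[q,v]=[\mathcal C^{-1}(\mathcal F(f))(q),v]$. Theorem. The transforms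 $\mathcal C$, $\mathcal C^{-1}$, $\mathcal V$, $\mathcal V^{-1}$ are well defined: $\mathcal C(\mathsf Q)$ is a smooth principal $G$-bundle over $M\times S^1$ with smooth framing, $\mathcal C^{-1}(P)$ is a smooth principal $\Omega G$-bundle over $M$, and both are functorial with smooth maps on morphisms. The functors $$\mathcal V\colon\Omega\mathrm{Vect}(M)\longrightarrow\mathrm{frVect}(M),\qquad \mathcal V^{-1}\colon\mathrm{frVect}(M)\longrightarrow\Omega\mathrm{Vect}(M)$$ form an equivalence of groupoids: there are natural isomorphisms $\mathcal V^{-1}\circ\mathcal V\cong\mathrm{id}$ and $\mathcal V\circ\mathcal V^{-1}\cong\mathrm{id}$. For each $n$ they restrict to an equivalence between $\Omega\mathrm{Vect}_V(M)$ and $\mathrm{frVect}_V(M)$. They are compatible with the frame bundle functors and the based caloron transforms of principal bundles: for each $n$ there are natural isomorphisms $$\mathcal F\circ\mathcal V\cong\mathcal C\circ\mathcal F,\qquad \mathcal F\circ\mathcal V^{-1}\cong\mathcal C^{-1}\circ\mathcal F .$$ -/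

import Mathlib

open Set Filter Topology CategoryTheory
open scoped Manifold ContDiff

universe v

noncomputable section

namespace Caloron

/-! ### Smooth maps between (real) topological vector spaces -/

section Gateaux

variable {V W : Type*} [AddCommGroup V] [Module ℝ V] [TopologicalSpace V]
  [AddCommGroup W] [Module ℝ W] [TopologicalSpace W]

/-- `f` is smooth on the open set `U`: all iterated Gateaux derivatives
`D k : U × V^k → W`, where
`D (k+1) v {h₁, …, h_{k+1}} = lim_{t → 0} (D k (v + t h_{k+1}) {h₁, …, h_k} - D k v {h₁, …, h_k}) / t`,
exist and are (jointly) continuous. -/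
def GateauxSmoothOn (f : V → W) (U : Set V) : Prop :=
  ∃ D : (k : ℕ) → V → (Fin k → V) → W,
    (∀ v ∈ U, ∀ h, D 0 v h = f v) ∧
    (∀ k, ∀ v ∈ U, ∀ h : Fin (k + 1) → V,
      Tendsto (fun t : ℝ => t⁻¹ • (D k (v + t • h (Fin.last k)) (Fin.init h) - D k v (Fin.init h)))
        (𝓝[≠] 0) (𝓝 (D (k + 1) v h))) ∧
    ∀ k, ContinuousOn (fun p : V × (Fin k → V) => D k p.1 p.2) (U ×ˢ univ)

theorem GateauxSmoothOn.mono {f : V → W} {U U' : Set V} (h : GateauxSmoothOn f U) (hU : U' ⊆ U) :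
    GateauxSmoothOn f U' := by
  obtain ⟨D, h0, h1, h2⟩ := h
  exact ⟨D, fun v hv => h0 v (hU hv), fun k v hv => h1 k v (hU hv),
    fun k => (h2 k).mono (prod_mono hU subset_rfl)⟩

theorem GateauxSmoothOn.congr {f g : V → W} {U : Set V} (h : GateauxSmoothOn f U)
    (hg : ∀ v ∈ U, g v = f v) : GateauxSmoothOn g U := by
  obtain ⟨D, h0, h1, h2⟩ := h
  exact ⟨D, fun v hv k => (h0 v hv k).trans (hg v hv).symm, h1, h2⟩

/-- A coinduction principle for smoothness. -/
theorem GateauxSmoothOn.of_closed {f : V → W} {U : Set V}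
    (T : ∀ k : ℕ, (V → (Fin k → V) → W) → Prop)
    (h0 : ∃ φ, T 0 φ ∧ ∀ v ∈ U, ∀ h, φ v h = f v)
    (hder : ∀ k φ, T k φ → ∃ φ', T (k + 1) φ' ∧ ∀ v ∈ U, ∀ h : Fin (k + 1) → V,
      Tendsto (fun t : ℝ => t⁻¹ • (φ (v + t • h (Fin.last k)) (Fin.init h) - φ v (Fin.init h)))
        (𝓝[≠] 0) (𝓝 (φ' v h)))
    (hcont : ∀ k φ, T k φ → ContinuousOn (fun p : V × (Fin k → V) => φ p.1 p.2) (U ×ˢ univ)) :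
    GateauxSmoothOn f U := by
  obtain ⟨φ0, hT0, hφ0⟩ := h0
  choose next hnext1 hnext2 using hder
  let S : ∀ k : ℕ, {φ : V → (Fin k → V) → W // T k φ} := fun k =>
    Nat.rec ⟨φ0, hT0⟩ (fun k φ => ⟨next k φ.1 φ.2, hnext1 k φ.1 φ.2⟩) k
  exact ⟨fun k => (S k).1, hφ0, fun k v hv h => hnext2 k (S k).1 (S k).2 v hv h,
    fun k => hcont k _ (S k).2⟩

theorem GateauxSmoothOn.comp_affine {V' : Type*} [AddCommGroup V'] [Module ℝ V']
    [TopologicalSpace V'] {f : V → W} {U : Set V} (h : GateauxSmoothOn f U)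
    (A : V' → V) (L : V' →ₗ[ℝ] V) (hA : Continuous A) (hL : Continuous L)
    (hAL : ∀ v w, A (v + w) = A v + L w) : GateauxSmoothOn (f ∘ A) (A ⁻¹' U) := by
  obtain ⟨D, h0, h1, h2⟩ := h
  refine ⟨fun k v h => D k (A v) (fun i => L (h i)), fun v hv h => h0 _ hv _, ?_, ?_⟩
  · intro k v hv h
    have := h1 k (A v) hv (fun i => L (h i))
    simp only [hAL, map_smul]
    exact this
  · intro k
    refine (h2 k).comp (f := fun p : V' × (Fin k → V') => (A p.1, fun i => L (p.2 i))) ?_ ?_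
    · exact Continuous.continuousOn (by fun_prop)
    · intro p hp
      exact ⟨hp.1, mem_univ _⟩

theorem GateauxSmoothOn.postcomp {W' : Type*} [AddCommGroup W'] [Module ℝ W']
    [TopologicalSpace W'] {f : V → W} {U : Set V} (h : GateauxSmoothOn f U)
    (L : W →ₗ[ℝ] W') (hL : Continuous L) : GateauxSmoothOn (fun v => L (f v)) U := by
  obtain ⟨D, h0, h1, h2⟩ := h
  refine ⟨fun k v h => L (D k v h), fun v hv h => congrArg L (h0 v hv h), ?_, ?_⟩
  · intro k v hv h
    simpa only [Function.comp_def, map_smul, map_sub] using (hL.tendsto _).comp (h1 k v hv h)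
  · intro k
    exact hL.comp_continuousOn (h2 k)

theorem gateauxSmoothOn_linear (L : V →ₗ[ℝ] W) (hL : Continuous L) (U : Set V) :
    GateauxSmoothOn L U := by
  refine ⟨fun k v h => match k, h with
    | 0, _ => L v
    | 1, h => L (h 0)
    | _ + 2, _ => 0, fun v hv h => rfl, ?_, ?_⟩
  · intro k v hv h
    match k with
    | 0 =>
      refine tendsto_const_nhds.congr' ?_
      filter_upwards [self_mem_nhdsWithin] with t ht
      have ht' : t ≠ 0 := ht
      simp [ht', smul_smul]
    | 1 => simpa [Fin.init] using tendsto_const_nhds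
    | _ + 2 => simpa using tendsto_const_nhds
  · intro k
    match k with
    | 0 => exact (hL.comp continuous_fst).continuousOn
    | 1 => exact (hL.comp ((continuous_apply 0).comp continuous_snd)).continuousOn
    | _ + 2 => exact continuousOn_const

theorem GateauxSmoothOn.add [ContinuousAdd W] {f g : V → W} {U : Set V}
    (hf : GateauxSmoothOn f U) (hg : GateauxSmoothOn g U) :
    GateauxSmoothOn (fun v => f v + g v) U := by
  obtain ⟨D, h0, h1, h2⟩ := hf
  obtain ⟨D', h0', h1', h2'⟩ := hg
  refine ⟨fun k v h => D k v h + D' k v h, fun v hv h => congrArg₂ (· + ·) (h0 v hv h) (h0' v hv h), ?_, ?_⟩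
  · intro k v hv h
    refine ((h1 k v hv h).add (h1' k v hv h)).congr fun t => ?_
    rw [← smul_add, sub_add_sub_comm]
  · intro k
    exact (h2 k).add (h2' k)

theorem GateauxSmoothOn.sum [ContinuousAdd W] {ι : Type*} {f : ι → V → W} {U : Set V}
    (s : Finset ι) (hf : ∀ i, GateauxSmoothOn (f i) U) :
    GateauxSmoothOn (fun v => ∑ i ∈ s, f i v) U := by
  classical
  induction s using Finset.induction_on with
  | empty =>
    have := gateauxSmoothOn_linear (0 : V →ₗ[ℝ] W) continuous_const U
    exact this.congr fun v _ => by simp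
  | insert a s ha ih =>
    refine ((hf a).add ih).congr fun v _ => by simp [Finset.sum_insert ha]

section Bilinear

variable {W₁ W₂ : Type*} [AddCommGroup W₁] [Module ℝ W₁] [TopologicalSpace W₁]
  [AddCommGroup W₂] [Module ℝ W₂] [TopologicalSpace W₂]

/-- The functions occurring in the higher Leibniz rule. -/
inductive LeibnizTerm (B : W₁ →ₗ[ℝ] W₂ →ₗ[ℝ] W) (D₁ : (k : ℕ) → V → (Fin k → V) → W₁)
    (D₂ : (k : ℕ) → V → (Fin k → V) → W₂) : ∀ k : ℕ, (V → (Fin k → V) → W) → Prop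
  | mul {a b k : ℕ} (e : Fin a → Fin k) (e' : Fin b → Fin k) :
      LeibnizTerm B D₁ D₂ k (fun v h => B (D₁ a v (h ∘ e)) (D₂ b v (h ∘ e')))
  | add {k : ℕ} {φ ψ : V → (Fin k → V) → W} : LeibnizTerm B D₁ D₂ k φ → LeibnizTerm B D₁ D₂ k ψ →
      LeibnizTerm B D₁ D₂ k (fun v h => φ v h + ψ v h)

theorem GateauxSmoothOn.bilinear [ContinuousAdd W] [ContinuousAdd V] [ContinuousSMul ℝ V]
    {f : V → W₁} {g : V → W₂} {U : Set V} (hU : IsOpen U)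
    (hf : GateauxSmoothOn f U) (hg : GateauxSmoothOn g U) (B : W₁ →ₗ[ℝ] W₂ →ₗ[ℝ] W)
    (hB : Continuous fun p : W₁ × W₂ => B p.1 p.2) :
    GateauxSmoothOn (fun v => B (f v) (g v)) U := by
  obtain ⟨D, h0, h1, h2⟩ := hf
  obtain ⟨D', h0', h1', h2'⟩ := hg
  refine GateauxSmoothOn.of_closed (LeibnizTerm B D D')
    ⟨_, LeibnizTerm.mul (a := 0) (b := 0) id id, fun v hv h => by rw [h0 v hv, h0' v hv]⟩ ?_ ?_
  · intro k φ hφ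
    induction hφ with
    | @mul a b k e e' =>
      refine ⟨_, LeibnizTerm.add
        (LeibnizTerm.mul (a := a + 1) (b := b) (Fin.snoc (fun i => (e i).castSucc) (Fin.last k))
          (fun i => (e' i).castSucc))
        (LeibnizTerm.mul (a := a) (b := b + 1) (fun i => (e i).castSucc)
          (Fin.snoc (fun i => (e' i).castSucc) (Fin.last k))), ?_⟩
      intro v hv h
      have key : ∀ (c : ℕ) (ε : Fin c → Fin k),
          Fin.init (h ∘ (Fin.snoc (fun i => (ε i).castSucc) (Fin.last k) : Fin (c + 1) → Fin (k + 1)))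
            = Fin.init h ∘ ε ∧
          (h ∘ (Fin.snoc (fun i => (ε i).castSucc) (Fin.last k) : Fin (c + 1) → Fin (k + 1)))
            (Fin.last c) = h (Fin.last k) := by
        intro c ε
        constructor
        · funext i; simp [Fin.init]
        · simp
      have d1 := h1 a v hv (h ∘ (Fin.snoc (fun i => (e i).castSucc) (Fin.last k)))
      have d2 := h1' b v hv (h ∘ (Fin.snoc (fun i => (e' i).castSucc) (Fin.last k)))
      rw [(key a e).1, (key a e).2] at d1
      rw [(key b e').1, (key b e').2] at d2
      have hmap : Tendsto (fun t : ℝ => v + t • h (Fin.last k)) (𝓝[≠] 0) (𝓝[U] v) := by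
        have hc : Tendsto (fun t : ℝ => v + t • h (Fin.last k)) (𝓝 0) (𝓝 v) := by
          have : Continuous (fun t : ℝ => v + t • h (Fin.last k)) := by fun_prop
          simpa using this.tendsto 0
        refine tendsto_nhdsWithin_iff.2 ⟨hc.mono_left nhdsWithin_le_nhds, ?_⟩
        exact (hc.mono_left nhdsWithin_le_nhds).eventually (hU.mem_nhds hv)
      have hc2 : Tendsto (fun t : ℝ => D' b (v + t • h (Fin.last k)) (Fin.init h ∘ e'))
          (𝓝[≠] 0) (𝓝 (D' b v (Fin.init h ∘ e'))) := by
        have hcon : ContinuousOn (fun x => D' b x (Fin.init h ∘ e')) U := by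
          refine (h2' b).comp (f := fun x => (x, Fin.init h ∘ e')) ?_ ?_
          · exact Continuous.continuousOn (by fun_prop)
          · intro x hx; exact ⟨hx, mem_univ _⟩
        exact (hcon v hv).tendsto.comp hmap
      have t1 := (hB.tendsto _).comp (d1.prodMk_nhds hc2)
      have t2 := (hB.tendsto _).comp
        ((tendsto_const_nhds (x := D a v (Fin.init h ∘ e))).prodMk_nhds d2)
      refine (t1.add t2).congr fun t => ?_
      simp only [Function.comp_apply, map_smul, LinearMap.smul_apply, map_sub, LinearMap.sub_apply]
      rw [← smul_add]
      congr 1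
      abel
    | add _ _ ih1 ih2 =>
      obtain ⟨φ', hφ', l1⟩ := ih1
      obtain ⟨ψ', hψ', l2⟩ := ih2
      refine ⟨_, hφ'.add hψ', fun v hv h => ?_⟩
      refine ((l1 v hv h).add (l2 v hv h)).congr fun t => ?_
      rw [← smul_add, sub_add_sub_comm]
  · intro k φ hφ
    induction hφ with
    | @mul a b k e e' =>
      have c1 : ContinuousOn (fun p : V × (Fin k → V) => D a p.1 (p.2 ∘ e)) (U ×ˢ univ) := by
        refine (h2 a).comp (f := fun p : V × (Fin k → V) => (p.1, p.2 ∘ e)) ?_ ?_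
        · exact Continuous.continuousOn (by fun_prop)
        · intro p hp; exact ⟨hp.1, mem_univ _⟩
      have c2 : ContinuousOn (fun p : V × (Fin k → V) => D' b p.1 (p.2 ∘ e')) (U ×ˢ univ) := by
        refine (h2' b).comp (f := fun p : V × (Fin k → V) => (p.1, p.2 ∘ e')) ?_ ?_
        · exact Continuous.continuousOn (by fun_prop)
        · intro p hp; exact ⟨hp.1, mem_univ _⟩
      exact hB.comp_continuousOn (c1.prodMk c2)
    | add _ _ ih1 ih2 => exact ih1.add ih2

end Bilinear

end Gateaux

/-! ### Loop spaces -/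

section Loops

variable {F F₁ F₂ F₃ : Type*} [NormedAddCommGroup F] [NormedSpace ℂ F]
  [NormedAddCommGroup F₁] [NormedSpace ℂ F₁] [NormedAddCommGroup F₂] [NormedSpace ℂ F₂]
  [NormedAddCommGroup F₃] [NormedSpace ℂ F₃]

/-- Smooth maps `S¹ → F` as a complex subspace of all maps. The circle is `Circle`, with base point
`0 ∈ S¹` given by `(1 : Circle)`. -/
def loopSubmodule (F : Type*) [NormedAddCommGroup F] [NormedSpace ℂ F] :
    Submodule ℂ (Circle → F) where
  carrier := {f | ContMDiff (𝓡 1) 𝓘(ℝ, F) ∞ f}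
  add_mem' := fun ha hb => ContMDiff.add ha hb
  zero_mem' := contMDiff_const
  smul_mem' := fun c _ hf =>
    ((c • (ContinuousLinearMap.id ℝ F) : F →L[ℝ] F).contMDiff).comp hf

/-- The space `LF` of smooth loops in the complex normed space `F`. -/
def LoopSpace (F : Type*) [NormedAddCommGroup F] [NormedSpace ℂ F] : Type _ :=
  ↥(loopSubmodule F)

namespace LoopSpace

instance : AddCommGroup (LoopSpace F) := inferInstanceAs (AddCommGroup ↥(loopSubmodule F))
instance : Module ℂ (LoopSpace F) := inferInstanceAs (Module ℂ ↥(loopSubmodule F))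
instance : CoeFun (LoopSpace F) (fun _ => Circle → F) := ⟨fun f => f.1⟩

theorem contMDiff (f : LoopSpace F) : ContMDiff (𝓡 1) 𝓘(ℝ, F) ∞ f := f.2

@[ext] theorem ext {f g : LoopSpace F} (h : ∀ θ, f θ = g θ) : f = g := Subtype.ext (funext h)

@[simp] theorem add_apply (f g : LoopSpace F) (θ : Circle) : (f + g) θ = f θ + g θ := rfl
@[simp] theorem smul_apply (c : ℂ) (f : LoopSpace F) (θ : Circle) : (c • f) θ = c • f θ := rfl
@[simp] theorem real_smul_apply (c : ℝ) (f : LoopSpace F) (θ : Circle) : (c • f) θ = c • f θ := rfl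

/-- The loop as a periodic function of the angle. -/
def angular (f : LoopSpace F) (t : ℝ) : F := f (Circle.exp t)

theorem contDiff_angular (f : LoopSpace F) : ContDiff ℝ ∞ f.angular :=
  contMDiff_iff_contDiff.1 (f.contMDiff.comp contMDiff_circleExp)

/-- The `k`-th derivative of a loop with respect to the angle. -/
def iterDeriv (k : ℕ) (f : LoopSpace F) : C(ℝ, F) :=
  ⟨iteratedDeriv k f.angular,
    f.contDiff_angular.continuous_iteratedDeriv k (by exact_mod_cast le_top)⟩

/-- All derivatives of a loop, as a linear map. -/
def jet (F : Type*) [NormedAddCommGroup F] [NormedSpace ℂ F] :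
    LoopSpace F →ₗ[ℝ] (ℕ → C(ℝ, F)) where
  toFun f k := f.iterDeriv k
  map_add' f g := by
    funext k; ext t
    exact iteratedDeriv_add
      (f.contDiff_angular.contDiffAt.of_le (by exact_mod_cast le_top))
      (g.contDiff_angular.contDiffAt.of_le (by exact_mod_cast le_top))
  map_smul' c f := by
    funext k; ext t
    exact iteratedDeriv_const_smul_field c f.angular

/-- The Fréchet (`C^∞`) topology on `LF`: uniform convergence of every derivative with respect to
the angle (as the derivatives are periodic, uniform convergence on `ℝ` is uniform convergence on
compact sets). -/
instance : TopologicalSpace (LoopSpace F) := TopologicalSpace.induced (jet F) inferInstance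

instance : IsTopologicalAddGroup (LoopSpace F) := topologicalAddGroup_induced (jet F)
instance : ContinuousSMul ℝ (LoopSpace F) := continuousSMul_induced (jet F)

theorem continuous_iff {T : Type*} [TopologicalSpace T] (f : T → LoopSpace F) :
    Continuous f ↔
      ∀ k, Continuous fun p : T × ℝ => iteratedDeriv k (f p.1).angular p.2 := by
  rw [continuous_induced_rng, continuous_pi_iff]
  refine forall_congr' fun k => ⟨fun h => ?_, fun h => ?_⟩
  · exact ContinuousMap.continuous_uncurry_of_continuous ⟨_, h⟩
  · exact ContinuousMap.continuous_of_continuous_uncurry _ h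

/-- A continuous family of smooth maps for the `C^∞` topology. -/
def GoodFamily {T : Type*} [TopologicalSpace T] (f : T → ℝ → F) : Prop :=
  (∀ t, ContDiff ℝ ∞ (f t)) ∧ ∀ k, Continuous fun p : T × ℝ => iteratedDeriv k (f p.1) p.2

theorem GoodFamily.deriv {T : Type*} [TopologicalSpace T] {f : T → ℝ → F} (hf : GoodFamily f) :
    GoodFamily fun t => deriv (f t) := by
  refine ⟨fun t => ((contDiff_infty_iff_deriv.1 (hf.1 t)).2), fun k => ?_⟩
  simpa only [iteratedDeriv_succ'] using hf.2 (k + 1)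

theorem continuous_iteratedDeriv_bilinear (b : F₁ →L[ℝ] F₂ →L[ℝ] F₃) {T : Type*}
    [TopologicalSpace T] (k : ℕ) : ∀ {f : T → ℝ → F₁} {g : T → ℝ → F₂}, GoodFamily f →
    GoodFamily g → Continuous fun p : T × ℝ => iteratedDeriv k (fun s => b (f p.1 s) (g p.1 s)) p.2 := by
  induction k with
  | zero =>
    intro f g hf hg
    have h1 := hf.2 0
    have h2 := hg.2 0
    simp only [iteratedDeriv_zero] at h1 h2 ⊢
    exact (b.continuous.comp h1).clm_apply h2
  | succ k ih =>
    intro f g hf hg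
    have hsm : ∀ {f : T → ℝ → F₁} {g : T → ℝ → F₂}, GoodFamily f → GoodFamily g → ∀ t,
        ContDiff ℝ ∞ (fun s => b (f t s) (g t s)) := fun hf hg t =>
      (b.contDiff.comp (hf.1 t)).clm_apply (hg.1 t)
    have h1 := ih hf.deriv hg
    have h2 := ih hf hg.deriv
    refine (h1.add h2).congr fun p => ?_
    rw [iteratedDeriv_succ', Pi.add_apply]
    rw [← iteratedDeriv_add ((hsm hf.deriv hg p.1).contDiffAt.of_le (by exact_mod_cast le_top))
      ((hsm hf hg.deriv p.1).contDiffAt.of_le (by exact_mod_cast le_top))]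
    congr 1
    funext s
    have d1 : HasDerivAt (f p.1) (_root_.deriv (f p.1) s) s :=
      ((hf.1 p.1).differentiable (by simp) s).hasDerivAt
    have d2 : HasDerivAt (g p.1) (_root_.deriv (g p.1) s) s :=
      ((hg.1 p.1).differentiable (by simp) s).hasDerivAt
    have d3 := (b.hasFDerivAt.comp_hasDerivAt s d1).clm_apply d2
    simpa [Pi.add_apply] using d3.deriv.symm

/-- The pointwise application of a continuous bilinear map to loops. -/
def bilinear (b : F₁ →L[ℝ] F₂ →L[ℝ] F₃) : LoopSpace F₁ →ₗ[ℝ] LoopSpace F₂ →ₗ[ℝ] LoopSpace F₃ :=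
  LinearMap.mk₂ ℝ
    (fun f g => ⟨fun θ => b (f θ) (g θ), (b.contMDiff.comp f.contMDiff).clm_apply g.contMDiff⟩)
    (fun f f' g => by ext θ; simp; rfl)
    (fun c f g => by ext θ; simp; rfl)
    (fun f g g' => by ext θ; simp; rfl)
    (fun c f g => by ext θ; simp; rfl)

theorem continuous_bilinear (b : F₁ →L[ℝ] F₂ →L[ℝ] F₃) :
    Continuous fun p : LoopSpace F₁ × LoopSpace F₂ => bilinear b p.1 p.2 := by
  rw [continuous_iff]
  intro k
  exact continuous_iteratedDeriv_bilinear b k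
    (f := fun p : LoopSpace F₁ × LoopSpace F₂ => p.1.angular) (g := fun p => p.2.angular)
    ⟨fun p => p.1.contDiff_angular, (continuous_iff _).1 continuous_fst⟩
    ⟨fun p => p.2.contDiff_angular, (continuous_iff _).1 continuous_snd⟩

theorem sum_apply {ι : Type*} (s : Finset ι) (f : ι → LoopSpace F) (θ : Circle) :
    (∑ i ∈ s, f i) θ = ∑ i ∈ s, f i θ := by
  classical
  induction s using Finset.induction_on with
  | empty => rfl
  | insert a s ha ih => rw [Finset.sum_insert ha, Finset.sum_insert ha, add_apply, ih]

/-- The pointwise application of a continuous linear map to loops. -/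
def mapL (a : F₁ →L[ℝ] F₂) : LoopSpace F₁ →ₗ[ℝ] LoopSpace F₂ where
  toFun f := ⟨fun θ => a (f θ), a.contMDiff.comp f.contMDiff⟩
  map_add' f g := by ext θ; exact map_add a (f θ) (g θ)
  map_smul' c f := by ext θ; exact map_smul a c (f θ)

theorem continuous_mapL (a : F₁ →L[ℝ] F₂) : Continuous (mapL a) := by
  rw [continuous_iff]
  intro k
  have h := (continuous_iff (fun f : LoopSpace F₁ => f)).1 continuous_id k
  refine (a.continuous.comp h).congr fun p => ?_
  have : (mapL a p.1).angular = a ∘ p.1.angular := rfl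
  rw [this]
  simp only [iteratedDeriv_eq_iteratedFDeriv]
  rw [a.iteratedFDeriv_comp_left p.1.contDiff_angular.contDiffAt (by exact_mod_cast le_top)]
  rfl

/-- The constant loop. -/
def const (v : F) : LoopSpace F := ⟨fun _ => v, contMDiff_const⟩

end LoopSpace

end Loops

/-! ### The groups `G = GL_n(ℂ)` and `ΩG` -/

/-- `V = ℂⁿ`. -/
abbrev Vec (n : ℕ) : Type := Fin n → ℂ

/-- `End V`. -/
abbrev EndV (n : ℕ) : Type := Vec n →L[ℂ] Vec n

/-- `G = GL(V)`, the group of units of `End V`. -/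
abbrev GLV (n : ℕ) : Type := (EndV n)ˣ

/-- `LV`. -/
abbrev LoopV (n : ℕ) : Type := LoopSpace (Vec n)

section SmoothG

variable {E' H' X : Type*} [NormedAddCommGroup E'] [NormedSpace ℝ E'] [TopologicalSpace H']
  (I : ModelWithCorners ℝ E' H') [TopologicalSpace X] [ChartedSpace H' X]

/-- Smoothness on `U` of a map from a finite dimensional manifold to a complex normed space. -/
def SmoothOn {F : Type*} [NormedAddCommGroup F] [NormedSpace ℂ F] (U : Set X) (f : X → F) : Prop :=
  ContMDiffOn I 𝓘(ℝ, F) ∞ f U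

/-- Smoothness on `U` of a map to `G`, an open subset of `End V`. -/
def GSmoothOn {n : ℕ} (U : Set X) (g : X → GLV n) : Prop :=
  SmoothOn I U fun x => (g x : EndV n)

/-- Composition in `End V` as a real bilinear map. -/
def mulB (n : ℕ) : EndV n →L[ℝ] EndV n →L[ℝ] EndV n :=
  LinearMap.mkContinuous₂ (LinearMap.mk₂ ℝ (fun a b : EndV n => a * b) add_mul
    (fun c a b => by ext; simp) mul_add (fun c a b => by ext; simp)) 1
    (fun a b => by simpa using norm_mul_le a b)

/-- Evaluation `End V × V → V` as a real bilinear map. -/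
def evalB (n : ℕ) : EndV n →L[ℝ] Vec n →L[ℝ] Vec n :=
  LinearMap.mkContinuous₂ (LinearMap.mk₂ ℝ (fun (a : EndV n) (v : Vec n) => a v)
    (fun _ _ _ => rfl) (fun c a b => by simp) (fun _ _ _ => map_add _ _ _)
    (fun c a b => by simp)) 1
    (fun a b => by simpa using a.le_opNorm b)

@[simp] theorem mulB_apply {n : ℕ} (a b : EndV n) : mulB n a b = a * b := rfl
@[simp] theorem evalB_apply {n : ℕ} (a : EndV n) (v : Vec n) : evalB n a v = a v := rfl

/-- The `j`-th unit vector. -/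
def unitVec {n : ℕ} (j : Fin n) : Vec n := Pi.single j 1

/-- The endomorphism with `j`-th column `w` and all other columns zero. -/
def colL {n : ℕ} (j : Fin n) : Vec n →L[ℝ] EndV n :=
  LinearMap.toContinuousLinearMap
    { toFun := fun w => (ContinuousLinearMap.proj j : Vec n →L[ℂ] ℂ).smulRight w
      map_add' := fun a b => by ext; simp [mul_add]
      map_smul' := fun c a => by ext; simp [mul_left_comm] }

theorem colL_sum {n : ℕ} (a : EndV n) : ∑ j, colL j (a (unitVec j)) = a := by
  ext v : 1
  conv_rhs => rw [show v = ∑ j, v j • unitVec j by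
    funext i; simp [unitVec, Finset.sum_apply, Pi.single_apply]]
  simp [colL]

end SmoothG

/-- Smooth loops in `G` taking the base point of the circle to the identity, as a subgroup of the
group of all maps `S¹ → G`. -/
def omegaSubgroup (n : ℕ) : Subgroup (Circle → GLV n) where
  carrier := {γ | ContMDiff (𝓡 1) 𝓘(ℝ, EndV n) ∞ (fun θ => (γ θ : EndV n)) ∧ γ 1 = 1}
  one_mem' := ⟨contMDiff_const, rfl⟩
  mul_mem' := fun {a b} ha hb =>
    ⟨((mulB n).contMDiff.comp ha.1).clm_apply hb.1, by simp [ha.2, hb.2]⟩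
  inv_mem' := fun {a} ha => by
    refine ⟨fun θ => ?_, by simp [ha.2]⟩
    have h1 : ContMDiffAt 𝓘(ℝ, EndV n) 𝓘(ℝ, EndV n) ∞ Ring.inverse ((a θ : GLV n) : EndV n) :=
      (contDiffAt_ringInverse ℝ (a θ)).contMDiffAt
    have h2 := h1.comp θ (ha.1 θ)
    refine h2.congr_of_eventuallyEq (Eventually.of_forall fun θ' => ?_)
    simp

/-- The based loop group `ΩG`, with the pointwise group structure. -/
def OmegaG (n : ℕ) : Type := ↥(omegaSubgroup n)

namespace OmegaG

instance (n : ℕ) : Group (OmegaG n) := inferInstanceAs (Group ↥(omegaSubgroup n))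

variable {n : ℕ}

/-- A based loop in `G` as a loop in `End V`. As a Fréchet manifold `ΩG` is the open subset
`{γ | γ(θ) invertible for all θ}` of the closed affine subspace `{γ | γ(0) = 1}` of `L(End V)`. -/
def toLoop (γ : OmegaG n) : LoopSpace (EndV n) := ⟨fun θ => (γ.1 θ : EndV n), γ.2.1⟩

theorem toLoop_mul (γ δ : OmegaG n) :
    (γ * δ).toLoop = LoopSpace.bilinear (mulB n) γ.toLoop δ.toLoop := rfl

/-- The loop (pointwise) representation of `ΩG` on `LV`. -/
instance : SMul (OmegaG n) (LoopV n) := ⟨fun γ v => LoopSpace.bilinear (evalB n) γ.toLoop v⟩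

theorem smul_def (γ : OmegaG n) (v : LoopV n) :
    γ • v = LoopSpace.bilinear (evalB n) γ.toLoop v := rfl

theorem smul_apply (γ : OmegaG n) (v : LoopV n) (θ : Circle) :
    (γ • v) θ = (γ.1 θ : EndV n) (v θ) := rfl

instance : DistribMulAction (OmegaG n) (LoopV n) where
  one_smul _ := rfl
  mul_smul _ _ _ := rfl
  smul_zero _ := map_zero _
  smul_add _ v w := map_add _ v w

instance : SMulCommClass (OmegaG n) ℂ (LoopV n) :=
  ⟨fun γ c v => LoopSpace.ext fun θ => (γ.1 θ : EndV n).map_smul c (v θ)⟩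

instance : FaithfulSMul (OmegaG n) (LoopV n) :=
  ⟨fun {_ _} h => Subtype.ext <| funext fun θ => Units.ext <| ContinuousLinearMap.ext fun v =>
    congrFun (congrArg Subtype.val (h (LoopSpace.const v))) θ⟩

end OmegaG

instance (n : ℕ) : SMulCommClass (GLV n) ℂ (Vec n) :=
  ⟨fun g c v => (g : EndV n).map_smul c v⟩

instance (n : ℕ) : FaithfulSMul (GLV n) (Vec n) :=
  ⟨fun {_ _} h => Units.ext <| ContinuousLinearMap.ext fun v => h v⟩

/-! ### Fibre models: a structure group acting on a typical fibre -/

/-- A structure group `H` acting linearly on a typical fibre `F`, together with the notions of smooth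
maps `U → H` and `U × F → F` for `U ⊆ X` open. It is only used for the two models `omegaModel`
(`H = ΩG`, `F = LV`) and `finModel` (`H = G`, `F = V`) below. -/
structure BundleModel (X H F : Type*) [TopologicalSpace X] [Group H] [AddCommGroup F] [Module ℂ F]
    [DistribMulAction H F] where
  /-- smooth maps `U → H` -/
  SmoothMap : Set X → (X → H) → Prop
  /-- smooth maps `U × F → F` -/
  SmoothRep : Set X → (X × F → F) → Prop
  mono : ∀ {U W : Set X} {g : X → H}, W ⊆ U → SmoothMap U g → SmoothMap W g
  mul : ∀ {U : Set X} {g h : X → H}, IsOpen U → SmoothMap U g → SmoothMap U h →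
    SmoothMap U (fun x => g x * h x)
  rep_iff : ∀ {U : Set X} {g : X → H} {r : X × F → F}, IsOpen U →
    (∀ x ∈ U, ∀ v, r (x, v) = g x • v) → (SmoothRep U r ↔ SmoothMap U g)

section Models

variable (E M : Type*) [NormedAddCommGroup E] [NormedSpace ℝ E] [TopologicalSpace M]
  [ChartedSpace E M]

/-- Smoothness on the open set `U` of a map from the manifold `M` (modelled on `E`) to the Fréchet
Lie group `ΩG`. -/
def OmegaSmoothOn {n : ℕ} (U : Set M) (g : M → OmegaG n) : Prop :=
  ∀ e ∈ atlas E M, GateauxSmoothOn (fun y : E => (g (e.symm y)).toLoop) (e.target ∩ e.symm ⁻¹' U)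

/-- Smoothness on `U × LV`, `U` open in `M`, of a map to `LV`. -/
def OmegaSmoothRep {n : ℕ} (U : Set M) (r : M × LoopV n → LoopV n) : Prop :=
  ∀ e ∈ atlas E M, GateauxSmoothOn (fun p : E × LoopV n => r (e.symm p.1, p.2))
    ((e.target ∩ e.symm ⁻¹' U) ×ˢ univ)

/-- The model of `Ω` vector bundles: `ΩG` acting on `LV`, over `M`. -/
def omegaModel (n : ℕ) : BundleModel M (OmegaG n) (LoopV n) where
  SmoothMap := OmegaSmoothOn E M
  SmoothRep := OmegaSmoothRep E M
  mono := fun hWU h e he => (h e he).mono (inter_subset_inter_right _ (preimage_mono hWU))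
  mul := fun hU hg hh e he =>
    (hg e he).bilinear (e.isOpen_inter_preimage_symm hU) (hh e he) _
      (LoopSpace.continuous_bilinear (mulB n))
  rep_iff := by
    intro U g r hU hr
    constructor
    · intro h e he
      have hop : IsOpen (e.target ∩ e.symm ⁻¹' U) := e.isOpen_inter_preimage_symm hU
      have key : ∀ j : Fin n, GateauxSmoothOn (fun y : E =>
          LoopSpace.mapL (colL j) (r (e.symm y, LoopSpace.const (unitVec j))))
          (e.target ∩ e.symm ⁻¹' U) := by
        intro j
        have h1 := (h e he).comp_affine (V' := E) (fun y => (y, LoopSpace.const (unitVec j)))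
          (LinearMap.inl ℝ E (LoopV n)) (by fun_prop)
          (by change Continuous fun y : E => (y, (0 : LoopV n)); fun_prop)
          (fun v w => by simp)
        have h2 := h1.postcomp (LoopSpace.mapL (colL j)) (LoopSpace.continuous_mapL (colL j))
        exact h2.mono fun y hy => ⟨hy, mem_univ _⟩
      refine (GateauxSmoothOn.sum Finset.univ key).congr fun y hy => ?_
      have : ∀ j, r (e.symm y, LoopSpace.const (unitVec j)) =
        g (e.symm y) • LoopSpace.const (unitVec j) := fun j => hr _ hy.2 _
      simp only [this]
      refine LoopSpace.ext fun θ => ?_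
      rw [LoopSpace.sum_apply]
      exact (colL_sum (((g (e.symm y)).1 θ : GLV n) : EndV n)).symm
    · intro h e he
      have hop : IsOpen (e.target ∩ e.symm ⁻¹' U) := e.isOpen_inter_preimage_symm hU
      have h1 := (h e he).comp_affine (V' := E × LoopV n) Prod.fst (LinearMap.fst ℝ E (LoopV n))
        continuous_fst continuous_fst (fun _ _ => rfl)
      have h2 := gateauxSmoothOn_linear (LinearMap.snd ℝ E (LoopV n)) continuous_snd
        ((e.target ∩ e.symm ⁻¹' U) ×ˢ univ)
      have h3 := (h1.mono (U' := (e.target ∩ e.symm ⁻¹' U) ×ˢ univ) (fun p hp => hp.1)).bilinear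
        (hop.prod isOpen_univ) h2 _ (LoopSpace.continuous_bilinear (evalB n))
      exact h3.congr fun p hp => hr _ hp.1.2 _

end Models

section FinModel

variable {E' H' : Type*} [NormedAddCommGroup E'] [NormedSpace ℝ E'] [TopologicalSpace H']
  (I : ModelWithCorners ℝ E' H') (X : Type*) [TopologicalSpace X] [ChartedSpace H' X]

/-- The model of complex vector bundles of rank `n`: `G` acting on `V`, over `X`. -/
def finModel (n : ℕ) : BundleModel X (GLV n) (Vec n) where
  SmoothMap := GSmoothOn I
  SmoothRep U r := SmoothOn (I.prod 𝓘(ℝ, Vec n)) (U ×ˢ (univ : Set (Vec n))) r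
  mono := fun hWU h => ContMDiffOn.mono h hWU
  mul := fun {U g h} _ hg hh => by
    have hg' : ContMDiffOn I 𝓘(ℝ, EndV n) ∞ (fun x => (g x : EndV n)) U := hg
    have hh' : ContMDiffOn I 𝓘(ℝ, EndV n) ∞ (fun x => (h x : EndV n)) U := hh
    exact ((mulB n).contMDiff.comp_contMDiffOn hg').clm_apply hh'
  rep_iff := by
    intro U g r _ hr
    constructor
    · intro h
      have h' : ContMDiffOn (I.prod 𝓘(ℝ, Vec n)) 𝓘(ℝ, Vec n) ∞ r (U ×ˢ univ) := h
      have key : ∀ j : Fin n, ContMDiffOn I 𝓘(ℝ, EndV n) ∞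
          (fun x => colL j (r (x, unitVec j))) U := fun j =>
        (colL j).contMDiff.comp_contMDiffOn
          (h'.comp (contMDiff_id.prodMk contMDiff_const).contMDiffOn
            (fun x hx => ⟨hx, mem_univ _⟩))
      have hs : ContMDiffOn I 𝓘(ℝ, EndV n) ∞ (fun x => ∑ j, colL j (r (x, unitVec j))) U :=
        contMDiffOn_finsetSum fun j _ => key j
      refine hs.congr fun x hx => ?_
      simp only [hr x hx]
      exact (colL_sum (g x : EndV n)).symm
    · intro h
      have h' : ContMDiffOn I 𝓘(ℝ, EndV n) ∞ (fun x => (g x : EndV n)) U := h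
      have h1 : ContMDiffOn (I.prod 𝓘(ℝ, Vec n)) 𝓘(ℝ, EndV n) ∞
          (fun p : X × Vec n => (g p.1 : EndV n)) (U ×ˢ univ) :=
        h'.comp contMDiff_fst.contMDiffOn fun p hp => hp.1
      have h2 : ContMDiffOn (I.prod 𝓘(ℝ, Vec n)) 𝓘(ℝ, Vec n) ∞
          (fun p : X × Vec n => p.2) (U ×ˢ univ) := contMDiff_snd.contMDiffOn
      exact (((evalB n).contMDiff.comp_contMDiffOn h1).clm_apply h2).congr
        fun p hp => hr p.1 hp.1 p.2

end FinModel

/-! ### Principal bundles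

A bundle over `X` is given by its fibres together with a family of local trivialisations whose
transition functions are smooth; the total space is the disjoint union of the fibres, with the manifold
structure for which the trivialisations are diffeomorphisms. -/

open TopologicalSpace (Opens)

section Bundles

variable {X H F : Type*} [TopologicalSpace X] [Group H] [AddCommGroup F] [Module ℂ F]
  [DistribMulAction H F]

/-- A section, over an open set, of a family of sets. -/
structure LocalSection (fib : X → Type v) where
  base : Opens X
  val : ∀ x, x ∈ base → fib x

variable (X H) in
/-- The data of a principal `H`-bundle over `X`: fibres, right action of `H` on the fibres, and the
distinguished local sections. A local section `s` corresponds to the local trivialisation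
`(x, h) ↦ s(x)h`. -/
structure PrePrincipalBundle where
  fib : X → Type v
  act : ∀ {x}, fib x → H → fib x
  atlas : Set (LocalSection fib)

namespace PrePrincipalBundle

/-- The laws of a smooth principal `H`-bundle. -/
structure IsPrincipal (𝒮 : BundleModel X H F) (P : PrePrincipalBundle.{v} X H) : Prop where
  act_one : ∀ {x} (p : P.fib x), P.act p 1 = p
  act_mul : ∀ {x} (p : P.fib x) (g h : H), P.act p (g * h) = P.act (P.act p g) h
  /-- the action on each fibre is free and transitive -/
  existsUnique_act : ∀ {x} (p q : P.fib x), ∃! h : H, P.act p h = q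
  /-- local triviality -/
  cover : ∀ x, ∃ s ∈ P.atlas, x ∈ s.base
  /-- the transition functions are smooth maps to `H` -/
  transition : ∀ s ∈ P.atlas, ∀ t ∈ P.atlas, ∃ g : X → H,
    𝒮.SmoothMap (s.base ∩ t.base : Set X) g ∧
      ∀ x (hs : x ∈ s.base) (ht : x ∈ t.base), t.val x ht = P.act (s.val x hs) (g x)

/-- Smoothness of an equivariant map `f : P → Q` covering the identity: around each point and with
respect to all distinguished local sections `s`, `t`, one has `f(s(y)) = t(y)g(y)` for a smooth
`H`-valued `g`. (By equivariance `f` reads `(y, h) ↦ (y, g(y)h)` in the trivialisations.) -/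
def SmoothMap (𝒮 : BundleModel X H F) (P Q : PrePrincipalBundle.{v} X H)
    (f : ∀ x, P.fib x → Q.fib x) : Prop :=
  ∀ s ∈ P.atlas, ∀ t ∈ Q.atlas, ∀ x ∈ s.base, x ∈ t.base →
    ∃ W : Opens X, x ∈ W ∧ ∃ g : X → H, 𝒮.SmoothMap W g ∧
      ∀ y ∈ W, ∃ (hs : y ∈ s.base) (ht : y ∈ t.base), f y (s.val y hs) = Q.act (t.val y ht) (g y)

end PrePrincipalBundle

/-- A smooth principal `H`-bundle over `X`. -/
structure PrincipalBundle (𝒮 : BundleModel X H F) extends PrePrincipalBundle.{v} X H where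
  isPrincipal : toPrePrincipalBundle.IsPrincipal 𝒮

namespace PrincipalBundle

variable {𝒮 : BundleModel X H F}

/-- A point of the fibre. -/
def point (P : PrincipalBundle.{v} 𝒮) (x : X) : P.fib x :=
  (P.isPrincipal.cover x).choose.val x (P.isPrincipal.cover x).choose_spec.2

theorem act_inj (P : PrincipalBundle.{v} 𝒮) {x : X} {p : P.fib x} {g h : H}
    (hgh : P.act p g = P.act p h) : g = h :=
  (P.isPrincipal.existsUnique_act p (P.act p h)).unique hgh rfl

/-- Bundle maps covering the identity: equivariant diffeomorphisms of the total spaces. -/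
@[ext] structure Hom (P Q : PrincipalBundle.{v} 𝒮) where
  map : ∀ x, P.fib x ≃ Q.fib x
  equivariant : ∀ {x} (p : P.fib x) (h : H), map x (P.act p h) = Q.act (map x p) h
  smooth : PrePrincipalBundle.SmoothMap 𝒮 P.toPrePrincipalBundle Q.toPrePrincipalBundle
    fun x => map x
  smooth_symm : PrePrincipalBundle.SmoothMap 𝒮 Q.toPrePrincipalBundle P.toPrePrincipalBundle
    fun x => (map x).symm

theorem smoothMap_id (P : PrincipalBundle.{v} 𝒮) :
    PrePrincipalBundle.SmoothMap 𝒮 P.toPrePrincipalBundle P.toPrePrincipalBundle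
      fun _ p => p := by
  intro s hs t ht x hxs hxt
  obtain ⟨g, hg, h⟩ := P.isPrincipal.transition t ht s hs
  exact ⟨t.base ⊓ s.base, ⟨hxt, hxs⟩, g, hg, fun y hy => ⟨hy.2, hy.1, h y hy.1 hy.2⟩⟩

theorem smoothMap_comp {P Q R : PrincipalBundle.{v} 𝒮} {f : ∀ x, P.fib x → Q.fib x}
    {f' : ∀ x, Q.fib x → R.fib x}
    (hequiv : ∀ {x} (p : Q.fib x) (h : H), f' x (Q.act p h) = R.act (f' x p) h)
    (hf : PrePrincipalBundle.SmoothMap 𝒮 P.toPrePrincipalBundle Q.toPrePrincipalBundle f)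
    (hf' : PrePrincipalBundle.SmoothMap 𝒮 Q.toPrePrincipalBundle R.toPrePrincipalBundle f') :
    PrePrincipalBundle.SmoothMap 𝒮 P.toPrePrincipalBundle R.toPrePrincipalBundle
      fun x p => f' x (f x p) := by
  intro s hs t ht x hxs hxt
  obtain ⟨r, hr, hxr⟩ := Q.isPrincipal.cover x
  obtain ⟨W, hxW, g, hg, h⟩ := hf s hs r hr x hxs hxr
  obtain ⟨W', hxW', g', hg', h'⟩ := hf' r hr t ht x hxr hxt
  refine ⟨W ⊓ W', ⟨hxW, hxW'⟩, fun y => g' y * g y, 𝒮.mul (W ⊓ W').isOpen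
    (𝒮.mono inter_subset_right hg') (𝒮.mono inter_subset_left hg), fun y hy => ?_⟩
  obtain ⟨hs1, hr1, e1⟩ := h y hy.1
  obtain ⟨hr2, ht2, e2⟩ := h' y hy.2
  refine ⟨hs1, ht2, ?_⟩
  change f' y (f y _) = R.act _ (g' y * g y)
  rw [e1, hequiv, e2, R.isPrincipal.act_mul]

/-- The identity bundle map. -/
def Hom.id (P : PrincipalBundle.{v} 𝒮) : Hom P P :=
  ⟨fun _ => Equiv.refl _, fun _ _ => rfl, P.smoothMap_id, P.smoothMap_id⟩

/-- The inverse of a bundle map. -/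
def Hom.symm {P Q : PrincipalBundle.{v} 𝒮} (f : Hom P Q) : Hom Q P where
  map x := (f.map x).symm
  equivariant q h := by rw [Equiv.symm_apply_eq, f.equivariant, Equiv.apply_symm_apply]
  smooth := f.smooth_symm
  smooth_symm := f.smooth

/-- The composition of bundle maps. -/
def Hom.comp {P Q R : PrincipalBundle.{v} 𝒮} (f : Hom P Q) (f' : Hom Q R) : Hom P R where
  map x := (f.map x).trans (f'.map x)
  equivariant p h := by simp [f.equivariant, f'.equivariant]
  smooth := smoothMap_comp (f := fun x => f.map x) (f' := fun x => f'.map x)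
    (fun p h => f'.equivariant p h) f.smooth f'.smooth
  smooth_symm := smoothMap_comp (f := fun x => (f'.map x).symm) (f' := fun x => (f.map x).symm)
    (fun p h => f.symm.equivariant p h) f'.smooth_symm f.smooth_symm

/-- The groupoid of principal bundles over `X` and bundle maps covering the identity. -/
instance : Groupoid (PrincipalBundle.{v} 𝒮) where
  Hom := Hom
  id := Hom.id
  comp := Hom.comp
  inv := Hom.symm
  id_comp _ := rfl
  comp_id _ := rfl
  assoc _ _ _ := rfl
  inv_comp f := Hom.ext <| funext fun x => Equiv.ext fun p => (f.map x).apply_symm_apply p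
  comp_inv f := Hom.ext <| funext fun x => Equiv.ext fun p => (f.map x).symm_apply_apply p

end PrincipalBundle

/-! ### Vector bundles with structure group -/

variable (F) in
/-- A linear local trivialisation of a family of complex vector spaces. -/
structure LocalTriv (fib : X → Type v) [∀ x, AddCommGroup (fib x)] [∀ x, Module ℂ (fib x)] where
  base : Opens X
  triv : ∀ x, x ∈ base → (fib x ≃ₗ[ℂ] F)

/-- A vector bundle over `X` with typical fibre `F` and structure group `H`: there is a preferred
family of local trivialisations whose transition functions are smooth maps to `H`. -/
structure StrVectorBundle (𝒮 : BundleModel X H F) where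
  fib : X → Type v
  [addCommGroup : ∀ x, AddCommGroup (fib x)]
  [module : ∀ x, Module ℂ (fib x)]
  atlas : Set (LocalTriv F fib)
  cover : ∀ x, ∃ ψ ∈ atlas, x ∈ ψ.base
  transition : ∀ ψ ∈ atlas, ∀ φ ∈ atlas, ∃ g : X → H,
    𝒮.SmoothMap (ψ.base ∩ φ.base : Set X) g ∧
      ∀ x (hψ : x ∈ ψ.base) (hφ : x ∈ φ.base) (w : F),
        φ.triv x hφ ((ψ.triv x hψ).symm w) = g x • w

attribute [instance] StrVectorBundle.addCommGroup StrVectorBundle.module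

namespace StrVectorBundle

variable {𝒮 : BundleModel X H F}

/-- The frames at `x` (in the reduction of the frame bundle to `H`): linear isomorphisms `F → E_x`
of the form `ψ_x⁻¹ ∘ h` with `ψ` in the preferred family of trivialisations and `h ∈ H`. -/
def IsFrame (E : StrVectorBundle.{v} 𝒮) {x : X} (p : F ≃ₗ[ℂ] E.fib x) : Prop :=
  ∃ ψ ∈ E.atlas, ∃ hx : x ∈ ψ.base, ∃ h : H, ∀ w, p w = (ψ.triv x hx).symm (h • w)

theorem isFrame_triv_symm (E : StrVectorBundle.{v} 𝒮) {x : X} {ψ : LocalTriv F E.fib}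
    (hψ : ψ ∈ E.atlas) (hx : x ∈ ψ.base) : E.IsFrame (ψ.triv x hx).symm :=
  ⟨ψ, hψ, hx, 1, fun w => by rw [one_smul]⟩

theorem IsFrame.exists_smul {E : StrVectorBundle.{v} 𝒮} {x : X} {p q : F ≃ₗ[ℂ] E.fib x}
    (hp : E.IsFrame p) (hq : E.IsFrame q) : ∃ h : H, ∀ w, q w = p (h • w) := by
  obtain ⟨ψ, hψ, hx, a, ha⟩ := hp
  obtain ⟨φ, hφ, hx', b, hb⟩ := hq
  obtain ⟨g, -, hg⟩ := E.transition φ hφ ψ hψ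
  refine ⟨a⁻¹ * (g x * b), fun w => ?_⟩
  rw [hb, ha, mul_smul, smul_inv_smul, mul_smul, ← hg x hx' hx, LinearEquiv.symm_apply_apply]

/-- Smoothness, as a map of total spaces, of a map `f : E → E'` covering the identity: all its
expressions `(y, w) ↦ φ_y(f(ψ_y⁻¹(w)))` in local trivialisations are smooth maps to `F`, near each
point of the base. -/
def IsSmooth (E E' : StrVectorBundle.{v} 𝒮) (f : ∀ x, E.fib x → E'.fib x) : Prop :=
  ∀ ψ ∈ E.atlas, ∀ φ ∈ E'.atlas, ∀ x ∈ ψ.base, x ∈ φ.base →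
    ∃ W : Opens X, x ∈ W ∧ ∃ r : X × F → F, 𝒮.SmoothRep W r ∧
      ∀ y ∈ W, ∃ (hψ : y ∈ ψ.base) (hφ : y ∈ φ.base),
        ∀ w, r (y, w) = φ.triv y hφ (f y ((ψ.triv y hψ).symm w))

/-- The map `f : E → E'` is on each fibre, with respect to arbitrary frames, given by the action of
an element of `H`. -/
def PreservesStructure (E E' : StrVectorBundle.{v} 𝒮) (f : ∀ x, E.fib x → E'.fib x) : Prop :=
  ∀ x (p : F ≃ₗ[ℂ] E.fib x) (q : F ≃ₗ[ℂ] E'.fib x), E.IsFrame p → E'.IsFrame q →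
    ∃ h : H, ∀ w, q.symm (f x (p w)) = h • w

/-- Isomorphisms of vector bundles with structure group `H`, covering the identity: `f` and `f⁻¹`
are smooth, linear on the fibres, and given by elements of `H` in any frames. -/
@[ext] structure Hom (E E' : StrVectorBundle.{v} 𝒮) where
  map : ∀ x, E.fib x ≃ₗ[ℂ] E'.fib x
  structural : PreservesStructure E E' fun x => map x
  structural_symm : PreservesStructure E' E fun x => (map x).symm
  smooth : IsSmooth E E' fun x => map x
  smooth_symm : IsSmooth E' E fun x => (map x).symm

/-- A smooth structure preserving map is locally given by a smooth map to `H`. -/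
theorem exists_smoothMap {E E' : StrVectorBundle.{v} 𝒮} {f : ∀ x, E.fib x → E'.fib x}
    (h1 : PreservesStructure E E' f) (h2 : IsSmooth E E' f) {ψ : LocalTriv F E.fib}
    (hψ : ψ ∈ E.atlas) {φ : LocalTriv F E'.fib} (hφ : φ ∈ E'.atlas) {x : X} (hx : x ∈ ψ.base)
    (hx' : x ∈ φ.base) : ∃ W : Opens X, x ∈ W ∧ ∃ g : X → H, 𝒮.SmoothMap W g ∧
      ∀ y ∈ W, ∃ (hψ : y ∈ ψ.base) (hφ : y ∈ φ.base),
        ∀ w, φ.triv y hφ (f y ((ψ.triv y hψ).symm w)) = g y • w := by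
  classical
  obtain ⟨W, hxW, r, hr, h⟩ := h2 ψ hψ φ hφ x hx hx'
  have key : ∀ y : X, ∃ k : H, ∀ (_ : y ∈ W) (hψ : y ∈ ψ.base) (hφ : y ∈ φ.base),
      ∀ w, φ.triv y hφ (f y ((ψ.triv y hψ).symm w)) = k • w := by
    intro y
    by_cases hy : y ∈ W
    · obtain ⟨a, b, -⟩ := h y hy
      obtain ⟨k, hk⟩ := h1 y _ _ (E.isFrame_triv_symm hψ a) (E'.isFrame_triv_symm hφ b)
      exact ⟨k, fun _ _ _ w => hk w⟩
    · exact ⟨1, fun hy' => (hy hy').elim⟩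
  choose g hg using key
  refine ⟨W, hxW, g, (𝒮.rep_iff W.isOpen fun y hy w => ?_).1 hr, fun y hy => ?_⟩
  · obtain ⟨a, b, e⟩ := h y hy
    rw [e, hg y hy a b]
  · obtain ⟨a, b, -⟩ := h y hy
    exact ⟨a, b, hg y hy a b⟩

theorem isSmooth_of_smoothMap {E E' : StrVectorBundle.{v} 𝒮} {f : ∀ x, E.fib x → E'.fib x}
    (h : ∀ ψ ∈ E.atlas, ∀ φ ∈ E'.atlas, ∀ x ∈ ψ.base, x ∈ φ.base →
      ∃ W : Opens X, x ∈ W ∧ ∃ g : X → H, 𝒮.SmoothMap W g ∧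
      ∀ y ∈ W, ∃ (hψ : y ∈ ψ.base) (hφ : y ∈ φ.base),
        ∀ w, φ.triv y hφ (f y ((ψ.triv y hψ).symm w)) = g y • w) : IsSmooth E E' f := by
  intro ψ hψ φ hφ x hx hx'
  obtain ⟨W, hxW, g, hg, hh⟩ := h ψ hψ φ hφ x hx hx'
  refine ⟨W, hxW, fun p => g p.1 • p.2, (𝒮.rep_iff W.isOpen fun _ _ _ => rfl).2 hg, fun y hy => ?_⟩
  obtain ⟨a, b, e⟩ := hh y hy
  exact ⟨a, b, fun w => (e w).symm⟩

theorem isSmooth_id (E : StrVectorBundle.{v} 𝒮) : IsSmooth E E fun _ e => e :=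
  isSmooth_of_smoothMap fun ψ hψ φ hφ x hx hx' => by
    obtain ⟨g, hg, h⟩ := E.transition ψ hψ φ hφ
    exact ⟨ψ.base ⊓ φ.base, ⟨hx, hx'⟩, g, hg, fun y hy => ⟨hy.1, hy.2, h y hy.1 hy.2⟩⟩

theorem preservesStructure_id (E : StrVectorBundle.{v} 𝒮) :
    PreservesStructure E E fun _ e => e := by
  intro x p q hp hq
  obtain ⟨h, hh⟩ := hq.exists_smul hp
  exact ⟨h, fun w => by rw [hh, LinearEquiv.symm_apply_apply]⟩

theorem preservesStructure_comp {E E' E'' : StrVectorBundle.{v} 𝒮} {f : ∀ x, E.fib x → E'.fib x}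
    {f' : ∀ x, E'.fib x → E''.fib x} (hf : PreservesStructure E E' f)
    (hf' : PreservesStructure E' E'' f') : PreservesStructure E E'' fun x e => f' x (f x e) := by
  intro x p q hp hq
  obtain ⟨ψ, hψ, hx⟩ := E'.cover x
  have hr := E'.isFrame_triv_symm hψ hx
  obtain ⟨h, hh⟩ := hf x p _ hp hr
  obtain ⟨h', hh'⟩ := hf' x _ q hr hq
  refine ⟨h' * h, fun w => ?_⟩
  rw [mul_smul, ← hh, ← hh', LinearEquiv.apply_symm_apply]

theorem isSmooth_comp {E E' E'' : StrVectorBundle.{v} 𝒮} {f : ∀ x, E.fib x → E'.fib x}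
    {f' : ∀ x, E'.fib x → E''.fib x} (hf : PreservesStructure E E' f)
    (hf' : PreservesStructure E' E'' f') (sf : IsSmooth E E' f) (sf' : IsSmooth E' E'' f') :
    IsSmooth E E'' fun x e => f' x (f x e) :=
  isSmooth_of_smoothMap fun ψ hψ χ hχ x hx hx' => by
    obtain ⟨φ, hφ, hxφ⟩ := E'.cover x
    obtain ⟨W, hxW, g, hg, h⟩ := exists_smoothMap hf sf hψ hφ hx hxφ
    obtain ⟨W', hxW', g', hg', h'⟩ := exists_smoothMap hf' sf' hφ hχ hxφ hx'
    refine ⟨W ⊓ W', ⟨hxW, hxW'⟩, fun y => g' y * g y, 𝒮.mul (W ⊓ W').isOpen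
      (𝒮.mono inter_subset_right hg') (𝒮.mono inter_subset_left hg), fun y hy => ?_⟩
    obtain ⟨a, b, e⟩ := h y hy.1
    obtain ⟨b', c, e'⟩ := h' y hy.2
    refine ⟨a, c, fun w => ?_⟩
    rw [mul_smul, ← e w, ← e', LinearEquiv.symm_apply_apply]

/-- The identity. -/
def Hom.id (E : StrVectorBundle.{v} 𝒮) : Hom E E :=
  ⟨fun _ => LinearEquiv.refl ℂ _, E.preservesStructure_id, E.preservesStructure_id,
    E.isSmooth_id, E.isSmooth_id⟩

/-- The inverse isomorphism. -/
def Hom.symm {E E' : StrVectorBundle.{v} 𝒮} (f : Hom E E') : Hom E' E :=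
  ⟨fun x => (f.map x).symm, f.structural_symm, f.structural, f.smooth_symm, f.smooth⟩

/-- The composition of isomorphisms. -/
def Hom.comp {E E' E'' : StrVectorBundle.{v} 𝒮} (f : Hom E E') (f' : Hom E' E'') : Hom E E'' where
  map x := (f.map x).trans (f'.map x)
  structural := preservesStructure_comp (f := fun x => f.map x) (f' := fun x => f'.map x)
    f.structural f'.structural
  structural_symm := preservesStructure_comp (f := fun x => (f'.map x).symm) (f' := fun x => (f.map x).symm)
    f'.structural_symm f.structural_symm
  smooth := isSmooth_comp (f := fun x => f.map x) (f' := fun x => f'.map x)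
    f.structural f'.structural f.smooth f'.smooth
  smooth_symm := isSmooth_comp (f := fun x => (f'.map x).symm) (f' := fun x => (f.map x).symm)
    f'.structural_symm f.structural_symm f'.smooth_symm f.smooth_symm

/-- The groupoid of vector bundles over `X` with structure group `H` and typical fibre `F`. -/
instance : Groupoid (StrVectorBundle.{v} 𝒮) where
  Hom := Hom
  id := Hom.id
  comp := Hom.comp
  inv := Hom.symm
  id_comp _ := rfl
  comp_id _ := rfl
  assoc _ _ _ := rfl
  inv_comp f := Hom.ext <| funext fun x => LinearEquiv.ext fun e => (f.map x).apply_symm_apply e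
  comp_inv f := Hom.ext <| funext fun x => LinearEquiv.ext fun e => (f.map x).symm_apply_apply e

end StrVectorBundle

end Bundles

/-! ### The frame bundle and the associated vector bundle -/

section FrameAssoc

variable {X : Type*} {H F : Type} [TopologicalSpace X] [Group H] [AddCommGroup F] [Module ℂ F]
  [DistribMulAction H F]

/-- The action of `h ∈ H` on `F` as a linear automorphism. -/
def smulEquiv (F : Type) [AddCommGroup F] [Module ℂ F] [DistribMulAction H F]
    [SMulCommClass H ℂ F] (h : H) : F ≃ₗ[ℂ] F :=
  DistribMulAction.toLinearEquiv ℂ F h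

@[simp] theorem smulEquiv_apply [SMulCommClass H ℂ F] (h : H) (w : F) : smulEquiv F h w = h • w := rfl

section Frame

variable {𝒮 : BundleModel X H F}

theorem StrVectorBundle.IsFrame.map {E E' : StrVectorBundle.{v} 𝒮} (f : StrVectorBundle.Hom E E')
    {x : X} {p : F ≃ₗ[ℂ] E.fib x} (hp : E.IsFrame p) : E'.IsFrame (p.trans (f.map x)) := by
  obtain ⟨φ, hφ, hx⟩ := E'.cover x
  obtain ⟨h, hh⟩ := f.structural x p _ hp (E'.isFrame_triv_symm hφ hx)
  exact ⟨φ, hφ, hx, h, fun w => by rw [← hh w]; simp⟩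

variable [SMulCommClass H ℂ F]

/-- The data of the frame bundle: the fibre over `x` consists of the frames at `x`, on which `H` acts
by precomposition; the distinguished local sections are the inverses of the local trivialisations. -/
def preFrameBundle (E : StrVectorBundle.{v} 𝒮) : PrePrincipalBundle.{v} X H where
  fib x := {p : F ≃ₗ[ℂ] E.fib x // E.IsFrame p}
  act p h := ⟨(smulEquiv F h).trans p.1, by
    obtain ⟨ψ, hψ, hx, k, hk⟩ := p.2
    exact ⟨ψ, hψ, hx, k * h, fun w => by simp [hk, mul_smul]⟩⟩
  atlas := {s | ∃ (ψ : LocalTriv F E.fib) (hψ : ψ ∈ E.atlas),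
    s = ⟨ψ.base, fun x hx => ⟨(ψ.triv x hx).symm, E.isFrame_triv_symm hψ hx⟩⟩}

theorem smoothMap_frame {E E' : StrVectorBundle.{v} 𝒮} (f : StrVectorBundle.Hom E E') :
    PrePrincipalBundle.SmoothMap 𝒮 (preFrameBundle E) (preFrameBundle E')
      fun x p => ⟨p.1.trans (f.map x), p.2.map f⟩ := by
  rintro _ ⟨ψ, hψ, rfl⟩ _ ⟨φ, hφ, rfl⟩ x hx hx'
  obtain ⟨W, hxW, g, hg, h⟩ := StrVectorBundle.exists_smoothMap f.structural f.smooth hψ hφ hx hx'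
  refine ⟨W, hxW, g, hg, fun y hy => ?_⟩
  obtain ⟨a, b, e⟩ := h y hy
  refine ⟨a, b, Subtype.ext <| LinearEquiv.ext fun w => ?_⟩
  change f.map y ((ψ.triv y a).symm w) = (φ.triv y b).symm (g y • w)
  rw [← e w, LinearEquiv.symm_apply_apply]

variable [FaithfulSMul H F]

/-- The frame bundle of a vector bundle with structure group `H`. -/
def frameBundle (E : StrVectorBundle.{v} 𝒮) : PrincipalBundle.{v} 𝒮 where
  toPrePrincipalBundle := preFrameBundle E
  isPrincipal :=
    { act_one := fun p => Subtype.ext <| LinearEquiv.ext fun w => by simp [preFrameBundle]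
      act_mul := fun p g h => Subtype.ext <| LinearEquiv.ext fun w => by
        simp [preFrameBundle, mul_smul]
      existsUnique_act := by
        intro x p q
        obtain ⟨h, hh⟩ := p.2.exists_smul q.2
        refine ⟨h, Subtype.ext <| LinearEquiv.ext fun w => (hh w).symm, fun k hk => ?_⟩
        refine eq_of_smul_eq_smul (α := F) fun w => p.1.injective ?_
        rw [← hh w, ← hk]
        rfl
      cover := fun x => by
        obtain ⟨ψ, hψ, hx⟩ := E.cover x
        exact ⟨_, ⟨ψ, hψ, rfl⟩, hx⟩
      transition := by
        rintro _ ⟨ψ, hψ, rfl⟩ _ ⟨φ, hφ, rfl⟩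
        obtain ⟨g, hg, h⟩ := E.transition φ hφ ψ hψ
        refine ⟨g, 𝒮.mono (inter_comm _ _).subset hg, fun x hs ht => ?_⟩
        refine Subtype.ext <| LinearEquiv.ext fun w => ?_
        change (φ.triv x ht).symm w = (ψ.triv x hs).symm (g x • w)
        rw [← h x ht hs, LinearEquiv.symm_apply_apply] }

/-- The frame bundle functor `𝓕`; it acts on morphisms by postcomposing frames. -/
def frameFunctor (𝒮 : BundleModel X H F) : StrVectorBundle.{v} 𝒮 ⥤ PrincipalBundle.{v} 𝒮 where
  obj := frameBundle
  map {E E'} f :=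
    { map := fun x =>
        { toFun := fun p => ⟨p.1.trans (f.map x), p.2.map f⟩
          invFun := fun p => ⟨p.1.trans (f.map x).symm, p.2.map f.symm⟩
          left_inv := fun p => Subtype.ext <| LinearEquiv.ext fun w => by simp
          right_inv := fun p => Subtype.ext <| LinearEquiv.ext fun w => by simp }
      equivariant := fun p h => rfl
      smooth := smoothMap_frame f
      smooth_symm := smoothMap_frame f.symm }
  map_id _ := rfl
  map_comp _ _ := rfl

end Frame

section Assoc

variable {𝒮 : BundleModel X H F}

namespace PrincipalBundle

/-- The element of `H` taking `p` to `q`. -/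
def diff (P : PrincipalBundle.{v} 𝒮) {x : X} (p q : P.fib x) : H :=
  (P.isPrincipal.existsUnique_act p q).choose

@[simp] theorem act_diff (P : PrincipalBundle.{v} 𝒮) {x : X} (p q : P.fib x) :
    P.act p (P.diff p q) = q := (P.isPrincipal.existsUnique_act p q).choose_spec.1

theorem diff_act (P : PrincipalBundle.{v} 𝒮) {x : X} (p q : P.fib x) (h : H) :
    P.diff p (P.act q h) = P.diff p q * h :=
  P.act_inj (p := p) (by rw [P.isPrincipal.act_mul, act_diff, act_diff])

theorem diff_self (P : PrincipalBundle.{v} 𝒮) {x : X} (p : P.fib x) : P.diff p p = 1 :=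
  P.act_inj (p := p) (by rw [act_diff, P.isPrincipal.act_one])

/-- The equivalence relation on `P_x × F` given by the `H`-action `(p, w)h = (ph, h⁻¹w)`. -/
def assocSetoid (P : PrincipalBundle.{v} 𝒮) (x : X) : Setoid (P.fib x × F) where
  r a b := ∃ h : H, b = (P.act a.1 h, h⁻¹ • a.2)
  iseqv :=
    { refl := fun a => ⟨1, by simp [P.isPrincipal.act_one]⟩
      symm := by
        rintro a _ ⟨h, rfl⟩
        exact ⟨h⁻¹, by simp [← P.isPrincipal.act_mul, P.isPrincipal.act_one]⟩
      trans := by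
        rintro a _ _ ⟨h, rfl⟩ ⟨k, rfl⟩
        exact ⟨h * k, by simp [← P.isPrincipal.act_mul, mul_smul]⟩ }

/-- The fibre `(P_x × F) / H` of the associated vector bundle. -/
def AssocFib (P : PrincipalBundle.{v} 𝒮) (x : X) : Type v := Quotient (P.assocSetoid x)

/-- The class `[p, w]`. -/
def cls (P : PrincipalBundle.{v} 𝒮) {x : X} (p : P.fib x) (w : F) : P.AssocFib x :=
  Quotient.mk (P.assocSetoid x) (p, w)

theorem cls_act (P : PrincipalBundle.{v} 𝒮) {x : X} (p : P.fib x) (h : H) (w : F) :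
    P.cls (P.act p h) w = P.cls p (h • w) :=
  (Quotient.sound (s := P.assocSetoid x) ⟨h, by simp⟩ :
    P.cls p (h • w) = P.cls (P.act p h) w).symm

/-- For `p ∈ P_x` the map `w ↦ [p, w]` is a bijection. -/
def coord (P : PrincipalBundle.{v} 𝒮) {x : X} (p : P.fib x) : F ≃ P.AssocFib x where
  toFun w := P.cls p w
  invFun := Quotient.lift (fun a => P.diff p a.1 • a.2) (by
    rintro a _ ⟨h, rfl⟩
    simp [diff_act, mul_smul])
  left_inv w := by
    change P.diff p p • w = w
    rw [diff_self, one_smul]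
  right_inv a := by
    induction a using Quotient.inductionOn with
    | h a =>
      change P.cls p (P.diff p a.1 • a.2) = P.cls a.1 a.2
      rw [← cls_act, act_diff]

/-- The vector space structure on `(P_x × F) / H` is the one for which all the bijections
`w ↦ [p, w]` are linear (see `cls_add` and `cls_smul`). -/
instance (P : PrincipalBundle.{v} 𝒮) (x : X) : AddCommGroup (P.AssocFib x) :=
  (P.coord (P.point x)).symm.addCommGroup

instance (P : PrincipalBundle.{v} 𝒮) (x : X) : Module ℂ (P.AssocFib x) :=
  (P.coord (P.point x)).symm.module ℂ

theorem cls_eq (P : PrincipalBundle.{v} 𝒮) {x : X} (p : P.fib x) (w : F) :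
    P.cls p w = P.coord (P.point x) (P.diff (P.point x) p • w) := by
  change _ = P.cls _ _
  rw [← cls_act, act_diff]

theorem cls_add (P : PrincipalBundle.{v} 𝒮) {x : X} (p : P.fib x) (w w' : F) :
    P.cls p (w + w') = P.cls p w + P.cls p w' := by
  rw [cls_eq, cls_eq, cls_eq, Equiv.add_def, Equiv.symm_symm, Equiv.symm_apply_apply,
    Equiv.symm_apply_apply, smul_add]

/-- The map `[p, w] ↦ [f(p), w]` on associated bundles. -/
def assocMap {P Q : PrincipalBundle.{v} 𝒮} (f : Hom P Q) (x : X) :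
    P.AssocFib x → Q.AssocFib x :=
  Quotient.map' (s₁ := P.assocSetoid x) (s₂ := Q.assocSetoid x) (fun a => (f.map x a.1, a.2)) (by
    rintro a _ ⟨h, rfl⟩
    exact ⟨h, by simp [f.equivariant]⟩)

theorem assocMap_cls {P Q : PrincipalBundle.{v} 𝒮} (f : Hom P Q) {x : X} (p : P.fib x) (w : F) :
    assocMap f x (P.cls p w) = Q.cls (f.map x p) w := rfl

theorem exists_cls (P : PrincipalBundle.{v} 𝒮) {x : X} (p : P.fib x) (a : P.AssocFib x) :
    ∃ w, a = P.cls p w := ⟨(P.coord p).symm a, ((P.coord p).apply_symm_apply a).symm⟩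

variable [SMulCommClass H ℂ F]

theorem cls_smul (P : PrincipalBundle.{v} 𝒮) {x : X} (p : P.fib x) (c : ℂ) (w : F) :
    P.cls p (c • w) = c • P.cls p w := by
  rw [cls_eq, cls_eq, Equiv.smul_def, Equiv.symm_symm, Equiv.symm_apply_apply, smul_comm]

/-- For `p ∈ P_x` the linear isomorphism `w ↦ [p, w]`. -/
def frame (P : PrincipalBundle.{v} 𝒮) {x : X} (p : P.fib x) : F ≃ₗ[ℂ] P.AssocFib x :=
  { P.coord p with
    map_add' := P.cls_add p
    map_smul' := P.cls_smul p }

theorem frame_apply (P : PrincipalBundle.{v} 𝒮) {x : X} (p : P.fib x) (w : F) :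
    P.frame p w = P.cls p w := rfl

theorem frame_symm_assocMap {P Q : PrincipalBundle.{v} 𝒮} (f : Hom P Q) {x : X} (p : P.fib x)
    (q : Q.fib x) (h : f.map x p = q) (a : P.AssocFib x) :
    (Q.frame q).symm (assocMap f x a) = (P.frame p).symm a := by
  obtain ⟨w, rfl⟩ := P.exists_cls p a
  rw [assocMap_cls, h, ← frame_apply, ← frame_apply, LinearEquiv.symm_apply_apply,
    LinearEquiv.symm_apply_apply]

/-- The associated vector bundle `P ×_H F`. -/
def assocBundle (P : PrincipalBundle.{v} 𝒮) : StrVectorBundle.{v} 𝒮 where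
  fib := P.AssocFib
  atlas := {ψ | ∃ s ∈ P.atlas, ψ = ⟨s.base, fun x hx => (P.frame (s.val x hx)).symm⟩}
  cover x := by
    obtain ⟨s, hs, hx⟩ := P.isPrincipal.cover x
    exact ⟨_, ⟨s, hs, rfl⟩, hx⟩
  transition := by
    rintro _ ⟨s, hs, rfl⟩ _ ⟨t, ht, rfl⟩
    obtain ⟨g, hg, h⟩ := P.isPrincipal.transition t ht s hs
    refine ⟨g, 𝒮.mono (inter_comm _ _).subset hg, fun x hx hx' w => ?_⟩
    simp only [LinearEquiv.symm_symm]
    rw [LinearEquiv.symm_apply_eq, frame_apply, frame_apply, h x hx' hx, cls_act]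

theorem isFrame_frame (P : PrincipalBundle.{v} 𝒮) {x : X} (p : P.fib x) :
    P.assocBundle.IsFrame (P.frame p) := by
  obtain ⟨s, hs, hx⟩ := P.isPrincipal.cover x
  refine ⟨_, ⟨s, hs, rfl⟩, hx, P.diff (s.val x hx) p, fun w => ?_⟩
  change P.cls p w = P.cls (s.val x hx) _
  rw [← cls_act, act_diff]

theorem exists_frame_of_isFrame (P : PrincipalBundle.{v} 𝒮) {x : X}
    {p : F ≃ₗ[ℂ] P.assocBundle.fib x} (hp : P.assocBundle.IsFrame p) :
    ∃ q : P.fib x, ∀ w, p w = P.cls q w := by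
  obtain ⟨_, ⟨s, hs, rfl⟩, hx, h, hh⟩ := hp
  refine ⟨P.act (s.val x hx) h, fun w => ?_⟩
  rw [hh w, cls_act]
  rfl

/-- The linear isomorphism `[p, w] ↦ [f(p), w]`. -/
def assocEquiv {P Q : PrincipalBundle.{v} 𝒮} (f : Hom P Q) (x : X) :
    P.AssocFib x ≃ₗ[ℂ] Q.AssocFib x where
  toFun := assocMap f x
  invFun := assocMap f.symm x
  map_add' a b := by
    obtain ⟨w, rfl⟩ := P.exists_cls (P.point x) a
    obtain ⟨w', rfl⟩ := P.exists_cls (P.point x) b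
    rw [← cls_add, assocMap_cls, assocMap_cls, assocMap_cls, cls_add]
  map_smul' c a := by
    obtain ⟨w, rfl⟩ := P.exists_cls (P.point x) a
    rw [← cls_smul, assocMap_cls, assocMap_cls, cls_smul]
    rfl
  left_inv a := by
    obtain ⟨w, rfl⟩ := P.exists_cls (P.point x) a
    rw [assocMap_cls, assocMap_cls]
    exact congrArg (fun p => P.cls p w) ((f.map x).symm_apply_apply _)
  right_inv a := by
    obtain ⟨w, rfl⟩ := Q.exists_cls (Q.point x) a
    rw [assocMap_cls, assocMap_cls]
    exact congrArg (fun p => Q.cls p w) ((f.map x).apply_symm_apply _)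

theorem assocMap_structural {P Q : PrincipalBundle.{v} 𝒮} (f : Hom P Q) :
    StrVectorBundle.PreservesStructure P.assocBundle Q.assocBundle (assocMap f) := by
  intro x p q hp hq
  obtain ⟨p', hp'⟩ := P.exists_frame_of_isFrame hp
  obtain ⟨q', hq'⟩ := Q.exists_frame_of_isFrame hq
  refine ⟨Q.diff q' (f.map x p'), fun w => ?_⟩
  have e1 : assocMap f x (p w) = Q.cls (f.map x p') w := congrArg (assocMap f x) (hp' w)
  have e2 : q (Q.diff q' (f.map x p') • w) = Q.cls (f.map x p') w := by
    rw [hq', ← cls_act, act_diff]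
  exact (congrArg q.symm (e1.trans e2.symm)).trans (q.symm_apply_apply _)

theorem assocMap_smooth {P Q : PrincipalBundle.{v} 𝒮} (f : Hom P Q) :
    StrVectorBundle.IsSmooth P.assocBundle Q.assocBundle (assocMap f) := by
  refine StrVectorBundle.isSmooth_of_smoothMap ?_
  rintro _ ⟨s, hs, rfl⟩ _ ⟨t, ht, rfl⟩ x hx hx'
  obtain ⟨W, hxW, g, hg, h⟩ := f.smooth s hs t ht x hx hx'
  refine ⟨W, hxW, g, hg, fun y hy => ?_⟩
  obtain ⟨a, b, e⟩ := h y hy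
  refine ⟨a, b, fun w => ?_⟩
  change (Q.frame (t.val y b)).symm (assocMap f y (P.cls (s.val y a) w)) = _
  rw [LinearEquiv.symm_apply_eq, assocMap_cls, frame_apply, ← cls_act]
  exact congrArg (fun p => Q.cls p w) e

end PrincipalBundle

/-- The associated vector bundle functor `P ↦ P ×_H F`. -/
def assocFunctor [SMulCommClass H ℂ F] (𝒮 : BundleModel X H F) : PrincipalBundle.{v} 𝒮 ⥤ StrVectorBundle.{v} 𝒮 where
  obj P := P.assocBundle
  map f :=
    { map := fun x => PrincipalBundle.assocEquiv f x
      structural := PrincipalBundle.assocMap_structural f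
      structural_symm := PrincipalBundle.assocMap_structural f.symm
      smooth := PrincipalBundle.assocMap_smooth f
      smooth_symm := PrincipalBundle.assocMap_smooth f.symm }
  map_id P := by
    refine StrVectorBundle.Hom.ext (funext fun x => LinearEquiv.ext fun a => ?_)
    obtain ⟨w, rfl⟩ := P.exists_cls (P.point x) a
    rfl
  map_comp {P Q R} f g := by
    refine StrVectorBundle.Hom.ext (funext fun x => LinearEquiv.ext fun a => ?_)
    obtain ⟨w, rfl⟩ := P.exists_cls (P.point x) a
    rfl

end Assoc

end FrameAssoc

/-! ### The groupoids of the caloron correspondence -/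

section Groupoids

variable (E M : Type*) [NormedAddCommGroup E] [NormedSpace ℝ E] [TopologicalSpace M]
  [ChartedSpace E M] (n : ℕ)

/-- `Bun_{ΩG}(M)`. -/
abbrev OmegaBundle := PrincipalBundle.{v} (omegaModel E M n)

/-- `ΩVect_V(M)`: the `Ω` vector bundles over `M` with typical fibre `LV`. -/
abbrev OmegaVectorBundle := StrVectorBundle.{v} (omegaModel E M n)

/-- The model of `G`-bundles and of rank `n` complex vector bundles over `M × S¹`. -/
abbrev circleModel : BundleModel (M × Circle) (GLV n) (Vec n) :=
  finModel (𝓘(ℝ, E).prod (𝓡 1)) (M × Circle) n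

/-- `Bun_G(M × S¹)`. -/
abbrev GBundle := PrincipalBundle.{v} (circleModel E M n)

/-- Complex vector bundles of rank `n` over `M × S¹`. -/
abbrev CVectorBundle := StrVectorBundle.{v} (circleModel E M n)

variable {M n} in
/-- Smoothness of a section over `M₀ = M × {0}`. -/
def SmoothFraming (P : PrePrincipalBundle.{v} (M × Circle) (GLV n)) (s₀ : ∀ m, P.fib (m, 1)) :
    Prop :=
  ∀ s ∈ P.atlas, ∃ g : M → GLV n, GSmoothOn 𝓘(ℝ, E) {m | (m, 1) ∈ s.base} g ∧
    ∀ m (h : (m, 1) ∈ s.base), s₀ m = P.act (s.val (m, 1) h) (g m)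

/-- `G`-bundles over `M × S¹` framed over `M × {0}`. -/
structure FramedGBundle where
  bundle : GBundle.{v} E M n
  framing : ∀ m, bundle.fib (m, 1)
  smooth_framing : SmoothFraming E bundle.toPrePrincipalBundle framing

/-- Complex vector bundles of rank `n` over `M × S¹` framed over `M × {0}`: there is a distinguished
(smooth) trivialisation over `M × {0}`. -/
structure FramedVectorBundle where
  bundle : CVectorBundle.{v} E M n
  framing : ∀ m, bundle.fib (m, 1) ≃ₗ[ℂ] Vec n
  smooth_framing : ∀ ψ ∈ bundle.atlas, ∃ g : M → GLV n,
    GSmoothOn 𝓘(ℝ, E) {m | (m, 1) ∈ ψ.base} g ∧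
      ∀ m (h : (m, 1) ∈ ψ.base) (w : Vec n), ψ.triv (m, 1) h ((framing m).symm w) = g m • w

variable {E M n}

/-- Bundle maps preserving the framings. -/
@[ext] structure FramedGBundle.Hom (P Q : FramedGBundle.{v} E M n) where
  hom : P.bundle ⟶ Q.bundle
  preserves : ∀ m, PrincipalBundle.Hom.map hom (m, 1) (P.framing m) = Q.framing m

/-- Vector bundle isomorphisms preserving the framings. -/
@[ext] structure FramedVectorBundle.Hom (P Q : FramedVectorBundle.{v} E M n) where
  hom : P.bundle ⟶ Q.bundle
  preserves : ∀ m (e : P.bundle.fib (m, 1)),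
    Q.framing m (StrVectorBundle.Hom.map hom (m, 1) e) = P.framing m e

/-- The groupoid `frBun_G(M)`. -/
instance : Groupoid (FramedGBundle.{v} E M n) where
  Hom := FramedGBundle.Hom
  id P := ⟨𝟙 _, fun _ => rfl⟩
  comp f g := ⟨f.hom ≫ g.hom, fun m => (congrArg _ (f.preserves m)).trans (g.preserves m)⟩
  id_comp _ := rfl
  comp_id _ := rfl
  assoc _ _ _ := rfl
  inv {P Q} f := ⟨Groupoid.inv f.hom, fun m => by
    rw [← f.preserves m]
    exact (PrincipalBundle.Hom.map f.hom (m, 1)).symm_apply_apply _⟩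
  inv_comp f := FramedGBundle.Hom.ext (Groupoid.inv_comp f.hom)
  comp_inv f := FramedGBundle.Hom.ext (Groupoid.comp_inv f.hom)

/-- The groupoid `frVect_V(M)`. -/
instance : Groupoid (FramedVectorBundle.{v} E M n) where
  Hom := FramedVectorBundle.Hom
  id P := ⟨𝟙 _, fun _ _ => rfl⟩
  comp f g := ⟨f.hom ≫ g.hom, fun m e => (g.preserves m _).trans (f.preserves m e)⟩
  id_comp _ := rfl
  comp_id _ := rfl
  assoc _ _ _ := rfl
  inv {P Q} f := ⟨Groupoid.inv f.hom, fun m e => by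
    refine (f.preserves m _).symm.trans ?_
    exact congrArg _ ((StrVectorBundle.Hom.map f.hom (m, 1)).apply_symm_apply e)⟩
  inv_comp f := FramedVectorBundle.Hom.ext (Groupoid.inv_comp f.hom)
  comp_inv f := FramedVectorBundle.Hom.ext (Groupoid.comp_inv f.hom)

theorem FramedVectorBundle.isFrame (P : FramedVectorBundle.{v} E M n) (m : M) :
    P.bundle.IsFrame (P.framing m).symm := by
  obtain ⟨ψ, hψ, h⟩ := P.bundle.cover (m, 1)
  obtain ⟨g, -, hg⟩ := P.smooth_framing ψ hψ
  exact ⟨ψ, hψ, h, g m, fun w => by rw [← hg m h w, LinearEquiv.symm_apply_apply]⟩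

variable (E M n)

/-- The frame bundle functor `𝓕 : frVect_V(M) → frBun_G(M)`; the framing of the frame bundle is given
by the distinguished trivialisation. -/
def framedFrameFunctor : FramedVectorBundle.{v} E M n ⥤ FramedGBundle.{v} E M n where
  obj P :=
    { bundle := (frameFunctor (circleModel E M n)).obj P.bundle
      framing := fun m => ⟨(P.framing m).symm, P.isFrame m⟩
      smooth_framing := by
        rintro _ ⟨ψ, hψ, rfl⟩
        obtain ⟨g, hg, h⟩ := P.smooth_framing ψ hψ
        refine ⟨g, hg, fun m hm => Subtype.ext <| LinearEquiv.ext fun w => ?_⟩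
        change (P.framing m).symm w = (ψ.triv (m, 1) hm).symm (g m • w)
        rw [← h m hm w, LinearEquiv.symm_apply_apply] }
  map {P Q} f :=
    { hom := (frameFunctor (circleModel E M n)).map f.hom
      preserves := fun m => Subtype.ext <| LinearEquiv.ext fun w => by
        change StrVectorBundle.Hom.map f.hom (m, 1) ((P.framing m).symm w) = (Q.framing m).symm w
        rw [LinearEquiv.eq_symm_apply]
        exact (f.preserves m _).trans ((P.framing m).apply_symm_apply w) }
  map_id _ := rfl
  map_comp _ _ := rfl

variable {E M n} in
/-- The associated vector bundle `P ×_G V` of a framed bundle, with the distinguished trivialisation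
`[s₀(m, 0), w] ↦ w`, i.e. `[s₀(m, 0)g, w] ↦ g(w)`, over `M × {0}`. -/
def framedAssoc (P : FramedGBundle.{v} E M n) : FramedVectorBundle.{v} E M n where
  bundle := P.bundle.assocBundle
  framing m := (P.bundle.frame (P.framing m)).symm
  smooth_framing := by
    rintro _ ⟨s, hs, rfl⟩
    obtain ⟨g, hg, h⟩ := P.smooth_framing s hs
    refine ⟨g, hg, fun m hm w => ?_⟩
    change (P.bundle.frame (s.val (m, 1) hm)).symm (P.bundle.frame (P.framing m) w) = _
    rw [LinearEquiv.symm_apply_eq, PrincipalBundle.frame_apply, PrincipalBundle.frame_apply,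
      ← PrincipalBundle.cls_act, h m hm]

/-- The associated vector bundle functor `P ↦ P ×_G V` for framed bundles. -/
def framedAssocFunctor : FramedGBundle.{v} E M n ⥤ FramedVectorBundle.{v} E M n where
  obj P := framedAssoc P
  map f :=
    { hom := (assocFunctor (circleModel E M n)).map f.hom
      preserves := fun m e =>
        PrincipalBundle.frame_symm_assocMap f.hom _ _ (f.preserves m) e }
  map_id P := FramedVectorBundle.Hom.ext ((assocFunctor (circleModel E M n)).map_id P.bundle)
  map_comp f g := FramedVectorBundle.Hom.ext
    ((assocFunctor (circleModel E M n)).map_comp f.hom g.hom)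

end Groupoids

/-! ### The based caloron transform -/

section Transform

variable {E M : Type*} [NormedAddCommGroup E] [NormedSpace ℝ E] [TopologicalSpace M]
  [ChartedSpace E M] {n : ℕ}

/-- The equivalence relation on `Q_x × G` (the fibre of `Q × {θ} × G` over `x`) given by the
`ΩG`-action `(q, θ, g)γ = (qγ, θ, γ(θ)⁻¹g)`. -/
def caloronSetoid (Q : OmegaBundle.{v} E M n) (y : M × Circle) : Setoid (Q.fib y.1 × GLV n) where
  r a b := ∃ γ : OmegaG n, b = (Q.act a.1 γ, (γ.1 y.2)⁻¹ * a.2)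
  iseqv :=
    { refl := fun a => ⟨1, Prod.ext (Q.isPrincipal.act_one _).symm
        (by change a.2 = (1 : GLV n)⁻¹ * a.2; simp)⟩
      symm := by
        rintro a _ ⟨γ, rfl⟩
        refine ⟨γ⁻¹, Prod.ext ?_ ?_⟩
        · simp [← Q.isPrincipal.act_mul, Q.isPrincipal.act_one]
        · change a.2 = ((γ.1 y.2)⁻¹)⁻¹ * ((γ.1 y.2)⁻¹ * a.2)
          simp
      trans := by
        rintro a _ _ ⟨γ, rfl⟩ ⟨δ, rfl⟩
        refine ⟨γ * δ, Prod.ext ?_ ?_⟩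
        · simp [← Q.isPrincipal.act_mul]
        · change (δ.1 y.2)⁻¹ * ((γ.1 y.2)⁻¹ * a.2) = (γ.1 y.2 * δ.1 y.2)⁻¹ * a.2
          simp [mul_assoc] }

/-- The data of the caloron transform `𝓒(Q) = (Q × S¹ × G) / ΩG` over `M × S¹`, with the `G`-action
`[q, θ, g]h = [q, θ, gh]`; its distinguished local sections are `(x, θ) ↦ [s(x), θ, 1]` for the
distinguished local sections `s` of `Q`. -/
def preCaloron (Q : OmegaBundle.{v} E M n) : PrePrincipalBundle.{v} (M × Circle) (GLV n) where
  fib y := Quotient (caloronSetoid Q y)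
  act {y} a h := Quotient.map' (s₁ := caloronSetoid Q y) (s₂ := caloronSetoid Q y)
    (fun a => (a.1, a.2 * h)) (by
      rintro a _ ⟨γ, rfl⟩
      exact ⟨γ, by simp [mul_assoc]⟩) a
  atlas := {t | ∃ s ∈ Q.atlas,
    t = ⟨⟨Prod.fst ⁻¹' s.base, s.base.isOpen.preimage continuous_fst⟩,
      fun y hy => Quotient.mk (caloronSetoid Q y) (s.val y.1 hy, 1)⟩}

/-- The canonical framing `m ↦ [q, 0, 1]` of `𝓒(Q)`, with `q` any point of the fibre over `m`. -/
def caloronFraming (Q : OmegaBundle.{v} E M n) (m : M) : (preCaloron Q).fib (m, 1) :=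
  Quotient.mk (caloronSetoid Q (m, 1)) (Q.point m, 1)

theorem caloronFraming_eq (Q : OmegaBundle.{v} E M n) (m : M) (q : Q.fib m) :
    caloronFraming Q m = Quotient.mk (caloronSetoid Q (m, 1)) (q, 1) := by
  refine Quotient.sound (s := caloronSetoid Q (m, 1)) ⟨Q.diff (Q.point m) q, Prod.ext ?_ ?_⟩
  · exact (Q.act_diff _ _).symm
  · change (1 : GLV n) = ((Q.diff (Q.point m) q).1 1)⁻¹ * 1
    rw [(Q.diff (Q.point m) q).2.2]
    simp

/-- The map `𝓒(f) : [q, θ, g] ↦ [f(q), θ, g]`. -/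
def caloronMap {Q R : OmegaBundle.{v} E M n} (f : Q ⟶ R) (y : M × Circle) :
    (preCaloron Q).fib y → (preCaloron R).fib y :=
  Quotient.map' (s₁ := caloronSetoid Q y) (s₂ := caloronSetoid R y)
    (fun a => (PrincipalBundle.Hom.map f y.1 a.1, a.2)) (by
      rintro a _ ⟨γ, rfl⟩
      exact ⟨γ, Prod.ext (PrincipalBundle.Hom.equivariant f _ _) rfl⟩)

variable (E M) in
/-- The assertion that the caloron transform is well defined: `𝓒(Q)` is a smooth principal
`G`-bundle over `M × S¹` with a smooth framing, and `𝓒(f)` is smooth. -/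
structure CaloronWellDefined : Prop where
  isPrincipal : ∀ (n : ℕ) (Q : OmegaBundle.{v} E M n),
    (preCaloron Q).IsPrincipal (circleModel E M n)
  smooth_framing : ∀ (n : ℕ) (Q : OmegaBundle.{v} E M n),
    SmoothFraming E (preCaloron Q) (caloronFraming Q)
  smooth_map : ∀ (n : ℕ) (Q R : OmegaBundle.{v} E M n) (f : Q ⟶ R),
    PrePrincipalBundle.SmoothMap (circleModel E M n) (preCaloron Q) (preCaloron R) (caloronMap f)

/-- The based caloron transform `𝓒 : Bun_{ΩG}(M) → frBun_G(M)`. -/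
def caloron (h : CaloronWellDefined.{v} E M) (n : ℕ) :
    OmegaBundle.{v} E M n ⥤ FramedGBundle.{v} E M n where
  obj Q := ⟨⟨preCaloron Q, h.isPrincipal n Q⟩, caloronFraming Q, h.smooth_framing n Q⟩
  map {Q R} f :=
    { hom :=
        { map := fun y =>
            { toFun := caloronMap f y
              invFun := caloronMap (Groupoid.inv f) y
              left_inv := by
                rintro ⟨a⟩
                exact congrArg (fun q => Quotient.mk (caloronSetoid Q y) (q, a.2))
                  ((PrincipalBundle.Hom.map f y.1).symm_apply_apply a.1)
              right_inv := by
                rintro ⟨a⟩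
                exact congrArg (fun q => Quotient.mk (caloronSetoid R y) (q, a.2))
                  ((PrincipalBundle.Hom.map f y.1).apply_symm_apply a.1) }
          equivariant := by rintro y ⟨a⟩ g; rfl
          smooth := h.smooth_map n Q R f
          smooth_symm := h.smooth_map n R Q (Groupoid.inv f) }
      preserves := fun m => (caloronFraming_eq R m _).symm }
  map_id Q := FramedGBundle.Hom.ext <| PrincipalBundle.Hom.ext <| funext fun y => Equiv.ext <| by
    rintro ⟨a⟩; rfl
  map_comp f g := FramedGBundle.Hom.ext <| PrincipalBundle.Hom.ext <| funext fun y => Equiv.ext <| by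
    rintro ⟨a⟩; rfl

/-! ### The based inverse caloron transform -/

/-- Smoothness of a section `p` of `P` over `{m} × S¹`. -/
def SmoothLoop (P : GBundle.{v} E M n) (m : M) (p : ∀ θ, P.fib (m, θ)) : Prop :=
  ∀ s ∈ P.atlas, ∀ θ, (m, θ) ∈ s.base → ∃ W : Opens Circle, θ ∈ W ∧ ∃ g : Circle → GLV n,
    GSmoothOn (𝓡 1) W g ∧
      ∀ η ∈ W, ∃ hs : (m, η) ∈ s.base, p η = P.act (s.val (m, η) hs) (g η)

theorem SmoothLoop.act {P : GBundle.{v} E M n} {m : M} {p : ∀ θ, P.fib (m, θ)}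
    (hp : SmoothLoop P m p) (γ : OmegaG n) : SmoothLoop P m fun θ => P.act (p θ) (γ.1 θ) := by
  intro s hs θ hθ
  obtain ⟨W, hW, g, hg, h⟩ := hp s hs θ hθ
  refine ⟨W, hW, fun η => g η * γ.1 η,
    (finModel (𝓡 1) Circle n).mul W.isOpen hg γ.2.1.contMDiffOn, fun η hη => ?_⟩
  obtain ⟨a, e⟩ := h η hη
  refine ⟨a, ?_⟩
  change P.act (p η) (γ.1 η) = P.act _ (g η * γ.1 η)
  rw [e, P.isPrincipal.act_mul]

theorem SmoothLoop.map {P R : GBundle.{v} E M n} {m : M} {p : ∀ θ, P.fib (m, θ)}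
    (hp : SmoothLoop P m p) (f : P ⟶ R) :
    SmoothLoop R m fun θ => PrincipalBundle.Hom.map f (m, θ) (p θ) := by
  intro t ht θ hθ
  obtain ⟨s, hs, hsθ⟩ := P.isPrincipal.cover (m, θ)
  obtain ⟨W, hW, g, hg, h⟩ := hp s hs θ hsθ
  obtain ⟨W', hW', g', hg', h'⟩ := PrincipalBundle.Hom.smooth f s hs t ht (m, θ) hsθ hθ
  have hc : Continuous fun η : Circle => (m, η) := by fun_prop
  let W₁ : Opens Circle := ⟨(fun η => (m, η)) ⁻¹' W', W'.isOpen.preimage hc⟩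
  have hg₂ : ContMDiffOn (𝓘(ℝ, E).prod (𝓡 1)) 𝓘(ℝ, EndV n) ∞ (fun z => (g' z : EndV n)) W' := hg'
  have hg₁ : GSmoothOn (𝓡 1) W₁ fun η => g' (m, η) :=
    hg₂.comp (contMDiff_const.prodMk contMDiff_id).contMDiffOn (fun _ h => h)
  refine ⟨W₁ ⊓ W, ⟨hW', hW⟩, fun η => g' (m, η) * g η,
    (finModel (𝓡 1) Circle n).mul (W₁ ⊓ W).isOpen
      ((finModel (𝓡 1) Circle n).mono inter_subset_left hg₁)
      ((finModel (𝓡 1) Circle n).mono inter_subset_right hg), fun η hη => ?_⟩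
  obtain ⟨a, e⟩ := h η hη.2
  obtain ⟨a', b, e'⟩ := h' (m, η) hη.1
  refine ⟨b, ?_⟩
  change PrincipalBundle.Hom.map f (m, η) (p η) = R.act _ (g' (m, η) * g η)
  rw [e, PrincipalBundle.Hom.equivariant, R.isPrincipal.act_mul]
  exact congrArg (fun q => R.act q (g η)) e'

/-- The fibre over `m` of the inverse caloron transform: smooth sections of `P` over `{m} × S¹` which
agree with the framing at `(m, 0)`. -/
def InvCaloronFib (P : FramedGBundle.{v} E M n) (m : M) : Type v :=
  {p : ∀ θ, P.bundle.fib (m, θ) // SmoothLoop P.bundle m p ∧ p 1 = P.framing m}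

/-- The data of the inverse caloron transform `𝓒⁻¹(P)` over `M`, with the pointwise action of `ΩG`.
Its local sections over `U ⊆ M` are the smooth sections of `P` over `U × S¹` which agree with the
framing over `U × {0}`. -/
def preInvCaloron (P : FramedGBundle.{v} E M n) : PrePrincipalBundle.{v} M (OmegaG n) where
  fib := InvCaloronFib P
  act p γ := ⟨fun θ => P.bundle.act (p.1 θ) (γ.1 θ), p.2.1.act γ,
    (congrArg₂ P.bundle.act p.2.2 γ.2.2).trans (P.bundle.isPrincipal.act_one _)⟩
  atlas := {s | ∀ t ∈ P.bundle.atlas, ∀ y : M × Circle, y.1 ∈ s.base → y ∈ t.base →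
    ∃ W : Opens (M × Circle), y ∈ W ∧ ∃ g : M × Circle → GLV n,
      GSmoothOn (𝓘(ℝ, E).prod (𝓡 1)) W g ∧
        ∀ z ∈ W, ∃ (hs : z.1 ∈ s.base) (ht : z ∈ t.base),
          (s.val z.1 hs).1 z.2 = P.bundle.act (t.val z ht) (g z)}

/-- The map `𝓒⁻¹(f) : p ↦ f ∘ p`. -/
def invCaloronMap {P R : FramedGBundle.{v} E M n} (f : P ⟶ R) (m : M) :
    (preInvCaloron P).fib m → (preInvCaloron R).fib m :=
  fun p => ⟨fun θ => PrincipalBundle.Hom.map (FramedGBundle.Hom.hom f) (m, θ) (p.1 θ),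
    p.2.1.map _,
    (congrArg (PrincipalBundle.Hom.map (FramedGBundle.Hom.hom f) (m, 1)) p.2.2).trans
      (FramedGBundle.Hom.preserves f m)⟩

variable (E M) in
/-- The assertion that the inverse caloron transform is well defined: `𝓒⁻¹(P)` is a smooth principal
`ΩG`-bundle over `M`, and `𝓒⁻¹(f)` is smooth. -/
structure InvCaloronWellDefined : Prop where
  isPrincipal : ∀ (n : ℕ) (P : FramedGBundle.{v} E M n),
    (preInvCaloron P).IsPrincipal (omegaModel E M n)
  smooth_map : ∀ (n : ℕ) (P R : FramedGBundle.{v} E M n) (f : P ⟶ R),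
    PrePrincipalBundle.SmoothMap (omegaModel E M n) (preInvCaloron P) (preInvCaloron R)
      (invCaloronMap f)

/-- The based inverse caloron transform `𝓒⁻¹ : frBun_G(M) → Bun_{ΩG}(M)`. -/
def invCaloron (h : InvCaloronWellDefined.{v} E M) (n : ℕ) :
    FramedGBundle.{v} E M n ⥤ OmegaBundle.{v} E M n where
  obj P := ⟨preInvCaloron P, h.isPrincipal n P⟩
  map {P R} f :=
    { map := fun m =>
        { toFun := invCaloronMap f m
          invFun := invCaloronMap (Groupoid.inv f) m
          left_inv := fun p => Subtype.ext <| funext fun θ =>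
            (PrincipalBundle.Hom.map (FramedGBundle.Hom.hom f) (m, θ)).symm_apply_apply (p.1 θ)
          right_inv := fun p => Subtype.ext <| funext fun θ =>
            (PrincipalBundle.Hom.map (FramedGBundle.Hom.hom f) (m, θ)).apply_symm_apply (p.1 θ) }
      equivariant := fun p γ => Subtype.ext <| funext fun θ =>
        PrincipalBundle.Hom.equivariant (FramedGBundle.Hom.hom f) (p.1 θ) (γ.1 θ)
      smooth := h.smooth_map n P R f
      smooth_symm := h.smooth_map n R P (Groupoid.inv f) }
  map_id _ := rfl
  map_comp _ _ := rfl

/-! ### The caloron transform for vector bundles -/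

/-- The caloron transform `𝓥(𝖤) = 𝓒(𝓕(𝖤)) ×_G V`, `𝓥 : ΩVect_V(M) → frVect_V(M)`. -/
def vectorCaloron (h : CaloronWellDefined.{v} E M) (n : ℕ) :
    OmegaVectorBundle.{v} E M n ⥤ FramedVectorBundle.{v} E M n :=
  frameFunctor (omegaModel E M n) ⋙ caloron h n ⋙ framedAssocFunctor E M n

/-- The inverse caloron transform `𝓥⁻¹(E) = 𝓒⁻¹(𝓕(E)) ×_{ΩG} LV`,
`𝓥⁻¹ : frVect_V(M) → ΩVect_V(M)`. -/
def vectorInvCaloron (h : InvCaloronWellDefined.{v} E M) (n : ℕ) :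
    FramedVectorBundle.{v} E M n ⥤ OmegaVectorBundle.{v} E M n :=
  framedFrameFunctor E M n ⋙ invCaloron h n ⋙ assocFunctor (omegaModel E M n)

variable (E M)

/-- The groupoid `ΩVect(M)` of all `Ω` vector bundles over `M`: the disjoint union over `n` of the
groupoids of those with typical fibre `L(ℂⁿ)`. -/
abbrev OmegaVect := Σ n : ℕ, OmegaVectorBundle.{v} E M n

/-- The groupoid `frVect(M)` of complex vector bundles over `M × S¹` framed over `M × {0}`: the
disjoint union over `n` of the groupoids of those with typical fibre `ℂⁿ`. -/
abbrev FrVect := Σ n : ℕ, FramedVectorBundle.{v} E M n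

variable {E M}

/-- The caloron transform `𝓥 : ΩVect(M) → frVect(M)`. -/
def vectorCaloronTotal (h : CaloronWellDefined.{v} E M) : OmegaVect.{v} E M ⥤ FrVect.{v} E M :=
  Sigma.Functor.sigma fun n => vectorCaloron h n

/-- The inverse caloron transform `𝓥⁻¹ : frVect(M) → ΩVect(M)`. -/
def vectorInvCaloronTotal (h : InvCaloronWellDefined.{v} E M) :
    FrVect.{v} E M ⥤ OmegaVect.{v} E M :=
  Sigma.Functor.sigma fun n => vectorInvCaloron h n

end Transform

end Caloron

end

/-!
All four natural isomorphisms are obtained by composing the elementary isomorphisms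
`𝓕(P ×_H F) ≅ P` and `𝓕(E) ×_H F ≅ E` (`frameAssocIso`, `assocFrameIso` and their framed
versions) with the caloron correspondence for principal bundles,
`𝓒⁻¹(𝓒(Q)) ≅ Q` by `q ↦ (θ ↦ [q, θ, 1])` and `𝓒(𝓒⁻¹(P)) ≅ P` by `[p, θ, g] ↦ p(θ)g`
(`caloronUnitIso`, `caloronCounitIso`). The content lies in the smoothness of these maps and in the
well-definedness of the transforms, for which there are two main ingredients.

*The exponential law* (`omegaSmoothOn_iff`): a map `γ : U → ΩG` is Gateaux smooth for the `C^∞`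
topology if and only if `(x, θ) ↦ γ(x)(θ)` is a smooth map on `U × S¹`. If `γ` is Gateaux smooth, the
derivatives of all orders in the parameter and the angle form a family of continuous functions which
is closed under partial derivatives, so they are smooth
(`LoopSpace.contDiffOn_of_gateauxSmoothOn`). Conversely, the difference quotients of a jointly smooth
family converge uniformly with all derivatives in the angle, because `C¹` functions are strictly
differentiable and mixed derivatives commute (`LoopSpace.JointlySmooth.gateauxSmoothOn`). This turns
smooth transition functions with values in `ΩG` into smooth transition functions over `M × S¹` with
values in `G`, and back.

*Local triviality of `𝓒⁻¹(P)`* (`exists_section_near_circle`): a principal `GL(V)`-bundle over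
`M × S¹` has smooth sections over `U × S¹` for some neighbourhood `U` of any given point. On the
covering `M × ℝ` local sections over products of a neighbourhood with an interval are glued one after
another (`CylinderSection.exists_glue`): after multiplication by a constant two of them agree at a
point, hence differ by a function close to `1` near it, and such functions can be cut off within
`GL(V)`. The section over `U × [0, 2π]` obtained in this way is closed up to a loop by means of a
smooth path in the connected group `GL(V)` (`exists_smooth_path`). A factor depending only on the
point of `U` makes it agree with the framing.

Smoothness of sections of the finite dimensional bundle `P` over circles, over `M × {0}`, over
`U × S¹` and over `M × ℝ` is treated uniformly as smoothness of sections along a map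
(`SmoothSecAt`).
-/

noncomputable section

namespace Caloron

/-! ### Continuous partial derivatives -/

section PartialDerivatives

variable {Z F : Type*} [NormedAddCommGroup Z] [NormedSpace ℝ Z] [NormedAddCommGroup F]
  [NormedSpace ℝ F]

/-- Continuous line derivatives along finitely many vectors give strict differentiability of the
restriction to the affine span of these vectors; one vector is added at a time. -/
theorem hasStrictFDerivAt_comp_sum_smul {U : Set Z} (hU : IsOpen U) {f : Z → F} :
    ∀ {k : ℕ} (v : Fin k → Z) (g : Fin k → Z → F), (∀ i, ContinuousOn (g i) U) →
      (∀ i, ∀ z ∈ U, HasLineDerivAt ℝ f (g i z) z (v i)) → ∀ z ∈ U,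
      HasStrictFDerivAt (fun a : Fin k → ℝ => f (z + ∑ i, a i • v i))
        (∑ i, (ContinuousLinearMap.proj i : (Fin k → ℝ) →L[ℝ] ℝ).smulRight (g i z)) 0 := by
  intro k
  induction k with
  | zero =>
    intro v g _ _ z _
    simpa using hasStrictFDerivAt_const (f z) (0 : Fin 0 → ℝ)
  | succ k ih =>
    intro v g hg hf z hz
    let w : ℝ × (Fin k → ℝ) → Z := fun p => z + p.1 • v 0 + ∑ i, p.2 i • v i.succ
    have hw : Continuous w := by fun_prop
    have hw0 : w 0 = z := by simp [w]
    have hev : ∀ᶠ p in 𝓝 (0 : ℝ × (Fin k → ℝ)), w p ∈ U :=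
      hw.continuousAt.eventually (hU.mem_nhds (by rw [hw0]; exact hz))
    have hgc : ∀ i, ContinuousAt (fun p => g i (w p)) 0 := fun i => by
      refine ContinuousAt.comp (g := g i) (f := w) ?_ hw.continuousAt
      rw [hw0]
      exact (hg i).continuousAt (hU.mem_nhds hz)
    have key := hasStrictFDerivAt_uncurry_coprod (𝕜 := ℝ) (u := (0 : ℝ × (Fin k → ℝ)))
      (f := fun s a => f (w (s, a)))
      (f₁ := fun s a => ContinuousLinearMap.toSpanSingleton ℝ (g 0 (w (s, a))))
      (f₂ := fun s a => ∑ i : Fin k,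
        (ContinuousLinearMap.proj i : (Fin k → ℝ) →L[ℝ] ℝ).smulRight (g i.succ (w (s, a))))
      ?_ ?_ ?_ ?_
    · have hL : HasStrictFDerivAt (fun a : Fin (k + 1) → ℝ => (a 0, fun i : Fin k => a i.succ))
          ((ContinuousLinearMap.proj 0 : (Fin (k + 1) → ℝ) →L[ℝ] ℝ).prod
            (ContinuousLinearMap.pi fun i : Fin k => ContinuousLinearMap.proj i.succ)) 0 :=
        ((ContinuousLinearMap.proj 0 : (Fin (k + 1) → ℝ) →L[ℝ] ℝ).prod
            (ContinuousLinearMap.pi fun i : Fin k =>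
              ContinuousLinearMap.proj i.succ)).hasStrictFDerivAt
      have := HasStrictFDerivAt.comp (g := fun p : ℝ × (Fin k → ℝ) => f (w (p.1, p.2)))
        (f := fun a : Fin (k + 1) → ℝ => (a 0, fun i : Fin k => a i.succ)) 0 key hL
      convert! this using 1
      · funext a
        simp [w, Fin.sum_univ_succ, add_assoc]
      · refine ContinuousLinearMap.ext fun a => ?_
        have e : w (0, 0) = z := hw0
        simp [Fin.sum_univ_succ, e, Function.HasUncurry.uncurry]
    · filter_upwards [hev] with p hp
      have h := hf 0 (w p) hp
      have h' : HasDerivAt (fun t : ℝ => f (w p + t • v 0)) (g 0 (w p)) (p.1 - p.1) := by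
        rw [sub_self]; exact h
      have h2 := (h'.comp_sub_const p.1 p.1).hasFDerivAt
      refine h2.congr_of_eventuallyEq (Eventually.of_forall fun s => ?_)
      refine congrArg f ?_
      simp only [w, sub_smul]
      abel
    · filter_upwards [hev] with p hp
      have h := (ih (fun i => v i.succ) (fun i => g i.succ) (fun i => hg _) (fun i => hf _)
        (w p) hp).hasFDerivAt
      rw [← sub_self p.2] at h
      have h2 := HasFDerivAt.comp (f := fun a => a - p.2) p.2 h ((hasFDerivAt_id p.2).sub_const p.2)
      refine h2.congr_of_eventuallyEq (Eventually.of_forall fun a => ?_)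
      refine congrArg f ?_
      simp [w, sub_smul]
    · exact ((ContinuousLinearMap.toSpanSingletonCLE (𝕜 := ℝ) (E := F)).continuous.continuousAt).comp
        (hgc 0)
    · change Tendsto (fun p : ℝ × (Fin k → ℝ) => ∑ i : Fin k, (ContinuousLinearMap.proj i :
        (Fin k → ℝ) →L[ℝ] ℝ).smulRight (g i.succ (w p))) (𝓝 0) (𝓝 _)
      refine tendsto_finsetSum _ fun i _ => ?_
      exact (((ContinuousLinearMap.smulRightL ℝ (Fin k → ℝ) F
        (ContinuousLinearMap.proj i)).continuous.continuousAt).comp (hgc i.succ))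

/-- A function with continuous partial derivatives along a basis is differentiable. -/
theorem hasFDerivAt_of_hasLineDerivAt_basis [FiniteDimensional ℝ Z] {ι : Type*} [Fintype ι] (b : Module.Basis ι ℝ Z)
    {U : Set Z} (hU : IsOpen U) {f : Z → F} (g : ι → Z → F) (hg : ∀ i, ContinuousOn (g i) U)
    (hf : ∀ i, ∀ z ∈ U, HasLineDerivAt ℝ f (g i z) z (b i)) {z : Z} (hz : z ∈ U) :
    HasFDerivAt f (∑ i, (LinearMap.toContinuousLinearMap (b.coord i)).smulRight (g i z)) z := by
  let c := b.reindex (Fintype.equivFin ι)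
  have h := (hasStrictFDerivAt_comp_sum_smul hU (fun i => c i)
    (fun i => g ((Fintype.equivFin ι).symm i)) (fun i => hg _)
    (fun i z hz => by simpa [c] using hf ((Fintype.equivFin ι).symm i) z hz) z hz).hasFDerivAt
  let L : Z →L[ℝ] (Fin (Fintype.card ι) → ℝ) := c.equivFun.toContinuousLinearEquiv
  have h0 : (0 : Fin (Fintype.card ι) → ℝ) = L (z - z) := by simp
  rw [h0] at h
  have h2 := h.comp z (L.hasFDerivAt.comp z ((hasFDerivAt_id z).sub_const z))
  refine (h2.congr_of_eventuallyEq (Eventually.of_forall fun y => ?_)).congr_fderiv ?_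
  · refine congrArg f ?_
    have : ∑ i, L (y - z) i • c i = y - z := c.sum_equivFun (y - z)
    change y = z + ∑ i, L (y - z) i • c i
    rw [this, add_sub_cancel]
  · refine ContinuousLinearMap.ext fun y => ?_
    simp only [ContinuousLinearMap.comp_apply, sum_apply,
      ContinuousLinearMap.smulRight_apply, ContinuousLinearMap.proj_apply]
    exact (Equiv.sum_comp (Fintype.equivFin ι).symm fun i => b.coord i y • g i z)

/-- A family of functions which is closed under the formation of partial derivatives and consists of
continuous functions consists of smooth functions. -/
theorem contDiffOn_of_closed_lineDeriv {ι : Type*} [Fintype ι] (b : Module.Basis ι ℝ Z)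
    {U : Set Z} (hU : IsOpen U) (𝓕 : Set (Z → F)) (hc : ∀ f ∈ 𝓕, ContinuousOn f U)
    (hd : ∀ f ∈ 𝓕, ∀ i, ∃ g ∈ 𝓕, ∀ z ∈ U, HasLineDerivAt ℝ f (g z) z (b i))
    {f : Z → F} (hf : f ∈ 𝓕) : ContDiffOn ℝ ∞ f U := by
  have := b.finiteDimensional_of_finite
  have key : ∀ n : ℕ, ∀ f ∈ 𝓕, ContDiffOn ℝ n f U := by
    intro n
    induction n with
    | zero => exact fun f hf => contDiffOn_zero.2 (hc f hf)
    | succ n ih =>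
      intro f hf
      choose g hg hg' using hd f hf
      have hfd := fun z (hz : z ∈ U) => hasFDerivAt_of_hasLineDerivAt_basis b hU g
        (fun i => hc _ (hg i)) hg' hz
      rw [Nat.cast_add, Nat.cast_one, contDiffOn_succ_iff_fderiv_of_isOpen hU]
      refine ⟨fun z hz => (hfd z hz).differentiableAt.differentiableWithinAt, by simp, ?_⟩
      refine ContDiffOn.congr (ContDiffOn.sum fun i _ => ?_) fun z hz => (hfd z hz).fderiv
      exact contDiffOn_const.smulRight (ih _ (hg i))
  exact contDiffOn_infty.2 fun n => key n f hf

end PartialDerivatives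

/-! ### Smooth families of loops -/

namespace LoopSpace

variable {F : Type*} [NormedAddCommGroup F] [NormedSpace ℂ F]

theorem continuous_iteratedDeriv_angular (j : ℕ) :
    Continuous fun p : LoopSpace F × ℝ => iteratedDeriv j p.1.angular p.2 :=
  (continuous_iff (fun f : LoopSpace F => f)).1 continuous_id j

/-- Convergence in the `C^∞` topology is locally uniform convergence of all derivatives. -/
theorem tendsto_of_iteratedDeriv {T : Type*} {l : Filter T} {f : T → LoopSpace F} {a : LoopSpace F}
    (h : ∀ k t₀, Tendsto (fun p : T × ℝ => iteratedDeriv k (f p.1).angular p.2) (l ×ˢ 𝓝 t₀)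
      (𝓝 (iteratedDeriv k a.angular t₀))) : Tendsto f l (𝓝 a) := by
  rw [nhds_induced, tendsto_comap_iff, tendsto_pi_nhds]
  intro k
  refine ContinuousMap.tendsto_of_tendstoLocallyUniformly ?_
  rw [tendstoLocallyUniformly_iff_forall_tendsto]
  intro t₀
  have h1 : Tendsto (fun p : T × ℝ => iteratedDeriv k a.angular p.2) (l ×ˢ 𝓝 t₀)
      (𝓝 (iteratedDeriv k a.angular t₀)) :=
    ((a.iterDeriv k).continuous.tendsto t₀).comp tendsto_snd
  exact (h1.prodMk_nhds (h k t₀)).mono_right (nhds_prod_eq.trans_le (nhds_prod_eq.symm.trans_le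
    (nhds_le_uniformity _)))

/-- A Gateaux smooth family of loops parametrised by a finite dimensional space is jointly smooth:
the derivatives of all orders of the family with respect to parameter and angle form a family of
continuous functions which is closed under partial derivatives. -/
theorem contDiffOn_of_gateauxSmoothOn {E : Type*} [NormedAddCommGroup E] [NormedSpace ℝ E]
    [FiniteDimensional ℝ E] {f : E → LoopSpace F} {U : Set E} (hU : IsOpen U)
    (hf : GateauxSmoothOn f U) :
    ContDiffOn ℝ ∞ (fun p : E × ℝ => (f p.1).angular p.2) (U ×ˢ univ) := by
  obtain ⟨D, h0, h1, h2⟩ := hf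
  let 𝓕 : Set (E × ℝ → F) := {φ | ∃ (k : ℕ) (h : Fin k → E) (j : ℕ),
    φ = fun p => iteratedDeriv j (D k p.1 h).angular p.2}
  have h𝓕 : (fun p : E × ℝ => iteratedDeriv 0 (D 0 p.1 0).angular p.2) ∈ 𝓕 := ⟨0, 0, 0, rfl⟩
  refine (contDiffOn_of_closed_lineDeriv
    ((Module.finBasis ℝ E).prod (Module.Basis.singleton Unit ℝ)) (hU.prod isOpen_univ) 𝓕 ?_ ?_
    h𝓕).congr fun p hp => ?_
  · rintro _ ⟨k, h, j, rfl⟩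
    refine (continuous_iteratedDeriv_angular j).comp_continuousOn
      (f := fun p : E × ℝ => (D k p.1 h, p.2)) (ContinuousOn.prodMk ?_ continuousOn_snd)
    exact (h2 k).comp (f := fun p : E × ℝ => (p.1, h)) (by fun_prop) fun p hp => ⟨hp.1, mem_univ _⟩
  · rintro _ ⟨k, h, j, rfl⟩ (i | i)
    · refine ⟨_, ⟨k + 1, Fin.snoc h (Module.finBasis ℝ E i), j, rfl⟩, fun p hp => ?_⟩
      rw [HasLineDerivAt, hasDerivAt_iff_tendsto_slope_zero]
      have h3 := h1 k p.1 hp.1 (Fin.snoc h (Module.finBasis ℝ E i))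
      have hc : Continuous fun a : LoopSpace F => jet F a j p.2 :=
        (continuous_iteratedDeriv_angular j).comp (Continuous.prodMk_left p.2)
      have h4 := (hc.tendsto _).comp h3
      refine h4.congr fun t => ?_
      simp only [Function.comp_apply, map_smul, map_sub, Fin.init_snoc, Fin.snoc_last]
      simp [jet, iterDeriv]
    · refine ⟨_, ⟨k, h, j + 1, rfl⟩, fun p _ => ?_⟩
      have hd : HasDerivAt (iteratedDeriv j (D k p.1 h).angular)
          (iteratedDeriv (j + 1) (D k p.1 h).angular p.2) (p.2 + 0) := by
        rw [iteratedDeriv_succ, add_zero]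
        exact (((D k p.1 h).contDiff_angular.differentiable_iteratedDeriv j
          (by exact_mod_cast WithTop.coe_lt_top _)) p.2).hasDerivAt
      have := HasDerivAt.comp_const_add p.2 0 hd
      simpa [HasLineDerivAt] using this
  · simp [h0 p.1 hp.1]

end LoopSpace

/-! ### The angle on the circle -/

/-- The angle of a point of the circle, in the interval `(t₀ - π, t₀ + π]`. -/
def circleAngle (t₀ : ℝ) (z : Circle) : ℝ := t₀ + Complex.arg ((z * (Circle.exp t₀)⁻¹ : Circle) : ℂ)

theorem exp_circleAngle (t₀ : ℝ) (z : Circle) : Circle.exp (circleAngle t₀ z) = z := by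
  rw [circleAngle, Circle.exp_add, Circle.exp_arg, mul_comm, inv_mul_cancel_right]

theorem circleAngle_exp (t₀ : ℝ) : circleAngle t₀ (Circle.exp t₀) = t₀ := by
  simp [circleAngle]

theorem contMDiffAt_circleAngle {t₀ : ℝ} {z : Circle}
    (hz : ((z * (Circle.exp t₀)⁻¹ : Circle) : ℂ) ∈ Complex.slitPlane) :
    ContMDiffAt (𝓡 1) 𝓘(ℝ, ℝ) ∞ (circleAngle t₀) z := by
  have : Fact (Module.finrank ℝ ℂ = 1 + 1) := finrank_real_complex_fact'
  have h1 : ContMDiffAt (𝓡 1) 𝓘(ℝ, ℂ) ∞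
      (fun z : Circle => ((z * (Circle.exp t₀)⁻¹ : Circle) : ℂ)) z :=
    (contMDiff_coe_sphere (n := 1) (E := ℂ)).contMDiffAt.comp z
      (contMDiff_mul_right (I := 𝓡 1) (n := ∞) (a := (Circle.exp t₀)⁻¹)).contMDiffAt
  have h2 : ContDiffAt ℝ ∞ (fun w : ℂ => t₀ + Complex.arg w)
      ((z * (Circle.exp t₀)⁻¹ : Circle) : ℂ) := by
    simp only [← Complex.log_im]
    exact contDiffAt_const.add (Complex.imCLM.contDiff.contDiffAt.comp _
      ((Complex.contDiffAt_log hz).restrict_scalars ℝ))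
  exact ContMDiffAt.comp (g := fun w : ℂ => t₀ + Complex.arg w)
    (f := fun z : Circle => ((z * (Circle.exp t₀)⁻¹ : Circle) : ℂ)) z h2.contMDiffAt h1

theorem contMDiffAt_circleAngle_exp (t₀ : ℝ) :
    ContMDiffAt (𝓡 1) 𝓘(ℝ, ℝ) ∞ (circleAngle t₀) (Circle.exp t₀) :=
  contMDiffAt_circleAngle (by simp)

/-! ### Jointly smooth families are Gateaux smooth -/

namespace LoopSpace

variable {F : Type*} [NormedAddCommGroup F] [NormedSpace ℂ F]

/-- A map from the circle which is a smooth function of the angle is smooth. -/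
theorem contMDiff_of_contDiff_exp {f : Circle → F} (hf : ContDiff ℝ ∞ fun t => f (Circle.exp t)) :
    ContMDiff (𝓡 1) 𝓘(ℝ, F) ∞ f := by
  intro z
  obtain ⟨t₀, rfl⟩ := Circle.exp_surjective z
  have h := hf.contMDiff.contMDiffAt.comp (Circle.exp t₀) (contMDiffAt_circleAngle_exp t₀)
  simpa only [Function.comp_def, exp_circleAngle] using h

section Parameter

variable {P : Type*} [NormedAddCommGroup P] [NormedSpace ℝ P]

/-- A family of loops, parametrised by an open subset `Ω` of a normed space, which is smooth as a
function of parameter and angle. -/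
def JointlySmooth (Ω : Set P) (φ : P → LoopSpace F) : Prop :=
  ContDiffOn ℝ ∞ (fun p : P × ℝ => (φ p.1).angular p.2) (Ω ×ˢ univ)

variable {Ω : Set P} {φ : P → LoopSpace F}

theorem _root_.ContDiffOn.fderiv_apply_of_isOpen {Z G : Type*} [NormedAddCommGroup Z]
    [NormedSpace ℝ Z] [NormedAddCommGroup G] [NormedSpace ℝ G] {f : Z → G} {s : Set Z}
    (hf : ContDiffOn ℝ ∞ f s) (hs : IsOpen s) :
    ContDiffOn ℝ ∞ (fun p : Z × Z => fderiv ℝ f p.1 p.2) (s ×ˢ univ) :=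
  ((hf.fderiv_of_isOpen hs (m := ∞) (by simp)).comp contDiffOn_fst fun p hp => hp.1).clm_apply
    contDiffOn_snd

theorem JointlySmooth.differentiableAt (hΩ : IsOpen Ω) (hφ : JointlySmooth Ω φ) {q : P}
    (hq : q ∈ Ω) (t : ℝ) :
    DifferentiableAt ℝ (fun p : P × ℝ => (φ p.1).angular p.2) (q, t) :=
  ((hφ (q, t) ⟨hq, mem_univ _⟩).contDiffAt
    ((hΩ.prod isOpen_univ).mem_nhds ⟨hq, mem_univ _⟩)).differentiableAt (by simp)

theorem JointlySmooth.fderiv_angular (hΩ : IsOpen Ω) (hφ : JointlySmooth Ω φ) {q : P} (hq : q ∈ Ω)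
    (v : P) (t : ℝ) : fderiv ℝ (fun q' => φ q' (Circle.exp t)) q v =
      fderiv ℝ (fun p : P × ℝ => (φ p.1).angular p.2) (q, t) (v, 0) := by
  have h := HasFDerivAt.comp (f := fun q' : P => (q', t)) q
    (hφ.differentiableAt hΩ hq t).hasFDerivAt
    ((hasFDerivAt_id q).prodMk (hasFDerivAt_const t q))
  have e : fderiv ℝ (fun q' => φ q' (Circle.exp t)) q = _ := h.fderiv
  rw [e]
  simp

theorem JointlySmooth.contMDiff_fderiv (hΩ : IsOpen Ω) (hφ : JointlySmooth Ω φ) {q : P}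
    (hq : q ∈ Ω) (v : P) :
    ContMDiff (𝓡 1) 𝓘(ℝ, F) ∞ fun θ => fderiv ℝ (fun q' => φ q' θ) q v := by
  refine contMDiff_of_contDiff_exp ?_
  simp only [hφ.fderiv_angular hΩ hq]
  rw [← contDiffOn_univ]
  exact (hφ.fderiv_apply_of_isOpen (hΩ.prod isOpen_univ)).comp
    (f := fun t : ℝ => ((q, t), (v, (0 : ℝ)))) (by fun_prop) fun t _ => ⟨⟨hq, mem_univ _⟩, mem_univ _⟩

open scoped Classical in
/-- The directional derivative, at `q` in the direction `v`, of a family of loops which is jointly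
smooth on `Ω`; it is set to zero for `q ∉ Ω`. -/
def directionalDeriv (hΩ : IsOpen Ω) (hφ : JointlySmooth Ω φ) (q v : P) : LoopSpace F :=
  if hq : q ∈ Ω then ⟨_, hφ.contMDiff_fderiv hΩ hq v⟩ else 0

theorem angular_directionalDeriv (hΩ : IsOpen Ω) (hφ : JointlySmooth Ω φ) {q : P} (hq : q ∈ Ω)
    (v : P) (t : ℝ) : (directionalDeriv hΩ hφ q v).angular t =
      fderiv ℝ (fun p : P × ℝ => (φ p.1).angular p.2) (q, t) (v, 0) := by
  rw [show directionalDeriv hΩ hφ q v = ⟨_, hφ.contMDiff_fderiv hΩ hq v⟩ from dif_pos hq]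
  exact hφ.fderiv_angular hΩ hq v t

theorem jointlySmooth_directionalDeriv (hΩ : IsOpen Ω) (hφ : JointlySmooth Ω φ) :
    JointlySmooth (Ω ×ˢ univ) fun p : P × P => directionalDeriv hΩ hφ p.1 p.2 := by
  have h := (hφ.fderiv_apply_of_isOpen (hΩ.prod isOpen_univ)).comp
    (f := fun p : (P × P) × ℝ => ((p.1.1, p.2), (p.1.2, (0 : ℝ))))
    (s := (Ω ×ˢ univ) ×ˢ univ) (by fun_prop) fun t ht => ⟨⟨ht.1.1, mem_univ _⟩, mem_univ _⟩
  exact h.congr fun p hp => angular_directionalDeriv hΩ hφ hp.1.1 p.1.2 p.2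

theorem JointlySmooth.contDiffOn_iteratedDeriv (hΩ : IsOpen Ω) (hφ : JointlySmooth Ω φ) (k : ℕ) :
    ContDiffOn ℝ ∞ (fun p : P × ℝ => iteratedDeriv k (φ p.1).angular p.2) (Ω ×ˢ univ) ∧
      ∀ q ∈ Ω, ∀ t, iteratedDeriv (k + 1) (φ q).angular t =
        fderiv ℝ (fun p : P × ℝ => iteratedDeriv k (φ p.1).angular p.2) (q, t) (0, 1) := by
  have step : ∀ k, ContDiffOn ℝ ∞ (fun p : P × ℝ => iteratedDeriv k (φ p.1).angular p.2)
      (Ω ×ˢ univ) → ∀ q ∈ Ω, ∀ t, iteratedDeriv (k + 1) (φ q).angular t =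
        fderiv ℝ (fun p : P × ℝ => iteratedDeriv k (φ p.1).angular p.2) (q, t) (0, 1) := by
    intro k hk q hq t
    have hd : DifferentiableAt ℝ (fun p : P × ℝ => iteratedDeriv k (φ p.1).angular p.2) (q, t) :=
      ((hk (q, t) ⟨hq, mem_univ _⟩).contDiffAt
        ((hΩ.prod isOpen_univ).mem_nhds ⟨hq, mem_univ _⟩)).differentiableAt (by simp)
    have h := hd.hasFDerivAt.comp_hasDerivAt t ((hasDerivAt_const t q).prodMk (hasDerivAt_id t))
    rw [iteratedDeriv_succ]
    exact h.deriv
  induction k with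
  | zero =>
    have h0 : ContDiffOn ℝ ∞ (fun p : P × ℝ => iteratedDeriv 0 (φ p.1).angular p.2)
        (Ω ×ˢ univ) := by simpa only [iteratedDeriv_zero, JointlySmooth] using hφ
    exact ⟨h0, step 0 h0⟩
  | succ k ih =>
    have h1 : ContDiffOn ℝ ∞ (fun p : P × ℝ => iteratedDeriv (k + 1) (φ p.1).angular p.2)
        (Ω ×ˢ univ) := by
      refine ContDiffOn.congr ?_ fun p hp => ih.2 p.1 hp.1 p.2
      exact (ih.1.fderiv_apply_of_isOpen (hΩ.prod isOpen_univ)).comp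
        (f := fun p : P × ℝ => (p, ((0 : P), (1 : ℝ)))) (by fun_prop) fun t ht => ⟨ht, mem_univ _⟩
    exact ⟨h1, step (k + 1) h1⟩

/-- Derivatives with respect to the angle and to the parameter commute. -/
theorem iteratedDeriv_directionalDeriv (hΩ : IsOpen Ω) (hφ : JointlySmooth Ω φ) {q : P}
    (hq : q ∈ Ω) (v : P) (k : ℕ) :
    ∀ t, iteratedDeriv k (directionalDeriv hΩ hφ q v).angular t =
      fderiv ℝ (fun p : P × ℝ => iteratedDeriv k (φ p.1).angular p.2) (q, t) (v, 0) := by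
  induction k with
  | zero => simpa only [iteratedDeriv_zero] using angular_directionalDeriv hΩ hφ hq v
  | succ k ih =>
    intro t
    obtain ⟨hk, hk'⟩ := hφ.contDiffOn_iteratedDeriv hΩ k
    set Φ := fun p : P × ℝ => iteratedDeriv k (φ p.1).angular p.2 with hΦ
    have hmem : Ω ×ˢ univ ∈ 𝓝 (q, t) := (hΩ.prod isOpen_univ).mem_nhds ⟨hq, mem_univ _⟩
    have hcd : ContDiffAt ℝ ∞ Φ (q, t) := (hk (q, t) ⟨hq, mem_univ _⟩).contDiffAt hmem
    have hd : DifferentiableAt ℝ (fderiv ℝ Φ) (q, t) :=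
      (hcd.fderiv_right (m := ∞) (by simp)).differentiableAt (by simp)
    have hsymm : IsSymmSndFDerivAt ℝ Φ (q, t) := hcd.isSymmSndFDerivAt
      (by simpa using (WithTop.coe_le_coe.2 le_top : ((2 : ℕ∞) : WithTop ℕ∞) ≤ ∞))
    have e1 : iteratedDeriv (k + 1) (directionalDeriv hΩ hφ q v).angular t =
        fderiv ℝ (fderiv ℝ Φ) (q, t) (0, 1) (v, 0) := by
      rw [iteratedDeriv_succ, funext ih]
      have h := hd.hasFDerivAt.comp_hasDerivAt t ((hasDerivAt_const t q).prodMk (hasDerivAt_id t))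
      exact (h.clm_apply (hasDerivAt_const t ((v, 0) : P × ℝ))).deriv.trans (by simp)
    have e2 : fderiv ℝ (fun p : P × ℝ => iteratedDeriv (k + 1) (φ p.1).angular p.2) (q, t) (v, 0) =
        fderiv ℝ (fderiv ℝ Φ) (q, t) (v, 0) (0, 1) := by
      have heq : (fun p : P × ℝ => iteratedDeriv (k + 1) (φ p.1).angular p.2) =ᶠ[𝓝 (q, t)]
          fun p => fderiv ℝ Φ p (0, 1) := by
        filter_upwards [hmem] with p hp using hk' p.1 hp.1 p.2
      rw [heq.fderiv_eq, (hd.hasFDerivAt.clm_apply (hasFDerivAt_const _ _)).fderiv]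
      simp
    rw [e1, e2, hsymm.eq]

/-- The difference quotients of a jointly smooth family converge in the `C^∞` topology. The
convergence is uniform in the angle because a `C¹` function is strictly differentiable. -/
theorem tendsto_directionalDeriv (hΩ : IsOpen Ω) (hφ : JointlySmooth Ω φ) {q : P}
    (hq : q ∈ Ω) (v : P) :
    Tendsto (fun s : ℝ => s⁻¹ • (φ (q + s • v) - φ q)) (𝓝[≠] 0)
      (𝓝 (directionalDeriv hΩ hφ q v)) := by
  refine tendsto_of_iteratedDeriv fun k t₀ => ?_
  have hk := (hφ.contDiffOn_iteratedDeriv hΩ k).1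
  rw [iteratedDeriv_directionalDeriv hΩ hφ hq]
  set Φ := fun p : P × ℝ => iteratedDeriv k (φ p.1).angular p.2 with hΦ
  have hcd : ContDiffAt ℝ ∞ Φ (q, t₀) := (hk (q, t₀) ⟨hq, mem_univ _⟩).contDiffAt
    ((hΩ.prod isOpen_univ).mem_nhds ⟨hq, mem_univ _⟩)
  have hs := (hcd.hasStrictFDerivAt (by simp)).isLittleO
  have hm : Tendsto (fun p : ℝ × ℝ => (((q + p.1 • v, p.2), (q, p.2)) : (P × ℝ) × (P × ℝ)))
      (𝓝[≠] 0 ×ˢ 𝓝 t₀) (𝓝 ((q, t₀), (q, t₀))) := by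
    have hc : Continuous fun p : ℝ × ℝ => (((q + p.1 • v, p.2), (q, p.2)) : (P × ℝ) × (P × ℝ)) := by
      fun_prop
    have := hc.tendsto (0, t₀)
    simp only [zero_smul, add_zero] at this
    refine this.mono_left ?_
    rw [nhds_prod_eq]
    exact Filter.prod_mono nhdsWithin_le_nhds le_rfl
  have h1 := hs.comp_tendsto hm
  have h2 : (fun p : ℝ × ℝ => Φ (q + p.1 • v, p.2) - Φ (q, p.2) -
      fderiv ℝ Φ (q, t₀) (p.1 • (v, 0))) =o[𝓝[≠] 0 ×ˢ 𝓝 t₀] fun p => p.1 := by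
    refine Asymptotics.IsLittleO.trans_isBigO (g := fun p : ℝ × ℝ => p.1 • ((v, 0) : P × ℝ)) ?_ ?_
    · simpa [Function.comp_def, -map_sub] using h1
    · exact Asymptotics.IsBigO.of_bound ‖((v, 0) : P × ℝ)‖
        (Eventually.of_forall fun p => by rw [norm_smul, mul_comm])
  have h3 := h2.tendsto_inv_smul_nhds_zero
  have h4 := h3.add_const (fderiv ℝ Φ (q, t₀) (v, 0))
  rw [zero_add] at h4
  refine h4.congr' ?_
  have hne : ∀ᶠ p : ℝ × ℝ in 𝓝[≠] 0 ×ˢ 𝓝 t₀, p.1 ≠ 0 :=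
    tendsto_fst.eventually (eventually_mem_nhdsWithin)
  filter_upwards [hne] with p hp
  have e : iteratedDeriv k (p.1⁻¹ • (φ (q + p.1 • v) - φ q)).angular p.2 =
      p.1⁻¹ • (Φ (q + p.1 • v, p.2) - Φ (q, p.2)) := by
    change jet F (p.1⁻¹ • (φ (q + p.1 • v) - φ q)) k p.2 = _
    rw [map_smul, map_sub]
    rfl
  rw [e, map_smul, smul_sub, smul_smul, inv_mul_cancel₀ hp, one_smul, sub_add_cancel]

theorem JointlySmooth.continuousOn (hΩ : IsOpen Ω) (hφ : JointlySmooth Ω φ) :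
    ContinuousOn φ Ω := by
  intro q hq
  refine ContinuousAt.continuousWithinAt (tendsto_of_iteratedDeriv fun k t₀ => ?_)
  have h := ((hφ.contDiffOn_iteratedDeriv hΩ k).1 (q, t₀) ⟨hq, mem_univ _⟩).contDiffAt
    ((hΩ.prod isOpen_univ).mem_nhds ⟨hq, mem_univ _⟩)
  rw [← nhds_prod_eq]
  exact h.continuousAt.tendsto

theorem JointlySmooth.comp {P' : Type*} [NormedAddCommGroup P'] [NormedSpace ℝ P'] {f : P' → P}
    {Ω' : Set P'} (hφ : JointlySmooth Ω φ) (hf : ContDiff ℝ ∞ f) (hm : MapsTo f Ω' Ω) :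
    JointlySmooth Ω' fun p => φ (f p) :=
  ContDiffOn.comp (f := fun p : P' × ℝ => (f p.1, p.2)) hφ
    ((hf.comp contDiff_fst).prodMk contDiff_snd).contDiffOn fun _ hp => ⟨hm hp.1, mem_univ _⟩

/-- A jointly smooth family of loops is Gateaux smooth; the iterated derivatives are found among the
families `(v, h₁, …, h_k) ↦ φ v h` which are jointly smooth in `v` and the directions `hᵢ`. -/
theorem JointlySmooth.gateauxSmoothOn (hΩ : IsOpen Ω) (hφ : JointlySmooth Ω φ) :
    GateauxSmoothOn φ Ω := by
  have hop : ∀ k : ℕ, IsOpen (Ω ×ˢ (univ : Set (Fin k → P))) := fun k => hΩ.prod isOpen_univ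
  refine GateauxSmoothOn.of_closed
    (fun k ψ => JointlySmooth (Ω ×ˢ univ) fun p : P × (Fin k → P) => ψ p.1 p.2)
    ⟨fun v _ => φ v, hφ.comp contDiff_fst fun _ hp => hp.1, fun _ _ _ => rfl⟩ ?_
    fun k ψ hψ => hψ.continuousOn (hop k)
  intro k ψ hψ
  refine ⟨fun v h => directionalDeriv (hop k) hψ (v, Fin.init h) (h (Fin.last k), 0), ?_, ?_⟩
  · refine (jointlySmooth_directionalDeriv (hop k) hψ).comp
      (f := fun p : P × (Fin (k + 1) → P) => ((p.1, Fin.init p.2), (p.2 (Fin.last k), 0)))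
      ?_ fun p hp => ⟨⟨hp.1, mem_univ _⟩, mem_univ _⟩
    unfold Fin.init
    fun_prop
  · intro v hv h
    have := tendsto_directionalDeriv (hop k) hψ (q := (v, Fin.init h)) ⟨hv, mem_univ _⟩
      (h (Fin.last k), 0)
    simpa using this

end Parameter

end LoopSpace

/-! ### The exponential law for maps to the based loop group -/

section ExponentialLaw

variable {E M : Type*} [NormedAddCommGroup E] [NormedSpace ℝ E] [FiniteDimensional ℝ E]
  [TopologicalSpace M] [ChartedSpace E M] [IsManifold 𝓘(ℝ, E) ∞ M] {n : ℕ}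

/-- The exponential law: a map `γ : U → ΩG` is smooth if and only if `(x, θ) ↦ γ(x)(θ)` is a smooth
map `U × S¹ → G`. -/
theorem omegaSmoothOn_iff {U : Set M} (hU : IsOpen U) {γ : M → OmegaG n} :
    OmegaSmoothOn E M U γ ↔
      GSmoothOn (𝓘(ℝ, E).prod (𝓡 1)) (U ×ˢ univ) fun p : M × Circle => (γ p.1).1 p.2 := by
  constructor
  · rintro h ⟨x, θ⟩ ⟨hx, -⟩
    obtain ⟨t₀, rfl⟩ := Circle.exp_surjective θ
    let e := chartAt E x
    have he : e ∈ IsManifold.maximalAtlas 𝓘(ℝ, E) ∞ M := IsManifold.chart_mem_maximalAtlas x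
    have hxe : x ∈ e.source := mem_chart_source E x
    have hop : IsOpen (e.target ∩ e.symm ⁻¹' U) := e.isOpen_inter_preimage_symm hU
    have h1 := LoopSpace.contDiffOn_of_gateauxSmoothOn hop (h e (chart_mem_atlas E x))
    have hmem : (e x, t₀) ∈ (e.target ∩ e.symm ⁻¹' U) ×ˢ (univ : Set ℝ) :=
      ⟨⟨e.map_source hxe, by rwa [mem_preimage, e.left_inv hxe]⟩, mem_univ _⟩
    have h2 := ((h1 _ hmem).contDiffAt ((hop.prod isOpen_univ).mem_nhds hmem)).contMDiffAt
    have h3 : ContMDiffAt (𝓘(ℝ, E).prod (𝓡 1)) 𝓘(ℝ, E × ℝ) ∞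
        (fun p : M × Circle => (e p.1, circleAngle t₀ p.2)) (x, Circle.exp t₀) :=
      ((contMDiffAt_of_mem_maximalAtlas he hxe).comp (x, Circle.exp t₀) contMDiffAt_fst).prodMk_space
        (ContMDiffAt.comp (g := circleAngle t₀) (f := Prod.snd) (x, Circle.exp t₀)
          (contMDiffAt_circleAngle_exp t₀) contMDiffAt_snd)
    rw [show (e x, t₀) = (fun p : M × Circle => (e p.1, circleAngle t₀ p.2)) (x, Circle.exp t₀) by
      simp [circleAngle_exp]] at h2
    refine ((h2.comp (x, Circle.exp t₀) h3).congr_of_eventuallyEq ?_).contMDiffWithinAt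
    have hev : ∀ᶠ p : M × Circle in 𝓝 (x, Circle.exp t₀), p.1 ∈ e.source :=
      continuous_fst.continuousAt.eventually (e.open_source.mem_nhds hxe)
    filter_upwards [hev] with p hp
    change _ = ((γ (e.symm (e p.1))).1 (Circle.exp (circleAngle t₀ p.2)) : EndV n)
    rw [e.left_inv hp, exp_circleAngle]
  · intro h e he
    have he' : e ∈ IsManifold.maximalAtlas 𝓘(ℝ, E) ∞ M :=
      IsManifold.subset_maximalAtlas he
    have hop : IsOpen (e.target ∩ e.symm ⁻¹' U) := e.isOpen_inter_preimage_symm hU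
    refine LoopSpace.JointlySmooth.gateauxSmoothOn hop ?_
    refine contMDiffOn_iff_contDiffOn.1 ?_
    have h1 : ContMDiffOn 𝓘(ℝ, E × ℝ) 𝓘(ℝ, E) ∞ (fun p : E × ℝ => e.symm p.1)
        ((e.target ∩ e.symm ⁻¹' U) ×ˢ univ) :=
      (contMDiffOn_symm_of_mem_maximalAtlas he').comp contDiff_fst.contMDiff.contMDiffOn
        fun p hp => hp.1.1
    have h2 : ContMDiffOn 𝓘(ℝ, E × ℝ) (𝓡 1) ∞ (fun p : E × ℝ => Circle.exp p.2)
        ((e.target ∩ e.symm ⁻¹' U) ×ˢ univ) :=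
      (contMDiff_circleExp.comp contDiff_snd.contMDiff).contMDiffOn
    have h' : ContMDiffOn (𝓘(ℝ, E).prod (𝓡 1)) 𝓘(ℝ, EndV n) ∞
      (fun p : M × Circle => ((γ p.1).1 p.2 : EndV n)) (U ×ˢ univ) := h
    exact h'.comp (h1.prodMk h2) fun p hp => ⟨hp.1.2, mem_univ _⟩

end ExponentialLaw

/-! ### Smooth sections of a principal `G`-bundle along a map -/

section SectionsAlong

variable {E' H' X : Type*} [NormedAddCommGroup E'] [NormedSpace ℝ E'] [TopologicalSpace H']
  {I : ModelWithCorners ℝ E' H'} [TopologicalSpace X] [ChartedSpace H' X]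
  {E'' H'' N : Type*} [NormedAddCommGroup E''] [NormedSpace ℝ E''] [TopologicalSpace H'']
  {J : ModelWithCorners ℝ E'' H''} [TopologicalSpace N] [ChartedSpace H'' N]
  {E₃ H₃ N' : Type*} [NormedAddCommGroup E₃] [NormedSpace ℝ E₃] [TopologicalSpace H₃]
  {J' : ModelWithCorners ℝ E₃ H₃} [TopologicalSpace N'] [ChartedSpace H₃ N'] {n : ℕ}

/-- Smoothness at a point of a map to `G`. -/
def GSmoothAt (J : ModelWithCorners ℝ E'' H'') (g : N → GLV n) (z : N) : Prop :=
  ContMDiffAt J 𝓘(ℝ, EndV n) ∞ (fun w => (g w : EndV n)) z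

theorem GSmoothAt.mul {g h : N → GLV n} {z : N} (hg : GSmoothAt J g z) (hh : GSmoothAt J h z) :
    GSmoothAt J (fun w => g w * h w) z := by
  have hg' : ContMDiffAt J 𝓘(ℝ, EndV n) ∞ (fun w => (g w : EndV n)) z := hg
  have hh' : ContMDiffAt J 𝓘(ℝ, EndV n) ∞ (fun w => (h w : EndV n)) z := hh
  exact ((mulB n).contMDiff.contMDiffAt.comp z hg').clm_apply hh'

theorem GSmoothAt.inv {g : N → GLV n} {z : N} (hg : GSmoothAt J g z) :
    GSmoothAt J (fun w => (g w)⁻¹) z := by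
  have h1 : ContMDiffAt 𝓘(ℝ, EndV n) 𝓘(ℝ, EndV n) ∞ Ring.inverse ((g z : GLV n) : EndV n) :=
    (contDiffAt_ringInverse ℝ (g z)).contMDiffAt
  exact (h1.comp z hg).congr_of_eventuallyEq (Eventually.of_forall fun w => by simp)

theorem GSmoothAt.congr {g h : N → GLV n} {z : N} (hg : GSmoothAt J g z) (e : h =ᶠ[𝓝 z] g) :
    GSmoothAt J h z :=
  ContMDiffAt.congr_of_eventuallyEq hg (e.fun_comp fun a : GLV n => (a : EndV n))

theorem GSmoothAt.comp {g : N → GLV n} {h : N' → N} {w : N'} (hg : GSmoothAt J g (h w))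
    (hh : ContMDiffAt J' J ∞ h w) : GSmoothAt J' (fun w => g (h w)) w :=
  ContMDiffAt.comp (g := fun z => (g z : EndV n)) w hg hh

theorem gSmoothAt_const (g : GLV n) (z : N) : GSmoothAt J (fun _ => g) z := contMDiffAt_const

theorem GSmoothOn.gSmoothAt {U : Set N} {g : N → GLV n} (hg : GSmoothOn J U g) {z : N}
    (hz : U ∈ 𝓝 z) : GSmoothAt J g z :=
  ContMDiffOn.contMDiffAt (f := fun w => (g w : EndV n)) hg hz

theorem gSmoothOn_of_gSmoothAt {U : Set N} {g : N → GLV n} (hg : ∀ z ∈ U, GSmoothAt J g z) :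
    GSmoothOn J U g := fun z hz => (hg z hz).contMDiffWithinAt

open scoped Classical in
/-- The coordinate, with respect to the local section `s`, of a section `σ` of `P` along `f`: the
`G`-valued function `g` with `σ(z) = s(f(z))g(z)` where `s` is defined, and `1` elsewhere. -/
def PrincipalBundle.secCoord (P : PrincipalBundle.{v} (finModel I X n)) {N : Type*} {f : N → X}
    (σ : ∀ z, P.fib (f z)) (s : LocalSection P.fib) (z : N) : GLV n :=
  if h : f z ∈ s.base then P.diff (s.val (f z) h) (σ z) else 1

/-- Smoothness at `z` of a section `σ` of `P` along a map `f : N → X`, i.e. of a section of the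
pullback `f^*P`: the coordinate with respect to a distinguished local section is smooth. -/
def SmoothSecAt (J : ModelWithCorners ℝ E'' H'') (P : PrincipalBundle.{v} (finModel I X n))
    (f : N → X) (σ : ∀ z, P.fib (f z)) (z : N) : Prop :=
  ∃ s ∈ P.atlas, f z ∈ s.base ∧ GSmoothAt J (P.secCoord σ s) z

variable {P : PrincipalBundle.{v} (finModel I X n)} {f : N → X} {σ τ : ∀ z, P.fib (f z)} {z : N}

theorem PrincipalBundle.act_secCoord (P : PrincipalBundle.{v} (finModel I X n)) {N : Type*}
    {f : N → X} (σ : ∀ z, P.fib (f z)) {s : LocalSection P.fib} {z : N} (h : f z ∈ s.base) :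
    P.act (s.val (f z) h) (P.secCoord σ s z) = σ z := by
  rw [PrincipalBundle.secCoord, dif_pos h, PrincipalBundle.act_diff]

theorem PrincipalBundle.secCoord_eq (P : PrincipalBundle.{v} (finModel I X n)) {N : Type*}
    {f : N → X} {σ : ∀ z, P.fib (f z)} {s : LocalSection P.fib} {z : N} (h : f z ∈ s.base)
    {g : GLV n} (e : σ z = P.act (s.val (f z) h) g) : P.secCoord σ s z = g :=
  P.act_inj ((P.act_secCoord σ h).trans e)

theorem SmoothSecAt.of_eventually {s : LocalSection P.fib} (hs : s ∈ P.atlas) {g : N → GLV n}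
    (hg : GSmoothAt J g z)
    (h : ∀ᶠ w in 𝓝 z, ∃ hw : f w ∈ s.base, σ w = P.act (s.val (f w) hw) (g w)) :
    SmoothSecAt J P f σ z :=
  ⟨s, hs, h.self_of_nhds.1, hg.congr <| h.mono fun _ ⟨hw, e⟩ => P.secCoord_eq hw e⟩

/-- Smoothness of a section does not depend on the distinguished local section. -/
theorem SmoothSecAt.secCoord (hf : ContMDiffAt J I ∞ f z) (h : SmoothSecAt J P f σ z)
    {t : LocalSection P.fib} (ht : t ∈ P.atlas) (hz : f z ∈ t.base) :
    GSmoothAt J (P.secCoord σ t) z := by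
  obtain ⟨s, hs, hzs, hg⟩ := h
  obtain ⟨k, hk, e⟩ := P.isPrincipal.transition t ht s hs
  have hop : (t.base ∩ s.base : Set X) ∈ 𝓝 (f z) :=
    (t.base.isOpen.inter s.base.isOpen).mem_nhds ⟨hz, hzs⟩
  have hk' : GSmoothAt J (fun w => k (f w)) z :=
    GSmoothAt.comp (GSmoothOn.gSmoothAt (J := I) hk hop) hf
  refine (hk'.mul hg).congr ?_
  filter_upwards [hf.continuousAt.eventually hop] with w hw
  refine P.secCoord_eq hw.1 ?_
  rw [P.isPrincipal.act_mul, ← e _ hw.1 hw.2, P.act_secCoord]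

theorem SmoothSecAt.congr (h : SmoothSecAt J P f σ z) (e : ∀ᶠ w in 𝓝 z, τ w = σ w) :
    SmoothSecAt J P f τ z := by
  obtain ⟨s, hs, hz, hg⟩ := h
  refine ⟨s, hs, hz, hg.congr (e.mono fun w hw => ?_)⟩
  simp only [PrincipalBundle.secCoord, hw]

theorem SmoothSecAt.act (hf : ContMDiffAt J I ∞ f z) (h : SmoothSecAt J P f σ z) {g : N → GLV n}
    (hg : GSmoothAt J g z) : SmoothSecAt J P f (fun w => P.act (σ w) (g w)) z := by
  obtain ⟨s, hs, hz, hc⟩ := h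
  refine SmoothSecAt.of_eventually hs (hc.mul hg) ?_
  filter_upwards [hf.continuousAt.eventually (s.base.isOpen.mem_nhds hz)] with w hw
  exact ⟨hw, by rw [P.isPrincipal.act_mul, P.act_secCoord]⟩

theorem SmoothSecAt.diff (hf : ContMDiffAt J I ∞ f z) (hσ : SmoothSecAt J P f σ z)
    (hτ : SmoothSecAt J P f τ z) : GSmoothAt J (fun w => P.diff (σ w) (τ w)) z := by
  obtain ⟨s, hs, hz, hc⟩ := hσ
  refine (hc.inv.mul (hτ.secCoord hf hs hz)).congr ?_
  filter_upwards [hf.continuousAt.eventually (s.base.isOpen.mem_nhds hz)] with w hw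
  refine P.act_inj (p := σ w) ?_
  rw [P.act_diff, P.isPrincipal.act_mul]
  conv_rhs => rw [← P.act_secCoord σ hw, ← P.isPrincipal.act_mul _ (P.secCoord σ s w),
    mul_inv_cancel, P.isPrincipal.act_one, P.act_secCoord]

/-- The pullback of a section along `f` to a section along `f' = f ∘ h`. -/
def PrincipalBundle.pull (P : PrincipalBundle.{v} (finModel I X n)) {N N' : Type*} {f : N → X}
    (σ : ∀ z, P.fib (f z)) (h : N' → N) {f' : N' → X} (e : ∀ w, f (h w) = f' w) (w : N') :
    P.fib (f' w) :=
  e w ▸ σ (h w)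

theorem SmoothSecAt.pull {h : N' → N} {f' : N' → X} (e : ∀ w, f (h w) = f' w) {w : N'}
    (hh : ContMDiffAt J' J ∞ h w) (hσ : SmoothSecAt J P f σ (h w)) :
    SmoothSecAt J' P f' (P.pull σ h e) w := by
  obtain rfl : (fun w => f (h w)) = f' := funext e
  obtain ⟨s, hs, hz, hc⟩ := hσ
  exact ⟨s, hs, hz, hc.comp hh⟩

theorem SmoothSecAt.comp {h : N' → N} {w : N'} (hσ : SmoothSecAt J P f σ (h w))
    (hh : ContMDiffAt J' J ∞ h w) :
    SmoothSecAt J' P (fun w => f (h w)) (fun w => σ (h w)) w :=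
  SmoothSecAt.pull (f' := fun w => f (h w)) (fun _ => rfl) hh hσ

theorem PrincipalBundle.pull_eq_pull (P : PrincipalBundle.{v} (finModel I X n)) {N N' : Type*}
    {f : N → X} (σ : ∀ z, P.fib (f z)) {h k : N' → N} {f' : N' → X} (e : ∀ w, f (h w) = f' w)
    (e' : ∀ w, f (k w) = f' w) {w : N'} (hw : h w = k w) : P.pull σ h e w = P.pull σ k e' w := by
  have key : ∀ (a b : N) (ea : f a = f' w) (eb : f b = f' w), a = b → ea ▸ σ a = eb ▸ σ b := by
    rintro a _ ea eb rfl
    rfl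
  exact key _ _ (e w) (e' w) hw

theorem SmoothSecAt.map {R : PrincipalBundle.{v} (finModel I X n)} (φ : P ⟶ R)
    (hf : ContMDiffAt J I ∞ f z) (h : SmoothSecAt J P f σ z) :
    SmoothSecAt J R f (fun w => PrincipalBundle.Hom.map φ (f w) (σ w)) z := by
  obtain ⟨s, hs, hz, hc⟩ := h
  obtain ⟨t, ht, hzt⟩ := R.isPrincipal.cover (f z)
  obtain ⟨W, hW, g, hg, e⟩ := PrincipalBundle.Hom.smooth φ s hs t ht (f z) hz hzt
  have hWn : (W : Set X) ∈ 𝓝 (f z) := W.isOpen.mem_nhds hW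
  have hg' : GSmoothAt J (fun w => g (f w)) z :=
    GSmoothAt.comp (GSmoothOn.gSmoothAt (J := I) hg hWn) hf
  refine SmoothSecAt.of_eventually ht (hg'.mul hc) ?_
  filter_upwards [hf.continuousAt.eventually hWn] with w hw
  obtain ⟨a, b, e1⟩ := e (f w) hw
  refine ⟨b, ?_⟩
  conv_lhs => rw [← P.act_secCoord σ a, PrincipalBundle.Hom.equivariant]
  rw [R.isPrincipal.act_mul]
  exact congrArg (fun q => R.act q (P.secCoord σ s w)) e1

/-- Smoothness on an open set in terms of the distinguished local section `s`. -/
theorem exists_gSmoothOn_secCoord (hf : ContMDiff J I ∞ f) {U : Set N}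
    (h : ∀ z ∈ U, SmoothSecAt J P f σ z) {s : LocalSection P.fib} (hs : s ∈ P.atlas) :
    ∃ g : N → GLV n, GSmoothOn J (U ∩ f ⁻¹' s.base) g ∧
      ∀ z (hz : f z ∈ s.base), σ z = P.act (s.val (f z) hz) (g z) :=
  ⟨P.secCoord σ s, gSmoothOn_of_gSmoothAt fun z hz => (h z hz.1).secCoord hf.contMDiffAt hs hz.2,
    fun _ hz => (P.act_secCoord σ hz).symm⟩

end SectionsAlong

/-! ### Smooth loops, framings and local sections as sections along maps -/

section Transform

variable {E M : Type*} [NormedAddCommGroup E] [NormedSpace ℝ E] [TopologicalSpace M]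
  [ChartedSpace E M] {n : ℕ}

theorem contMDiff_mk_left (m : M) :
    ContMDiff (𝓡 1) (𝓘(ℝ, E).prod (𝓡 1)) ∞ fun θ : Circle => (m, θ) :=
  contMDiff_const.prodMk contMDiff_id

theorem contMDiff_mk_one :
    ContMDiff 𝓘(ℝ, E) (𝓘(ℝ, E).prod (𝓡 1)) ∞ fun m : M => (m, (1 : Circle)) :=
  contMDiff_id.prodMk contMDiff_const

theorem smoothLoop_iff {P : GBundle.{v} E M n} {m : M} {p : ∀ θ, P.fib (m, θ)} :
    SmoothLoop P m p ↔ ∀ θ, SmoothSecAt (𝓡 1) P (fun θ => (m, θ)) p θ := by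
  constructor
  · intro h θ
    obtain ⟨s, hs, hθ⟩ := P.isPrincipal.cover (m, θ)
    obtain ⟨W, hW, g, hg, e⟩ := h s hs θ hθ
    have hWn : (W : Set Circle) ∈ 𝓝 θ := W.isOpen.mem_nhds hW
    exact SmoothSecAt.of_eventually hs (hg.gSmoothAt hWn) (eventually_of_mem hWn e)
  · intro h s hs θ hθ
    obtain ⟨g, hg, e⟩ := exists_gSmoothOn_secCoord (contMDiff_mk_left (E := E) m)
      (U := univ) (fun θ _ => h θ) hs
    exact ⟨⟨_, isOpen_univ.inter (s.base.isOpen.preimage (contMDiff_mk_left (E := E) m).continuous)⟩,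
      ⟨mem_univ _, hθ⟩, g, hg, fun η hη => ⟨hη.2, e η hη.2⟩⟩

theorem smoothFraming_iff {P : GBundle.{v} E M n} {s₀ : ∀ m, P.fib (m, 1)} :
    SmoothFraming E P.toPrePrincipalBundle s₀ ↔
      ∀ m, SmoothSecAt 𝓘(ℝ, E) P (fun m => (m, 1)) s₀ m := by
  have hc := (contMDiff_mk_one (E := E) (M := M)).continuous
  constructor
  · intro h m
    obtain ⟨s, hs, hm⟩ := P.isPrincipal.cover (m, 1)
    obtain ⟨g, hg, e⟩ := h s hs
    have hn : {m : M | (m, 1) ∈ s.base} ∈ 𝓝 m := (s.base.isOpen.preimage hc).mem_nhds hm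
    exact SmoothSecAt.of_eventually hs (hg.gSmoothAt hn) (eventually_of_mem hn fun m hm => ⟨hm, e m hm⟩)
  · intro h s hs
    obtain ⟨g, hg, e⟩ := exists_gSmoothOn_secCoord (contMDiff_mk_one (E := E))
      (U := univ) (fun θ _ => h θ) hs
    rw [univ_inter] at hg
    exact ⟨g, hg, e⟩

open scoped Classical in
/-- The section of `P` over `U × S¹` defined by a local section over `U` of the inverse caloron
transform, with arbitrary values outside `U × S¹`. -/
def uncurrySection (P : FramedGBundle.{v} E M n) (s : LocalSection (preInvCaloron P).fib)
    (z : M × Circle) : P.bundle.fib z :=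
  if h : z.1 ∈ s.base then (s.val z.1 h).1 z.2 else P.bundle.point z

theorem uncurrySection_eq (P : FramedGBundle.{v} E M n) (s : LocalSection (preInvCaloron P).fib)
    {z : M × Circle} (h : z.1 ∈ s.base) : uncurrySection P s z = (s.val z.1 h).1 z.2 := dif_pos h

theorem mem_preInvCaloron_atlas {P : FramedGBundle.{v} E M n}
    {s : LocalSection (preInvCaloron P).fib} : s ∈ (preInvCaloron P).atlas ↔
      ∀ z : M × Circle, z.1 ∈ s.base → SmoothSecAt (𝓘(ℝ, E).prod (𝓡 1)) P.bundle (fun z => z)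
        (uncurrySection P s) z := by
  constructor
  · intro h z hz
    obtain ⟨t, ht, hzt⟩ := P.bundle.isPrincipal.cover z
    obtain ⟨W, hW, g, hg, e⟩ := h t ht z hz hzt
    have hWn : (W : Set (M × Circle)) ∈ 𝓝 z := W.isOpen.mem_nhds hW
    refine SmoothSecAt.of_eventually ht (hg.gSmoothAt hWn) (eventually_of_mem hWn fun w hw => ?_)
    obtain ⟨a, b, e⟩ := e w hw
    exact ⟨b, (uncurrySection_eq P s a).trans e⟩
  · intro h t ht z hz hzt
    obtain ⟨g, hg, e⟩ := exists_gSmoothOn_secCoord (U := Prod.fst ⁻¹' s.base) contMDiff_id h ht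
    refine ⟨⟨_, (s.base.isOpen.preimage (continuous_fst (X := M) (Y := Circle))).inter t.base.isOpen⟩,
      ⟨hz, hzt⟩, g, hg, fun w hw => ⟨hw.1, hw.2, ?_⟩⟩
    exact (uncurrySection_eq P s hw.1).symm.trans (e w hw.2)

end Transform

/-! ### Smooth paths in `GL(V)` -/

theorem isUnit_one_add_smul {A : Type*} [Ring A] [Algebra ℂ A] {B : A} {z : ℂ} (hz : z ≠ 0)
    (h : -z⁻¹ ∉ spectrum ℂ B) : IsUnit (1 + z • B) := by
  rw [spectrum.notMem_iff] at h
  convert ((neg_ne_zero.2 hz).isUnit.map (algebraMap ℂ A)).mul h using 1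
  rw [mul_sub, ← map_mul, neg_mul_neg, mul_inv_cancel₀ hz, map_one, map_neg, neg_mul,
    sub_neg_eq_add, ← Algebra.smul_def]

/-- Any `A ∈ GL(V)` is the endpoint of a smooth path which starts at the identity and is constant
near its ends. The path is `s ↦ 1 + z(s)(A - 1)` for a path `z(s) = s + i c s(1 - s)` from `0` to `1`
in `ℂ`, the real number `c` being chosen to avoid the finitely many `z` for which `1 + z(A - 1)` is
singular. -/
theorem exists_smooth_path {n : ℕ} (A : GLV n) : ∃ p : ℝ → GLV n,
    (∀ t, GSmoothAt 𝓘(ℝ, ℝ) p t) ∧ (∀ t ≤ 0, p t = 1) ∧ ∀ t, 1 ≤ t → p t = A := by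
  classical
  set B : EndV n := (A : EndV n) - 1 with hB
  have hfin : (spectrum ℂ B).Finite := by
    have h := Module.End.finite_spectrum ((Module.End.toContinuousLinearMap (Vec n)).symm B)
    rwa [AlgEquiv.spectrum_eq] at h
  obtain ⟨c, hc⟩ := (hfin.image fun μ : ℂ =>
    (-μ⁻¹).im / ((-μ⁻¹).re * (1 - (-μ⁻¹).re))).exists_notMem
  let z : ℝ → ℂ := fun s => s + (c * (s * (1 - s)) : ℝ) * Complex.I
  have hre : ∀ s, (z s).re = s := fun s => by simp [z]
  have him : ∀ s, (z s).im = c * (s * (1 - s)) := fun s => by simp [z]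
  have hunit : ∀ s, IsUnit (1 + z s • B) := by
    intro s
    rcases eq_or_ne s 0 with rfl | h0
    · have e : z 0 • B = 0 := by
        rw [show z 0 = 0 by simp [z]]
        exact zero_smul ℂ B
      rw [e, add_zero]
      exact isUnit_one
    rcases eq_or_ne s 1 with rfl | h1
    · simp [z, hB]
    have hz : z s ≠ 0 := fun h => h0 (by rw [← hre s, h, Complex.zero_re])
    have hμ : -(z s)⁻¹ ∉ spectrum ℂ B := by
      intro hμ
      refine hc ⟨_, hμ, ?_⟩
      have e : -(-(z s)⁻¹)⁻¹ = z s := by rw [inv_neg, inv_inv, neg_neg]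
      simp only [e, hre, him]
      exact mul_div_cancel_right₀ c (mul_ne_zero h0 (sub_ne_zero.2 h1.symm))
    exact isUnit_one_add_smul hz hμ
  refine ⟨fun t => (hunit (Real.smoothTransition t)).unit, fun t => ?_, fun t ht => ?_, fun t ht => ?_⟩
  · refine ContDiffAt.contMDiffAt ?_
    simp only [IsUnit.unit_spec]
    have hχ : ContDiff ℝ ∞ Real.smoothTransition := Real.smoothTransition.contDiff (n := ⊤)
    have hz : ContDiff ℝ ∞ fun t => z (Real.smoothTransition t) := by
      have h1 : ContDiff ℝ ∞ fun s : ℝ => (s : ℂ) := Complex.ofRealCLM.contDiff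
      exact (h1.comp hχ).add
        ((h1.comp (contDiff_const.mul (hχ.mul (contDiff_const.sub hχ)))).mul contDiff_const)
    exact (contDiff_const.add (hz.smul contDiff_const)).contDiffAt
  · refine Units.ext ?_
    simp only [Real.smoothTransition.zero_of_nonpos ht, IsUnit.unit_spec, Units.val_one, z,
      Complex.ofReal_zero, zero_mul, mul_zero, add_zero, add_eq_left]
    exact zero_smul ℂ B
  · refine Units.ext ?_
    simp [Real.smoothTransition.one_of_one_le ht, z, hB]

/-! ### Gluing sections over products of open sets with intervals -/

section Gluing

variable {E M : Type*} [NormedAddCommGroup E] [NormedSpace ℝ E] [TopologicalSpace M]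
  [ChartedSpace E M] {n : ℕ}

/-- The universal covering of the circle, with parameters: `(x, t) ↦ (x, e^{it})`. -/
def cylinderMap (M : Type*) (z : M × ℝ) : M × Circle := (z.1, Circle.exp z.2)

theorem contMDiff_cylinderMap :
    ContMDiff (𝓘(ℝ, E).prod 𝓘(ℝ, ℝ)) (𝓘(ℝ, E).prod (𝓡 1)) ∞ (cylinderMap M) :=
  contMDiff_fst.prodMk (contMDiff_circleExp.comp contMDiff_snd)

/-- A section of `P` along `(x, t) ↦ (x, e^{it})`. -/
abbrev CylinderSection (P : GBundle.{v} E M n) := ∀ z : M × ℝ, P.fib (cylinderMap M z)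

/-- Smoothness of a section along `(x, t) ↦ (x, e^{it})` on a subset of `M × ℝ`. -/
def CylinderSection.SmoothOn {P : GBundle.{v} E M n} (σ : CylinderSection P) (U : Set (M × ℝ)) :
    Prop :=
  ∀ z ∈ U, SmoothSecAt (𝓘(ℝ, E).prod 𝓘(ℝ, ℝ)) P (cylinderMap M) σ z

variable {P : GBundle.{v} E M n} {σ τ : CylinderSection P} {U : Set M} {m : M}

/-- Two sections which agree at a point `(m, t₀)` can be glued after shrinking the parameter space:
near that point they differ by a function `d` close to `1`, and `1 + χ(d - 1)`, for a cutoff function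
`χ` of the variable `t`, is still invertible and interpolates between `d` and `1`. -/
theorem CylinderSection.exists_glue (hU : IsOpen U) (hm : m ∈ U) {a b c d t₀ δ₀ : ℝ}
    (hσ : σ.SmoothOn (U ×ˢ Ioo a b)) (hτ : τ.SmoothOn (U ×ˢ Ioo c d)) (hab : t₀ ∈ Ioo a b)
    (hcd : t₀ ∈ Ioo c d) (h0 : σ (m, t₀) = τ (m, t₀)) (hδ₀ : 0 < δ₀) :
    ∃ W : Set M, IsOpen W ∧ m ∈ W ∧ ∃ δ > 0, δ ≤ δ₀ ∧ ∃ ρ : CylinderSection P,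
      ρ.SmoothOn (W ×ˢ Ioo a d) ∧ (∀ z : M × ℝ, z.2 ≤ t₀ - δ → ρ z = σ z) ∧
        ∀ z : M × ℝ, t₀ + δ ≤ z.2 → ρ z = τ z := by
  classical
  let g : M × ℝ → GLV n := fun z => P.diff (τ z) (σ z)
  have hg : ∀ z ∈ U ×ˢ (Ioo a b ∩ Ioo c d), GSmoothAt (𝓘(ℝ, E).prod 𝓘(ℝ, ℝ)) g z := fun z hz =>
    SmoothSecAt.diff contMDiff_cylinderMap.contMDiffAt (hτ z ⟨hz.1, hz.2.2⟩) (hσ z ⟨hz.1, hz.2.1⟩)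
  have hg0 : g (m, t₀) = 1 := by
    change P.diff (τ (m, t₀)) (σ (m, t₀)) = 1
    rw [h0, P.diff_self]
  obtain ⟨r, hr, hball⟩ := Metric.isOpen_iff.1 (Units.isOpen (R := EndV n)) 1 isUnit_one
  have hev : ∀ᶠ z in 𝓝 (m, t₀), ((g z : GLV n) : EndV n) ∈ Metric.ball (1 : EndV n) r ∧
      z ∈ U ×ˢ (Ioo a b ∩ Ioo c d) := by
    refine (ContinuousAt.eventually_mem (hg (m, t₀) ⟨hm, hab, hcd⟩).continuousAt ?_).and ?_
    · rw [hg0]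
      exact Metric.ball_mem_nhds _ hr
    · exact (hU.prod (isOpen_Ioo.inter isOpen_Ioo)).mem_nhds ⟨hm, hab, hcd⟩
  rw [nhds_prod_eq, eventually_prod_iff] at hev
  obtain ⟨p, hp, q, hq, hpq⟩ := hev
  obtain ⟨W, hWp, hWo, hmW⟩ := mem_nhds_iff.1 hp
  obtain ⟨ε, hε, hεq⟩ := Metric.mem_nhds_iff.1 hq
  set δ := min (ε / 2) δ₀ with hδdef
  have hδ : 0 < δ := lt_min (half_pos hε) hδ₀
  have hδε : δ < ε := (min_le_left _ _).trans_lt (half_lt_self hε)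
  have hmid : ∀ z ∈ W ×ˢ Ioo (t₀ - ε) (t₀ + ε),
      ((g z : GLV n) : EndV n) ∈ Metric.ball (1 : EndV n) r ∧ z ∈ U ×ˢ (Ioo a b ∩ Ioo c d) :=
    fun z hz => hpq (hWp hz.1) (hεq (by rw [Real.ball_eq_Ioo]; exact hz.2))
  let χ : ℝ → ℝ := fun t => Real.smoothTransition ((t₀ + δ - t) / (2 * δ))
  have hχ : ContDiff ℝ ∞ χ := (Real.smoothTransition.contDiff (n := ⊤)).comp (by fun_prop)
  have hχ1 : ∀ t ≤ t₀ - δ, χ t = 1 := fun t ht =>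
    Real.smoothTransition.one_of_one_le ((one_le_div (by positivity)).2 (by linarith))
  have hχ0 : ∀ t, t₀ + δ ≤ t → χ t = 0 := fun t ht =>
    Real.smoothTransition.zero_of_nonpos (div_nonpos_of_nonpos_of_nonneg (by linarith) (by positivity))
  let k : M × ℝ → EndV n := fun z => 1 + χ z.2 • (((g z : GLV n) : EndV n) - 1)
  have hk : ∀ z ∈ W ×ˢ Ioo (t₀ - ε) (t₀ + ε), IsUnit (k z) := by
    intro z hz
    refine hball ?_
    have h1 := (hmid z hz).1
    rw [Metric.mem_ball, dist_eq_norm] at h1 ⊢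
    rw [show k z - 1 = χ z.2 • (((g z : GLV n) : EndV n) - 1) by simp [k], norm_smul,
      Real.norm_of_nonneg (Real.smoothTransition.nonneg _)]
    exact (mul_le_of_le_one_left (norm_nonneg _) (Real.smoothTransition.le_one _)).trans_lt h1
  let h : M × ℝ → GLV n := fun z => if hz : IsUnit (k z) then hz.unit else 1
  have hhk : ∀ z ∈ W ×ˢ Ioo (t₀ - ε) (t₀ + ε), ((h z : GLV n) : EndV n) = k z := fun z hz => by
    simp only [h, dif_pos (hk z hz), IsUnit.unit_spec]
  have hopen : IsOpen (W ×ˢ Ioo (t₀ - ε) (t₀ + ε)) := hWo.prod isOpen_Ioo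
  have hh : ∀ z ∈ W ×ˢ Ioo (t₀ - ε) (t₀ + ε), GSmoothAt (𝓘(ℝ, E).prod 𝓘(ℝ, ℝ)) h z := by
    intro z hz
    have h1 : ContMDiffAt (𝓘(ℝ, E).prod 𝓘(ℝ, ℝ)) 𝓘(ℝ, ℝ) ∞ (fun z : M × ℝ => χ z.2) z :=
      (hχ.contMDiff.comp contMDiff_snd).contMDiffAt
    have h2 : ContMDiffAt (𝓘(ℝ, E).prod 𝓘(ℝ, ℝ)) 𝓘(ℝ, EndV n) ∞
        (fun z => ((g z : GLV n) : EndV n)) z := hg z (hmid z hz).2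
    have h3 : ContMDiffAt (𝓘(ℝ, E).prod 𝓘(ℝ, ℝ)) 𝓘(ℝ, EndV n) ∞ k z :=
      contMDiffAt_const.add (h1.smul (h2.sub contMDiffAt_const))
    exact h3.congr_of_eventuallyEq (eventually_of_mem (hopen.mem_nhds hz) hhk)
  let ρ : CylinderSection P := fun z =>
    if z.2 ≤ t₀ - δ then σ z else if t₀ + δ ≤ z.2 then τ z else P.act (τ z) (h z)
  have hρ1 : ∀ z : M × ℝ, z.2 ≤ t₀ - δ → ρ z = σ z := fun z hz => if_pos hz
  have hρ2 : ∀ z : M × ℝ, t₀ + δ ≤ z.2 → ρ z = τ z := fun z hz => by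
    simp only [ρ, if_neg (show ¬ z.2 ≤ t₀ - δ by linarith), if_pos hz]
  have hρ3 : ∀ z ∈ W ×ˢ Ioo (t₀ - ε) (t₀ + ε), ρ z = P.act (τ z) (h z) := by
    intro z hz
    by_cases c1 : z.2 ≤ t₀ - δ
    · have e : h z = g z := Units.ext (by rw [hhk z hz]; simp [k, hχ1 _ c1])
      rw [hρ1 z c1, e]
      exact (P.act_diff _ _).symm
    by_cases c2 : t₀ + δ ≤ z.2
    · have e : h z = 1 := Units.ext (by
        rw [hhk z hz]
        simp only [k, hχ0 _ c2, Units.val_one, add_eq_left]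
        exact zero_smul ℝ (((g z : GLV n) : EndV n) - 1))
      rw [hρ2 z c2, e, P.isPrincipal.act_one]
    simp only [ρ, if_neg c1, if_neg c2]
  refine ⟨W, hWo, hmW, δ, hδ, min_le_right _ _, ρ, ?_, hρ1, hρ2⟩
  have hWU : W ⊆ U := fun x hx => (hmid (x, t₀) ⟨hx, by constructor <;> dsimp only <;> linarith⟩).2.1
  rintro z ⟨hzW, hza, hzd⟩
  rcases lt_or_ge z.2 (t₀ - δ) with h1 | h1
  · refine (hσ z ⟨hWU hzW, hza, h1.trans (by linarith [hab.2])⟩).congr ?_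
    have : ∀ᶠ w : M × ℝ in 𝓝 z, w.2 < t₀ - δ := continuous_snd.continuousAt.eventually_lt_const h1
    exact this.mono fun w hw => hρ1 w hw.le
  rcases lt_or_ge (t₀ + δ) z.2 with h2 | h2
  · refine (hτ z ⟨hWU hzW, lt_trans (by linarith [hcd.1]) h2, hzd⟩).congr ?_
    have : ∀ᶠ w : M × ℝ in 𝓝 z, t₀ + δ < w.2 := continuous_snd.continuousAt.eventually_const_lt h2
    exact this.mono fun w hw => hρ2 w hw.le
  · have hz : z ∈ W ×ˢ Ioo (t₀ - ε) (t₀ + ε) := ⟨hzW, by linarith, by linarith⟩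
    exact (SmoothSecAt.act contMDiff_cylinderMap.contMDiffAt
      (hτ z ⟨(hmid z hz).2.1, (hmid z hz).2.2.2⟩) (hh z hz)).congr
        (eventually_of_mem (hopen.mem_nhds hz) hρ3)

/-- There is a smooth section over (the preimage of) a neighbourhood of `{m} × [a, b]`. -/
def HasCylinderSection (P : GBundle.{v} E M n) (m : M) (a b : ℝ) : Prop :=
  ∃ U : Set M, IsOpen U ∧ m ∈ U ∧ ∃ ε > 0, ∃ σ : CylinderSection P,
    σ.SmoothOn (U ×ˢ Ioo (a - ε) (b + ε))

theorem HasCylinderSection.mono {a b a' b' : ℝ} (h : HasCylinderSection P m a b) (ha : a ≤ a')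
    (hb : b' ≤ b) : HasCylinderSection P m a' b' := by
  obtain ⟨U, hU, hm, ε, hε, σ, hσ⟩ := h
  exact ⟨U, hU, hm, ε, hε, σ, fun z hz => hσ z ⟨hz.1, by linarith [hz.2.1], by linarith [hz.2.2]⟩⟩

theorem HasCylinderSection.trans {a b c : ℝ} (h : HasCylinderSection P m a b)
    (h' : HasCylinderSection P m b c) (hab : a ≤ b) (hbc : b ≤ c) : HasCylinderSection P m a c := by
  obtain ⟨U, hU, hm, ε, hε, σ, hσ⟩ := h
  obtain ⟨U', hU', hm', ε', hε', τ, hτ⟩ := h'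
  let k : GLV n := P.diff (τ (m, b)) (σ (m, b))
  have hτk : CylinderSection.SmoothOn (P := P) (fun z => P.act (τ z) k)
      ((U ∩ U') ×ˢ Ioo (b - ε') (c + ε')) := fun z hz =>
    SmoothSecAt.act contMDiff_cylinderMap.contMDiffAt (hτ z ⟨hz.1.2, hz.2⟩) (gSmoothAt_const k z)
  obtain ⟨W, hW, hmW, -, -, -, ρ, hρ, -⟩ := CylinderSection.exists_glue (t₀ := b) (δ₀ := 1)
    (hU.inter hU') ⟨hm, hm'⟩ (fun z hz => hσ z ⟨hz.1.1, hz.2⟩) hτk ⟨by linarith, by linarith⟩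
    ⟨by linarith, by linarith⟩ (P.act_diff _ _).symm one_pos
  exact ⟨W, hW, hmW, min ε ε', lt_min hε hε', ρ, fun z hz => hρ z
    ⟨hz.1, by linarith [hz.2.1, min_le_left ε ε'], by linarith [hz.2.2, min_le_right ε ε']⟩⟩

theorem exists_hasCylinderSection_near (P : GBundle.{v} E M n) (m : M) (t : ℝ) :
    ∃ ε > 0, ∀ a ∈ Ioo (t - ε) (t + ε), ∀ b ∈ Ioo (t - ε) (t + ε), HasCylinderSection P m a b := by
  classical
  obtain ⟨s, hs, hst⟩ := P.isPrincipal.cover (cylinderMap M (m, t))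
  have hc : Continuous (cylinderMap M) := (contMDiff_cylinderMap (E := E)).continuous
  have hn : (cylinderMap M) ⁻¹' s.base ∈ 𝓝 (m, t) := (s.base.isOpen.preimage hc).mem_nhds hst
  obtain ⟨U, V, hU, hmU, hV, htV, hUV⟩ := mem_nhds_prod_iff'.1 hn
  obtain ⟨ε, hε, hεV⟩ := Metric.isOpen_iff.1 hV t htV
  rw [Real.ball_eq_Ioo] at hεV
  let σ : CylinderSection P := fun z =>
    if h : cylinderMap M z ∈ s.base then s.val _ h else P.point _
  have hσ : σ.SmoothOn (U ×ˢ Ioo (t - ε) (t + ε)) := by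
    intro z hz
    refine SmoothSecAt.of_eventually hs (gSmoothAt_const 1 z) ?_
    filter_upwards [(hU.prod hV).mem_nhds ⟨hz.1, hεV hz.2⟩] with w hw
    exact ⟨hUV hw, by simp only [σ, P.isPrincipal.act_one]; exact dif_pos (hUV hw)⟩
  refine ⟨ε, hε, fun a ha b hb => ⟨U, hU, hmU, min (a - (t - ε)) (t + ε - b),
    lt_min (by linarith [ha.1]) (by linarith [hb.2]), σ, fun z hz => hσ z ⟨hz.1, ?_, ?_⟩⟩⟩
  · linarith [hz.2.1, min_le_left (a - (t - ε)) (t + ε - b)]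
  · linarith [hz.2.2, min_le_right (a - (t - ε)) (t + ε - b)]

theorem hasCylinderSection (P : GBundle.{v} E M n) (m : M) (a b : ℝ) :
    HasCylinderSection P m a b := by
  have step : ∀ t, ∃ ε > 0, ∀ u ∈ Ioo (t - ε) (t + ε), ∀ u' ∈ Ioo (t - ε) (t + ε),
      HasCylinderSection P m a u → HasCylinderSection P m a u' := by
    intro t
    obtain ⟨ε, hε, h⟩ := exists_hasCylinderSection_near P m t
    refine ⟨ε, hε, fun u hu u' hu' H => ?_⟩
    rcases le_total u' u with hle | hle
    · exact H.mono le_rfl hle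
    rcases le_total u a with hua | hua
    · exact (h u hu u' hu').mono hua le_rfl
    · exact H.trans (h u hu u' hu') hua hle
  have hloc : IsLocallyConstant fun t => HasCylinderSection P m a t := by
    refine (IsLocallyConstant.iff_eventually_eq _).2 fun t => ?_
    obtain ⟨ε, hε, h⟩ := step t
    have ht : t ∈ Ioo (t - ε) (t + ε) := ⟨by linarith, by linarith⟩
    filter_upwards [isOpen_Ioo.mem_nhds ht] with u hu
    exact propext ⟨h u hu t ht, h t ht u hu⟩
  obtain ⟨ε, hε, h⟩ := exists_hasCylinderSection_near P m a
  have ha : a ∈ Ioo (a - ε) (a + ε) := ⟨by linarith, by linarith⟩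
  have e := hloc.apply_eq_of_preconnectedSpace a b
  exact e.mp (h a ha a ha)

/-! ### Sections over a neighbourhood of a circle -/

/-- The deck transformation `(x, t) ↦ (x, t + 2π)`. -/
def deck (M : Type*) (z : M × ℝ) : M × ℝ := (z.1, z.2 + 2 * Real.pi)

omit [TopologicalSpace M] in
theorem cylinderMap_deck (z : M × ℝ) : cylinderMap M (deck M z) = cylinderMap M z :=
  Prod.ext rfl (Circle.exp_add_two_pi z.2)

theorem contMDiff_deck :
    ContMDiff (𝓘(ℝ, E).prod 𝓘(ℝ, ℝ)) (𝓘(ℝ, E).prod 𝓘(ℝ, ℝ)) ∞ (deck M) := by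
  have h : ContDiff ℝ ∞ fun t : ℝ => t + 2 * Real.pi := by fun_prop
  exact contMDiff_fst.prodMk (h.contMDiff.comp contMDiff_snd)

/-- The translate `(x, t) ↦ σ(x, t + 2π)` of a section. -/
def CylinderSection.shift (σ : CylinderSection P) : CylinderSection P :=
  PrincipalBundle.pull P σ (deck M) cylinderMap_deck

theorem CylinderSection.SmoothOn.shift {U : Set (M × ℝ)} (hσ : σ.SmoothOn U) :
    σ.shift.SmoothOn (deck M ⁻¹' U) := fun z hz =>
  SmoothSecAt.pull (f := cylinderMap M) (f' := cylinderMap M) cylinderMap_deck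
    contMDiff_deck.contMDiffAt (hσ (deck M z) hz)

theorem CylinderSection.shift_act (σ : CylinderSection P) (g : M × ℝ → GLV n) (z : M × ℝ) :
    CylinderSection.shift (P := P) (fun w => P.act (σ w) (g w)) z =
      P.act (σ.shift z) (g (deck M z)) := by
  have key : ∀ {y y' : M × Circle} (e : y = y') (p : P.fib y) (h : GLV n),
      e ▸ P.act p h = P.act (e ▸ p : P.fib y') h := by
    rintro y _ rfl p h
    rfl
  exact key _ _ _

/-- There is a section over a neighbourhood of `{m} × [0, 2π]` whose values at `(m, 0)` and
`(m, 2π)` agree: the endpoint can be corrected as `G` is connected. -/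
theorem exists_cylinderSection_closed (P : GBundle.{v} E M n) (m : M) :
    ∃ U : Set M, IsOpen U ∧ m ∈ U ∧ ∃ ε > 0, ∃ σ : CylinderSection P,
      σ.SmoothOn (U ×ˢ Ioo (-ε) (2 * Real.pi + ε)) ∧ σ.shift (m, 0) = σ (m, 0) := by
  obtain ⟨U, hU, hm, ε, hε, σ, hσ⟩ := hasCylinderSection P m 0 (2 * Real.pi)
  obtain ⟨p, hp, hp0, hp1⟩ := exists_smooth_path (P.diff (σ.shift (m, 0)) (σ (m, 0)))
  refine ⟨U, hU, hm, ε, hε, fun z => P.act (σ z) (p z.2), fun z hz => ?_, ?_⟩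
  · rw [zero_sub] at hσ
    exact SmoothSecAt.act contMDiff_cylinderMap.contMDiffAt (hσ z hz)
      (GSmoothAt.comp (h := Prod.snd) (hp z.2) contMDiffAt_snd)
  · refine (CylinderSection.shift_act σ (fun z => p z.2) (m, 0)).trans ?_
    simp only [hp0 0 le_rfl, P.isPrincipal.act_one]
    rw [hp1 _ (by simp only [deck, zero_add]; linarith [Real.pi_gt_three]), P.act_diff]

theorem CylinderSection.pull_eq_of_shift_eq (ρ : CylinderSection P) {N : Type*}
    {h k : N → M × ℝ} {f : N → M × Circle} (e : ∀ w, cylinderMap M (h w) = f w)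
    (e' : ∀ w, cylinderMap M (k w) = f w) {w : N} (hw : h w = deck M (k w))
    (hρ : ρ.shift (k w) = ρ (k w)) :
    PrincipalBundle.pull P ρ h e w = PrincipalBundle.pull P ρ k e' w := by
  have key : ∀ (a b : M × ℝ) (y : M × Circle) (ea : cylinderMap M a = y)
      (eb : cylinderMap M b = y), a = deck M b → ρ.shift b = ρ b → ea ▸ ρ a = eb ▸ ρ b := by
    rintro _ b _ ea rfl rfl hb
    exact hb
  exact key _ _ _ (e w) (e' w) hw hρ

/-- A principal `G`-bundle over `M × S¹` has smooth sections over `U × S¹` for a neighbourhood `U` of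
any given point. The section over `U × [0, 2π]` is blended with its translate near `t = 0`; the result
is periodic near `t = ±π` and descends to the circle. -/
theorem exists_section_near_circle (P : GBundle.{v} E M n) (m : M) :
    ∃ U : Set M, IsOpen U ∧ m ∈ U ∧ ∃ s : ∀ z : M × Circle, P.fib z,
      ∀ z : M × Circle, z.1 ∈ U →
        SmoothSecAt (𝓘(ℝ, E).prod (𝓡 1)) P (fun z : M × Circle => z) s z := by
  have hπ := Real.pi_gt_three
  obtain ⟨U, hU, hm, ε, hε, σ, hσ, hσ0⟩ := exists_cylinderSection_closed P m
  have hσ' : σ.shift.SmoothOn (U ×ˢ Ioo (-(2 * Real.pi) - ε) ε) := fun z hz =>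
    hσ.shift z ⟨hz.1, by simp only [deck]; linarith [hz.2.1], by simp only [deck]; linarith [hz.2.2]⟩
  obtain ⟨W, hW, hmW, δ, hδ, hδ1, ρ, hρ, hρ1, hρ2⟩ := CylinderSection.exists_glue (t₀ := 0) (δ₀ := 1)
    hU hm hσ' hσ ⟨by linarith, hε⟩ ⟨by linarith, by linarith⟩ hσ0 one_pos
  have hper : ∀ z : M × ℝ, z.2 ∈ Ioo (-Real.pi - 1) (-Real.pi + 1) → ρ.shift z = ρ z := by
    intro z hz
    rw [hρ1 z (by linarith [hz.2])]
    have e : ρ (deck M z) = σ (deck M z) :=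
      hρ2 (deck M z) (by simp only [deck]; linarith [hz.1])
    exact congrArg (fun q => cylinderMap_deck z ▸ q) e
  have hlift : ∀ (t₀ : ℝ) (w : M × Circle), cylinderMap M (w.1, circleAngle t₀ w.2) = w :=
    fun t₀ w => Prod.ext rfl (exp_circleAngle t₀ w.2)
  let S : ℝ → ∀ z : M × Circle, P.fib z := fun t₀ =>
    P.pull (f := cylinderMap M) (f' := fun z : M × Circle => z) ρ
      (fun w : M × Circle => (w.1, circleAngle t₀ w.2)) (hlift t₀)
  have hS : ∀ (t₀ : ℝ) (z : M × Circle), z.1 ∈ W →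
      circleAngle t₀ z.2 ∈ Ioo (-(2 * Real.pi) - ε) (2 * Real.pi + ε) →
      ContMDiffAt (𝓡 1) 𝓘(ℝ, ℝ) ∞ (circleAngle t₀) z.2 →
      SmoothSecAt (𝓘(ℝ, E).prod (𝓡 1)) P (fun z : M × Circle => z) (S t₀) z := by
    intro t₀ z hz hz2 hc
    exact SmoothSecAt.pull (f := cylinderMap M) (f' := fun z : M × Circle => z) (hlift t₀)
      (contMDiffAt_fst.prodMk (ContMDiffAt.comp (g := circleAngle t₀) z hc contMDiffAt_snd))
      (hρ _ ⟨hz, hz2⟩)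
  have hrange : ∀ (t₀ : ℝ) (w : Circle),
      circleAngle t₀ w ∈ Ioc (t₀ - Real.pi) (t₀ + Real.pi) := fun t₀ w => by
    have h := Complex.arg_mem_Ioc ((w * (Circle.exp t₀)⁻¹ : Circle) : ℂ)
    exact ⟨by unfold circleAngle; linarith [h.1], by unfold circleAngle; linarith [h.2]⟩
  refine ⟨W, hW, hmW, S 0, fun z hz => ?_⟩
  by_cases hslit : ((z.2 * (Circle.exp 0)⁻¹ : Circle) : ℂ) ∈ Complex.slitPlane
  · have h := hrange 0 z.2
    exact hS 0 z hz ⟨by linarith [h.1], by linarith [h.2]⟩ (contMDiffAt_circleAngle hslit)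
  · -- At the remaining point `-1` of the circle, the angle in `(-2π, 0]` is smooth.
    have hz2 : z.2 = Circle.exp (-Real.pi) := by
      have h1 : circleAngle 0 z.2 = Real.pi := by
        rw [Complex.mem_slitPlane_iff_arg, not_and_or, not_not, not_not] at hslit
        rcases hslit with h | h
        · rw [circleAngle, h, zero_add]
        · exact absurd h (Circle.coe_ne_zero _)
      rw [← exp_circleAngle 0 z.2, h1, Circle.exp_eq_exp]
      exact ⟨1, by push_cast; ring⟩
    have hangle : circleAngle (-Real.pi) z.2 = -Real.pi := by rw [hz2, circleAngle_exp]
    have hc : ContMDiffAt (𝓡 1) 𝓘(ℝ, ℝ) ∞ (circleAngle (-Real.pi)) z.2 := by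
      rw [hz2]
      exact contMDiffAt_circleAngle_exp _
    refine (hS (-Real.pi) z hz (by rw [hangle]; constructor <;> linarith) hc).congr ?_
    have hev : ∀ᶠ w : M × Circle in 𝓝 z,
        circleAngle (-Real.pi) w.2 ∈ Ioo (-Real.pi - 1) (-Real.pi + 1) := by
      have hc' : ContinuousAt (fun w : M × Circle => circleAngle (-Real.pi) w.2) z :=
        ContinuousAt.comp (g := circleAngle (-Real.pi)) hc.continuousAt continuous_snd.continuousAt
      refine hc'.eventually_mem (isOpen_Ioo.mem_nhds ?_)
      rw [hangle]
      constructor <;> linarith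
    filter_upwards [hev] with w hw
    obtain ⟨j, hj⟩ := Circle.exp_eq_exp.1
      ((exp_circleAngle 0 w.2).trans (exp_circleAngle (-Real.pi) w.2).symm)
    have hr := hrange 0 w.2
    have hj0 : 0 ≤ j := by
      by_contra hcon
      have : (j : ℝ) ≤ -1 := by exact_mod_cast (by omega : j ≤ -1)
      nlinarith [hr.1, hw.2]
    have hj1 : j ≤ 1 := by
      by_contra hcon
      have : (2 : ℝ) ≤ j := by exact_mod_cast (by omega : 2 ≤ j)
      nlinarith [hr.2, hw.1]
    obtain rfl | rfl : j = 0 ∨ j = 1 := by omega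
    · refine P.pull_eq_pull (f := cylinderMap M) (f' := fun z : M × Circle => z) ρ (hlift 0)
        (hlift (-Real.pi)) ?_
      rw [hj]
      simp
    · refine CylinderSection.pull_eq_of_shift_eq ρ (f := fun z : M × Circle => z) (hlift 0)
        (hlift (-Real.pi)) ?_ (hper _ hw)
      rw [hj]
      simp [deck]

end Gluing

/-! ### The caloron transform is well defined -/

section WellDefined

variable {E M : Type*} [NormedAddCommGroup E] [NormedSpace ℝ E] [FiniteDimensional ℝ E]
  [TopologicalSpace M] [ChartedSpace E M] [IsManifold 𝓘(ℝ, E) ∞ M] {n : ℕ}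

section Caloron

omit [FiniteDimensional ℝ E] [IsManifold 𝓘(ℝ, E) ∞ M]

/-- The class `[q, θ, g]`. -/
def caloronMk (Q : OmegaBundle.{v} E M n) {y : M × Circle} (q : Q.fib y.1) (g : GLV n) :
    (preCaloron Q).fib y :=
  Quotient.mk (caloronSetoid Q y) (q, g)

theorem caloronMk_act (Q : OmegaBundle.{v} E M n) {y : M × Circle} (q : Q.fib y.1) (γ : OmegaG n)
    (g : GLV n) :
    (caloronMk Q (Q.act q γ) g : (preCaloron Q).fib y) = caloronMk Q q (γ.1 y.2 * g) :=
  (Quotient.sound (s := caloronSetoid Q y)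
    ⟨γ, Prod.ext rfl (inv_mul_cancel_left _ _).symm⟩ :
    (caloronMk Q q (γ.1 y.2 * g) : (preCaloron Q).fib y) = caloronMk Q (Q.act q γ) g).symm

theorem caloronMk_inj (Q : OmegaBundle.{v} E M n) {y : M × Circle} {q : Q.fib y.1} {g h : GLV n}
    (e : (caloronMk Q q g : (preCaloron Q).fib y) = caloronMk Q q h) : g = h := by
  obtain ⟨γ, hγ⟩ := Quotient.exact (s := caloronSetoid Q y) e
  obtain ⟨h1, h2⟩ := Prod.ext_iff.1 hγ
  have hγ1 : γ = 1 := Q.act_inj (p := q) (h1.symm.trans (Q.isPrincipal.act_one q).symm)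
  subst hγ1
  have h3 : h = (1 : GLV n)⁻¹ * g := h2
  rw [h3, inv_one, one_mul]

theorem exists_caloronMk (Q : OmegaBundle.{v} E M n) {y : M × Circle} (q : Q.fib y.1)
    (a : (preCaloron Q).fib y) : ∃ g, a = caloronMk Q q g := by
  obtain ⟨b, g⟩ := a
  refine ⟨(Q.diff q b).1 y.2 * g, ?_⟩
  rw [← caloronMk_act, Q.act_diff]
  rfl

end Caloron

theorem preCaloron_isPrincipal (Q : OmegaBundle.{v} E M n) :
    (preCaloron Q).IsPrincipal (circleModel E M n) where
  act_one {y} p := by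
    obtain ⟨g, rfl⟩ := exists_caloronMk Q (Q.point y.1) p
    exact congrArg (caloronMk Q _) (mul_one g)
  act_mul {y} p h k := by
    obtain ⟨g, rfl⟩ := exists_caloronMk Q (Q.point y.1) p
    exact congrArg (caloronMk Q _) (mul_assoc g h k).symm
  existsUnique_act {y} p q := by
    obtain ⟨g, rfl⟩ := exists_caloronMk Q (Q.point y.1) p
    obtain ⟨h, rfl⟩ := exists_caloronMk Q (Q.point y.1) q
    refine ⟨g⁻¹ * h, congrArg (caloronMk Q _) (mul_inv_cancel_left g h), fun k hk => ?_⟩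
    have e : g * k = h := caloronMk_inj Q hk
    rw [← e, inv_mul_cancel_left]
  cover y := by
    obtain ⟨s, hs, hy⟩ := Q.isPrincipal.cover y.1
    exact ⟨_, ⟨s, hs, rfl⟩, hy⟩
  transition := by
    rintro _ ⟨s, hs, rfl⟩ _ ⟨t, ht, rfl⟩
    obtain ⟨γ, hγ, e⟩ := Q.isPrincipal.transition s hs t ht
    refine ⟨fun z => (γ z.1).1 z.2, ?_, fun z hsz htz => ?_⟩
    · exact ContMDiffOn.mono ((omegaSmoothOn_iff (s.base.isOpen.inter t.base.isOpen)).1 hγ)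
        fun z hz => ⟨hz, mem_univ _⟩
    · change caloronMk Q (t.val z.1 htz) 1 = caloronMk Q (s.val z.1 hsz) (1 * (γ z.1).1 z.2)
      rw [e z.1 hsz htz, caloronMk_act, mul_one, one_mul]

theorem caloronWellDefined : CaloronWellDefined.{v} E M where
  isPrincipal _ Q := preCaloron_isPrincipal Q
  smooth_framing n Q := by
    rintro _ ⟨s, hs, rfl⟩
    refine ⟨fun _ => 1, contMDiffOn_const, fun m hm => ?_⟩
    rw [(preCaloron_isPrincipal Q).act_one]
    exact caloronFraming_eq Q m _
  smooth_map n Q R f := by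
    rintro _ ⟨s, hs, rfl⟩ _ ⟨t, ht, rfl⟩ y hy hy'
    obtain ⟨W, hW, γ, hγ, e⟩ := PrincipalBundle.Hom.smooth f s hs t ht y.1 hy hy'
    refine ⟨⟨Prod.fst ⁻¹' W, W.isOpen.preimage continuous_fst⟩, hW, fun z => (γ z.1).1 z.2, ?_,
      fun z hz => ?_⟩
    · exact ContMDiffOn.mono ((omegaSmoothOn_iff W.isOpen).1 hγ) fun z hz => ⟨hz, mem_univ _⟩
    · obtain ⟨a, b, e⟩ := e z.1 hz
      refine ⟨a, b, ?_⟩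
      change caloronMk R (PrincipalBundle.Hom.map f z.1 (s.val z.1 a)) 1 =
        caloronMk R (t.val z.1 b) (1 * (γ z.1).1 z.2)
      rw [one_mul, ← mul_one ((γ z.1).1 z.2), ← caloronMk_act]
      exact congrArg (fun q => caloronMk R q 1) e

/-! ### The inverse caloron transform is well defined -/

section InvCaloron

omit [FiniteDimensional ℝ E] [IsManifold 𝓘(ℝ, E) ∞ M]

/-- The based loop by which two points of a fibre of the inverse caloron transform differ. -/
def invCaloronDiff {P : FramedGBundle.{v} E M n} {m : M} (p q : (preInvCaloron P).fib m) :
    OmegaG n :=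
  ⟨fun θ => P.bundle.diff (p.1 θ) (q.1 θ), fun θ =>
    SmoothSecAt.diff (contMDiff_mk_left m).contMDiffAt (smoothLoop_iff.1 p.2.1 θ)
      (smoothLoop_iff.1 q.2.1 θ), 
    (congrArg₂ P.bundle.diff p.2.2 q.2.2).trans (P.bundle.diff_self _)⟩

theorem act_invCaloronDiff {P : FramedGBundle.{v} E M n} {m : M} (p q : (preInvCaloron P).fib m) :
    (preInvCaloron P).act p (invCaloronDiff p q) = q :=
  Subtype.ext <| funext fun θ => P.bundle.act_diff (p.1 θ) (q.1 θ)

/-- Local triviality of the inverse caloron transform: a smooth section of `P` over `U × S¹` can be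
multiplied by a function on `U` so as to agree with the framing over `U × {0}`. -/
theorem exists_mem_preInvCaloron_atlas (P : FramedGBundle.{v} E M n) (m : M) :
    ∃ s ∈ (preInvCaloron P).atlas, m ∈ s.base := by
  obtain ⟨U, hU, hm, s, hs⟩ := exists_section_near_circle P.bundle m
  let h : M → GLV n := fun x => P.bundle.diff (s (x, 1)) (P.framing x)
  have hh : ∀ x ∈ U, GSmoothAt 𝓘(ℝ, E) h x := fun x hx =>
    SmoothSecAt.diff contMDiff_mk_one.contMDiffAt
      (SmoothSecAt.comp (f := fun z : M × Circle => z) (h := fun m : M => (m, (1 : Circle)))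
        (hs (x, 1) hx) contMDiff_mk_one.contMDiffAt)
      (smoothFraming_iff.1 P.smooth_framing x)
  have hsh : ∀ z : M × Circle, z.1 ∈ U → SmoothSecAt (𝓘(ℝ, E).prod (𝓡 1)) P.bundle
      (fun z : M × Circle => z) (fun z => P.bundle.act (s z) (h z.1)) z := fun z hz =>
    SmoothSecAt.act contMDiff_id.contMDiffAt (hs z hz)
      (GSmoothAt.comp (h := Prod.fst) (hh z.1 hz) contMDiffAt_fst)
  let t : LocalSection (preInvCaloron P).fib :=
    ⟨⟨U, hU⟩, fun x hx => ⟨fun θ => P.bundle.act (s (x, θ)) (h x),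
      smoothLoop_iff.2 fun θ => SmoothSecAt.comp (f := fun z : M × Circle => z)
        (h := fun θ : Circle => (x, θ)) (hsh (x, θ) hx) (contMDiff_mk_left x).contMDiffAt,
      P.bundle.act_diff _ _⟩⟩
  refine ⟨t, mem_preInvCaloron_atlas.2 fun z hz => (hsh z hz).congr ?_, hm⟩
  have hop : IsOpen (Prod.fst ⁻¹' U : Set (M × Circle)) := hU.preimage continuous_fst
  exact eventually_of_mem (hop.mem_nhds hz) fun w hw => uncurrySection_eq P t hw

end InvCaloron

open scoped Classical in
/-- Two sections over `U` of the inverse caloron transform which come from smooth sections `σ`, `τ` over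
`U × S¹` differ by a smooth map `U → ΩG`; by the exponential law it suffices that the pointwise
difference of `σ` and `τ` is smooth on `U × S¹`. -/
theorem exists_omegaSmoothOn_diff {R : FramedGBundle.{v} E M n} {U : TopologicalSpace.Opens M}
    (p q : ∀ m, m ∈ U → (preInvCaloron R).fib m)
    {σ τ : ∀ z : M × Circle, R.bundle.fib z}
    (hp : ∀ z (hz : z.1 ∈ U), σ z = (p z.1 hz).1 z.2) (hq : ∀ z (hz : z.1 ∈ U), τ z = (q z.1 hz).1 z.2)
    (hσ : ∀ z : M × Circle, z.1 ∈ U →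
      SmoothSecAt (𝓘(ℝ, E).prod (𝓡 1)) R.bundle (fun z => z) σ z)
    (hτ : ∀ z : M × Circle, z.1 ∈ U →
      SmoothSecAt (𝓘(ℝ, E).prod (𝓡 1)) R.bundle (fun z => z) τ z) :
    ∃ γ : M → OmegaG n, OmegaSmoothOn E M U γ ∧
      ∀ m (hm : m ∈ U), q m hm = (preInvCaloron R).act (p m hm) (γ m) := by
  refine ⟨fun m => if hm : m ∈ U then invCaloronDiff (p m hm) (q m hm) else 1, ?_, fun m hm => ?_⟩
  · refine (omegaSmoothOn_iff U.isOpen).2 (gSmoothOn_of_gSmoothAt fun z hz => ?_)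
    refine (SmoothSecAt.diff contMDiff_id.contMDiffAt (hσ z hz.1) (hτ z hz.1)).congr ?_
    have hop : IsOpen (Prod.fst ⁻¹' U : Set (M × Circle)) := U.isOpen.preimage continuous_fst
    filter_upwards [hop.mem_nhds hz.1] with w hw
    have hw' : w.1 ∈ U := hw
    simp only [dif_pos hw', hp w hw', hq w hw']
    rfl
  · simp only [dif_pos hm, act_invCaloronDiff]

theorem invCaloronWellDefined : InvCaloronWellDefined.{v} E M where
  isPrincipal n P :=
    { act_one := fun p => Subtype.ext <| funext fun θ => P.bundle.isPrincipal.act_one _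
      act_mul := fun p g h => Subtype.ext <| funext fun θ => P.bundle.isPrincipal.act_mul _ _ _
      existsUnique_act := fun p q => by
        refine ⟨invCaloronDiff p q, act_invCaloronDiff p q, fun γ hγ => ?_⟩
        refine Subtype.ext <| funext fun θ => P.bundle.act_inj (p := p.1 θ) ?_
        exact congrFun (congrArg Subtype.val (hγ.trans (act_invCaloronDiff p q).symm)) θ
      cover := exists_mem_preInvCaloron_atlas P
      transition := fun s hs t ht => by
        obtain ⟨γ, hγ, e⟩ := exists_omegaSmoothOn_diff (U := s.base ⊓ t.base)
          (fun m hm => s.val m hm.1) (fun m hm => t.val m hm.2)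
          (fun z hz => uncurrySection_eq P s hz.1) (fun z hz => uncurrySection_eq P t hz.2)
          (fun z hz => mem_preInvCaloron_atlas.1 hs z hz.1)
          (fun z hz => mem_preInvCaloron_atlas.1 ht z hz.2)
        exact ⟨γ, hγ, fun m hs ht => e m ⟨hs, ht⟩⟩ }
  smooth_map n P R f := by
    intro s hs t ht x hxs hxt
    obtain ⟨γ, hγ, e⟩ := exists_omegaSmoothOn_diff (U := s.base ⊓ t.base)
      (fun m hm => t.val m hm.2) (fun m hm => invCaloronMap f m (s.val m hm.1))
      (σ := uncurrySection R t) (τ := fun z =>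
        PrincipalBundle.Hom.map (FramedGBundle.Hom.hom f) z (uncurrySection P s z))
      (fun z hz => uncurrySection_eq R t hz.2)
      (fun z hz => congrArg (PrincipalBundle.Hom.map (FramedGBundle.Hom.hom f) z)
        (uncurrySection_eq P s hz.1))
      (fun z hz => mem_preInvCaloron_atlas.1 ht z hz.2)
      (fun z hz => (mem_preInvCaloron_atlas.1 hs z hz.1).map _ contMDiff_id.contMDiffAt)
    exact ⟨s.base ⊓ t.base, ⟨hxs, hxt⟩, γ, hγ, fun y hy => ⟨hy.1, hy.2, e y hy⟩⟩

end WellDefined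

/-! ### Frame bundles of associated bundles, and conversely -/

/-- A natural family of morphisms between functors to a groupoid is a natural isomorphism. -/
def groupoidNatIso {C D : Type*} [Category* C] [Groupoid D] {F G : C ⥤ D}
    (α : ∀ X, F.obj X ⟶ G.obj X)
    (naturality : ∀ {X Y : C} (f : X ⟶ Y), F.map f ≫ α Y = α X ≫ G.map f) : F ≅ G :=
  NatIso.ofComponents (fun X => (Groupoid.isoEquivHom _ _).symm (α X)) naturality

section PrincipalHom

variable {X H F : Type*} [TopologicalSpace X] [Group H] [AddCommGroup F] [Module ℂ F]
  [DistribMulAction H F] {𝒮 : BundleModel X H F}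

theorem PrincipalBundle.bijective_of_equivariant {P Q : PrincipalBundle.{v} 𝒮} {x : X}
    {f : P.fib x → Q.fib x} (hf : ∀ p h, f (P.act p h) = Q.act (f p) h) : f.Bijective := by
  constructor
  · intro p q hpq
    obtain ⟨h, rfl, -⟩ := P.isPrincipal.existsUnique_act p q
    rw [hf] at hpq
    rw [← Q.act_inj ((Q.isPrincipal.act_one (f p)).trans hpq), P.isPrincipal.act_one]
  · intro q
    obtain ⟨h, hh, -⟩ := Q.isPrincipal.existsUnique_act (f (P.point x)) q
    exact ⟨P.act (P.point x) h, (hf _ _).trans hh⟩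

/-- An equivariant map over the identity is a morphism of principal bundles as soon as it is smooth
and its inverse, which exists automatically, is smooth. -/
def PrincipalBundle.Hom.ofEquivariant {P Q : PrincipalBundle.{v} 𝒮} (f : ∀ x, P.fib x → Q.fib x)
    (hf : ∀ {x} (p : P.fib x) (h : H), f x (P.act p h) = Q.act (f x p) h)
    (hs : ∀ s ∈ P.atlas, ∀ t ∈ Q.atlas, ∀ x ∈ s.base, x ∈ t.base →
      ∃ W : TopologicalSpace.Opens X, x ∈ W ∧ ∃ g : X → H, 𝒮.SmoothMap W g ∧
        ∀ y ∈ W, ∃ (hs : y ∈ s.base) (ht : y ∈ t.base),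
          f y (s.val y hs) = Q.act (t.val y ht) (g y))
    (hs' : ∀ s ∈ P.atlas, ∀ t ∈ Q.atlas, ∀ x ∈ s.base, x ∈ t.base →
      ∃ W : TopologicalSpace.Opens X, x ∈ W ∧ ∃ g : X → H, 𝒮.SmoothMap W g ∧
        ∀ y ∈ W, ∃ (hs : y ∈ s.base) (ht : y ∈ t.base),
          t.val y ht = Q.act (f y (s.val y hs)) (g y)) : PrincipalBundle.Hom P Q where
  map x := Equiv.ofBijective (f x) (PrincipalBundle.bijective_of_equivariant hf)
  equivariant := hf
  smooth := hs
  smooth_symm := by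
    intro t ht s hsP x hxt hxs
    obtain ⟨W, hW, g, hg, e⟩ := hs' s hsP t ht x hxs hxt
    refine ⟨W, hW, g, hg, fun y hy => ?_⟩
    obtain ⟨a, b, e⟩ := e y hy
    refine ⟨b, a, ?_⟩
    change (Equiv.ofBijective (f y) (PrincipalBundle.bijective_of_equivariant hf)).symm _ = _
    rw [Equiv.symm_apply_eq, e]
    exact (hf _ _).symm

theorem StrVectorBundle.preservesStructure_of_local {E E' : StrVectorBundle.{v} 𝒮}
    {f : ∀ x, E.fib x → E'.fib x}
    (h : ∀ ψ ∈ E.atlas, ∀ φ ∈ E'.atlas, ∀ x (hψ : x ∈ ψ.base) (hφ : x ∈ φ.base),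
      ∃ g : H, ∀ w, φ.triv x hφ (f x ((ψ.triv x hψ).symm w)) = g • w) :
    StrVectorBundle.PreservesStructure E E' f := by
  rintro x p q ⟨ψ, hψ, hx, a, ha⟩ ⟨φ, hφ, hx', b, hb⟩
  obtain ⟨g, hg⟩ := h ψ hψ φ hφ x hx hx'
  refine ⟨b⁻¹ * (g * a), fun w => ?_⟩
  rw [LinearEquiv.symm_apply_eq, ha, hb, mul_smul, smul_inv_smul, mul_smul, ← hg,
    LinearEquiv.symm_apply_apply]

/-- A fibrewise linear isomorphism which, together with its inverse, is given by smooth `H`-valued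
functions in the preferred trivialisations is a morphism of vector bundles with structure group. -/
def StrVectorBundle.Hom.ofLocal {E E' : StrVectorBundle.{v} 𝒮} (f : ∀ x, E.fib x ≃ₗ[ℂ] E'.fib x)
    (h : ∀ ψ ∈ E.atlas, ∀ φ ∈ E'.atlas, ∃ g : X → H, 𝒮.SmoothMap (ψ.base ∩ φ.base : Set X) g ∧
      ∀ x (hψ : x ∈ ψ.base) (hφ : x ∈ φ.base) (w : F),
        φ.triv x hφ (f x ((ψ.triv x hψ).symm w)) = g x • w)
    (h' : ∀ ψ ∈ E.atlas, ∀ φ ∈ E'.atlas, ∃ g : X → H, 𝒮.SmoothMap (φ.base ∩ ψ.base : Set X) g ∧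
      ∀ x (hφ : x ∈ φ.base) (hψ : x ∈ ψ.base) (w : F),
        ψ.triv x hψ ((f x).symm ((φ.triv x hφ).symm w)) = g x • w) : StrVectorBundle.Hom E E' where
  map := f
  structural := preservesStructure_of_local fun ψ hψ φ hφ x hx hx' => by
    obtain ⟨g, -, e⟩ := h ψ hψ φ hφ
    exact ⟨g x, e x hx hx'⟩
  structural_symm := preservesStructure_of_local fun φ hφ ψ hψ x hx hx' => by
    obtain ⟨g, -, e⟩ := h' ψ hψ φ hφ
    exact ⟨g x, e x hx hx'⟩
  smooth := isSmooth_of_smoothMap fun ψ hψ φ hφ x hx hx' => by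
    obtain ⟨g, hg, e⟩ := h ψ hψ φ hφ
    exact ⟨ψ.base ⊓ φ.base, ⟨hx, hx'⟩, g, hg, fun y hy => ⟨hy.1, hy.2, e y hy.1 hy.2⟩⟩
  smooth_symm := isSmooth_of_smoothMap fun φ hφ ψ hψ x hx hx' => by
    obtain ⟨g, hg, e⟩ := h' ψ hψ φ hφ
    exact ⟨φ.base ⊓ ψ.base, ⟨hx, hx'⟩, g, hg, fun y hy => ⟨hy.1, hy.2, e y hy.1 hy.2⟩⟩

end PrincipalHom

section FrameAssocIso

variable {X : Type*} {H F : Type} [TopologicalSpace X] [Group H] [AddCommGroup F] [Module ℂ F]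
  [DistribMulAction H F] [SMulCommClass H ℂ F] [FaithfulSMul H F] {𝒮 : BundleModel X H F}

omit [FaithfulSMul H F] in
theorem PrincipalBundle.frame_act (P : PrincipalBundle.{v} 𝒮) {x : X} (p : P.fib x) (h : H) :
    P.frame (P.act p h) = (smulEquiv F h).trans (P.frame p) :=
  LinearEquiv.ext fun w => P.cls_act p h w

/-- The canonical isomorphism `p ↦ (w ↦ [p, w])` from a principal bundle to the frame bundle of the
associated vector bundle. -/
def toFrameAssoc (P : PrincipalBundle.{v} 𝒮) :
    PrincipalBundle.Hom P (frameBundle P.assocBundle) :=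
  PrincipalBundle.Hom.ofEquivariant (Q := frameBundle P.assocBundle)
    (fun _ p => ⟨P.frame p, P.isFrame_frame p⟩)
    (fun p h => Subtype.ext (P.frame_act p h))
    (by
      rintro s hs _ ⟨_, ⟨t, ht, rfl⟩, rfl⟩ x hxs hxt
      obtain ⟨g, hg, e⟩ := P.isPrincipal.transition t ht s hs
      refine ⟨t.base ⊓ s.base, ⟨hxt, hxs⟩, g, hg, fun y hy => ⟨hy.2, hy.1, Subtype.ext ?_⟩⟩
      change P.frame (s.val y hy.2) = (smulEquiv F (g y)).trans (P.frame (t.val y hy.1))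
      rw [e y hy.1 hy.2, P.frame_act])
    (by
      rintro s hs _ ⟨_, ⟨t, ht, rfl⟩, rfl⟩ x hxs hxt
      obtain ⟨g, hg, e⟩ := P.isPrincipal.transition s hs t ht
      refine ⟨s.base ⊓ t.base, ⟨hxs, hxt⟩, g, hg, fun y hy => ⟨hy.1, hy.2, Subtype.ext ?_⟩⟩
      change P.frame (t.val y hy.2) = (smulEquiv F (g y)).trans (P.frame (s.val y hy.1))
      rw [e y hy.1 hy.2, P.frame_act])

theorem toFrameAssoc_naturality {P Q : PrincipalBundle.{v} 𝒮} (f : P ⟶ Q) :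
    f ≫ (toFrameAssoc Q : Q ⟶ frameBundle Q.assocBundle) =
      (toFrameAssoc P : P ⟶ frameBundle P.assocBundle) ≫
        (frameFunctor 𝒮).map ((assocFunctor 𝒮).map f) :=
  PrincipalBundle.Hom.ext <| funext fun _ => Equiv.ext fun _ => Subtype.ext <|
    LinearEquiv.ext fun _ => rfl

/-- Evaluation of frames `[p, w] ↦ p(w)` on the vector bundle associated to the frame bundle of
`E`. -/
def evalFrame (E : StrVectorBundle.{v} 𝒮) (x : X) :
    (frameBundle E).AssocFib (F := F) x ≃ₗ[ℂ] E.fib x :=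
  ((frameBundle E).frame ((frameBundle E).point x)).symm.trans ((frameBundle E).point x).1

theorem evalFrame_cls (E : StrVectorBundle.{v} 𝒮) {x : X} (p : (frameBundle E).fib x) (w : F) :
    evalFrame E x ((frameBundle E).cls p w) = p.1 w := by
  conv_lhs => rw [← (frameBundle E).act_diff ((frameBundle E).point x) p,
    PrincipalBundle.cls_act, ← PrincipalBundle.frame_apply]
  change ((frameBundle E).point x).1 (((frameBundle E).frame ((frameBundle E).point x)).symm _) = _
  rw [LinearEquiv.symm_apply_apply]
  exact congrArg (fun q : (frameBundle E).fib x => q.1 w) ((frameBundle E).act_diff _ p)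

/-- The canonical isomorphism `[p, w] ↦ p(w)` from the vector bundle associated to the frame bundle
of `E` to `E`. -/
def ofAssocFrame (E : StrVectorBundle.{v} 𝒮) : StrVectorBundle.Hom (frameBundle E).assocBundle E :=
  StrVectorBundle.Hom.ofLocal (E := (frameBundle E).assocBundle) (evalFrame E)
    (by
      rintro _ ⟨_, ⟨ψ, hψ, rfl⟩, rfl⟩ φ hφ
      obtain ⟨g, hg, e⟩ := E.transition ψ hψ φ hφ
      refine ⟨g, hg, fun x hx hx' w => ?_⟩
      rw [← e x hx hx']
      exact congrArg (φ.triv x hx') (evalFrame_cls E _ w))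
    (by
      rintro _ ⟨_, ⟨ψ, hψ, rfl⟩, rfl⟩ φ hφ
      obtain ⟨g, hg, e⟩ := E.transition φ hφ ψ hψ
      refine ⟨g, hg, fun x hx hx' w => ?_⟩
      rw [← e x hx hx']
      change ((frameBundle E).frame _).symm ((evalFrame E x).symm _) = _
      rw [LinearEquiv.symm_apply_eq, LinearEquiv.symm_apply_eq, PrincipalBundle.frame_apply,
        evalFrame_cls]
      exact ((ψ.triv x hx').symm_apply_apply _).symm)

theorem ofAssocFrame_naturality {E E' : StrVectorBundle.{v} 𝒮} (f : E ⟶ E') :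
    (assocFunctor 𝒮).map ((frameFunctor 𝒮).map f) ≫
        (ofAssocFrame E' : (frameBundle E').assocBundle ⟶ E') =
      (ofAssocFrame E : (frameBundle E).assocBundle ⟶ E) ≫ f := by
  refine StrVectorBundle.Hom.ext <| funext fun x => LinearEquiv.ext fun a => ?_
  obtain ⟨w, rfl⟩ := (frameBundle E).exists_cls ((frameBundle E).point x) a
  exact (evalFrame_cls E' _ w).trans
    (congrArg (StrVectorBundle.Hom.map f x) (evalFrame_cls E _ w)).symm

variable (𝒮) in
/-- `𝓕(P ×_H F) ≅ P`. -/
def frameAssocIso : 𝟭 (PrincipalBundle.{v} 𝒮) ≅ assocFunctor 𝒮 ⋙ frameFunctor 𝒮 :=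
  groupoidNatIso (fun P => toFrameAssoc P) toFrameAssoc_naturality

variable (𝒮) in
/-- `𝓕(E) ×_H F ≅ E`. -/
def assocFrameIso : frameFunctor 𝒮 ⋙ assocFunctor 𝒮 ≅ 𝟭 (StrVectorBundle.{v} 𝒮) :=
  groupoidNatIso (fun E => ofAssocFrame E) ofAssocFrame_naturality

end FrameAssocIso

section FramedFrameAssocIso

variable (E M : Type*) [NormedAddCommGroup E] [NormedSpace ℝ E] [TopologicalSpace M]
  [ChartedSpace E M] (n : ℕ)

/-- `𝓕(P ×_G V) ≅ P` for framed bundles. -/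
def framedFrameAssocIso :
    𝟭 (FramedGBundle.{v} E M n) ≅ framedAssocFunctor E M n ⋙ framedFrameFunctor E M n :=
  groupoidNatIso (fun P => ⟨toFrameAssoc P.bundle, fun _ => rfl⟩)
    fun f => FramedGBundle.Hom.ext (toFrameAssoc_naturality f.hom)

/-- `𝓕(E) ×_G V ≅ E` for framed bundles. -/
def framedAssocFrameIso :
    framedFrameFunctor E M n ⋙ framedAssocFunctor E M n ≅ 𝟭 (FramedVectorBundle.{v} E M n) :=
  groupoidNatIso (fun P => ⟨ofAssocFrame P.bundle, fun m e => by
      obtain ⟨w, rfl⟩ := (frameBundle P.bundle).exists_cls ⟨(P.framing m).symm, P.isFrame m⟩ e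
      refine (congrArg (P.framing m) (evalFrame_cls P.bundle _ w)).trans ?_
      refine ((P.framing m).apply_symm_apply w).trans ?_
      exact (((frameBundle P.bundle).frame ⟨(P.framing m).symm, P.isFrame m⟩).symm_apply_apply
        w).symm⟩)
    fun f => FramedVectorBundle.Hom.ext (ofAssocFrame_naturality f.hom)

end FramedFrameAssocIso

/-! ### The caloron correspondence for principal bundles -/

section CaloronIso

variable {E M : Type*} [NormedAddCommGroup E] [NormedSpace ℝ E] [TopologicalSpace M]
  [ChartedSpace E M]

section Unit

variable (hC : CaloronWellDefined.{v} E M) {n : ℕ} (Q : OmegaBundle.{v} E M n)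

/-- The smooth section `θ ↦ [q, θ, 1]` of `𝓒(Q)` over a circle, for `q ∈ Q`. -/
def caloronLoop {m : M} (q : Q.fib m) : InvCaloronFib ((caloron hC n).obj Q) m :=
  ⟨fun _ => caloronMk Q q 1, by
    refine smoothLoop_iff.2 fun θ => ?_
    obtain ⟨s, hs, hm⟩ := Q.isPrincipal.cover m
    refine SmoothSecAt.of_eventually (g := fun θ => (Q.diff (s.val m hm) q).1 θ) ⟨s, hs, rfl⟩
      ((Q.diff (s.val m hm) q).2.1 θ) (Eventually.of_forall fun η => ⟨hm, ?_⟩)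
    change caloronMk Q (y := (m, η)) q 1 =
      caloronMk Q (y := (m, η)) (s.val m hm) (1 * (Q.diff (s.val m hm) q).1 η)
    conv_lhs => rw [← Q.act_diff (s.val m hm) q, caloronMk_act]
    rw [mul_one, one_mul], (caloronFraming_eq Q m q).symm⟩

theorem caloronLoop_act {m : M} (q : Q.fib m) (γ : OmegaG n) :
    caloronLoop hC Q (Q.act q γ) =
      (preInvCaloron ((caloron hC n).obj Q)).act (caloronLoop hC Q q) γ := by
  refine Subtype.ext <| funext fun θ => ?_
  change caloronMk Q (y := (m, θ)) (Q.act q γ) 1 = caloronMk Q (y := (m, θ)) q (1 * γ.1 θ)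
  rw [caloronMk_act, mul_one, one_mul]

/-- A distinguished local section `s` of `Q` gives the smooth local section `(x, θ) ↦ [s(x), θ, 1]`
of `𝓒(Q)`. -/
theorem caloronLoop_mem_atlas {s : LocalSection Q.fib} (hs : s ∈ Q.atlas) :
    (⟨s.base, fun m hm => caloronLoop hC Q (s.val m hm)⟩ :
      LocalSection (preInvCaloron ((caloron hC n).obj Q)).fib) ∈
        (preInvCaloron ((caloron hC n).obj Q)).atlas := by
  refine mem_preInvCaloron_atlas.2 fun z hz => ?_
  refine SmoothSecAt.of_eventually (g := fun _ => 1) ⟨s, hs, rfl⟩ (gSmoothAt_const 1 z) ?_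
  have hop : IsOpen (Prod.fst ⁻¹' s.base : Set (M × Circle)) :=
    s.base.isOpen.preimage continuous_fst
  filter_upwards [hop.mem_nhds hz] with w hw
  refine ⟨hw, (uncurrySection_eq ((caloron hC n).obj Q) _ hw).trans ?_⟩
  change caloronMk Q (s.val w.1 hw) 1 = caloronMk Q (s.val w.1 hw) (1 * 1)
  rw [one_mul]

variable (hI : InvCaloronWellDefined.{v} E M)

/-- The canonical isomorphism `q ↦ (θ ↦ [q, θ, 1])` from `Q` to `𝓒⁻¹(𝓒(Q))`. -/
def toInvCaloronCaloron :
    PrincipalBundle.Hom Q ((invCaloron hI n).obj ((caloron hC n).obj Q)) :=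
  PrincipalBundle.Hom.ofEquivariant (Q := (invCaloron hI n).obj ((caloron hC n).obj Q))
    (fun _ q => caloronLoop hC Q q) (fun q γ => caloronLoop_act hC Q q γ)
    (fun s hs t ht x hxs hxt => by
      obtain ⟨g, hg, e⟩ := (hI.isPrincipal n ((caloron hC n).obj Q)).transition t ht _
        (caloronLoop_mem_atlas hC Q hs)
      exact ⟨t.base ⊓ s.base, ⟨hxt, hxs⟩, g, hg, fun y hy => ⟨hy.2, hy.1, e y hy.1 hy.2⟩⟩)
    (fun s hs t ht x hxs hxt => by
      obtain ⟨g, hg, e⟩ := (hI.isPrincipal n ((caloron hC n).obj Q)).transition _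
        (caloronLoop_mem_atlas hC Q hs) t ht
      exact ⟨s.base ⊓ t.base, ⟨hxs, hxt⟩, g, hg, fun y hy => ⟨hy.1, hy.2, e y hy.1 hy.2⟩⟩)

variable (n) in
/-- `𝓒⁻¹(𝓒(Q)) ≅ Q`. -/
def caloronUnitIso : 𝟭 (OmegaBundle.{v} E M n) ≅ caloron hC n ⋙ invCaloron hI n :=
  groupoidNatIso (fun Q => toInvCaloronCaloron hC Q hI)
    fun _ => PrincipalBundle.Hom.ext <| funext fun _ => Equiv.ext fun _ => rfl

end Unit

section Counit

variable (hI : InvCaloronWellDefined.{v} E M) (hC : CaloronWellDefined.{v} E M) {n : ℕ}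
  (P : FramedGBundle.{v} E M n)

/-- The evaluation map `[p, θ, g] ↦ p(θ)g`. -/
def evalLoop (y : M × Circle) :
    (preCaloron ((invCaloron hI n).obj P)).fib y → P.bundle.fib y :=
  Quotient.lift (s := caloronSetoid ((invCaloron hI n).obj P) y)
    (fun a => P.bundle.act (a.1.1 y.2) a.2) (by
      rintro a _ ⟨γ, rfl⟩
      change _ = P.bundle.act (P.bundle.act (a.1.1 y.2) (γ.1 y.2)) ((γ.1 y.2)⁻¹ * a.2)
      rw [← P.bundle.isPrincipal.act_mul, mul_inv_cancel_left])

theorem evalLoop_act {y : M × Circle} (a : (preCaloron ((invCaloron hI n).obj P)).fib y)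
    (h : GLV n) : evalLoop hI P y ((preCaloron ((invCaloron hI n).obj P)).act a h) =
      P.bundle.act (evalLoop hI P y a) h := by
  obtain ⟨p, g⟩ := a
  exact P.bundle.isPrincipal.act_mul _ g h

/-- The canonical isomorphism `[p, θ, g] ↦ p(θ)g` from `𝓒(𝓒⁻¹(P))` to `P`. -/
def ofCaloronInvCaloron :
    PrincipalBundle.Hom ((caloron hC n).obj ((invCaloron hI n).obj P)).bundle P.bundle :=
  PrincipalBundle.Hom.ofEquivariant
    (P := ((caloron hC n).obj ((invCaloron hI n).obj P)).bundle) (evalLoop hI P) (evalLoop_act hI P)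
    (by
      rintro _ ⟨s, hs, rfl⟩ t ht y hys hyt
      obtain ⟨W, hW, g, hg, e⟩ := hs t ht y hys hyt
      refine ⟨W, hW, g, hg, fun z hz => ?_⟩
      obtain ⟨a, b, e⟩ := e z hz
      exact ⟨a, b, (P.bundle.isPrincipal.act_one _).trans e⟩)
    (by
      rintro _ ⟨s, hs, rfl⟩ t ht y hys hyt
      obtain ⟨W, hW, g, hg, e⟩ := hs t ht y hys hyt
      refine ⟨W, hW, fun z => (g z)⁻¹, gSmoothOn_of_gSmoothAt fun z hz => ?_, fun z hz => ?_⟩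
      · exact (hg.gSmoothAt (W.isOpen.mem_nhds hz)).inv
      obtain ⟨a, b, e⟩ := e z hz
      refine ⟨a, b, ?_⟩
      change _ = P.bundle.act (P.bundle.act ((s.val z.1 a).1 z.2) 1) (g z)⁻¹
      rw [P.bundle.isPrincipal.act_one, e, ← P.bundle.isPrincipal.act_mul, mul_inv_cancel,
        P.bundle.isPrincipal.act_one])

variable (n) in
/-- `𝓒(𝓒⁻¹(P)) ≅ P`. -/
def caloronCounitIso : invCaloron hI n ⋙ caloron hC n ≅ 𝟭 (FramedGBundle.{v} E M n) :=
  groupoidNatIso (fun P => ⟨ofCaloronInvCaloron hI hC P, fun m =>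
      (P.bundle.isPrincipal.act_one _).trans (((invCaloron hI n).obj P).point m).2.2⟩)
    fun {P R} f => FramedGBundle.Hom.ext <| PrincipalBundle.Hom.ext <| funext fun y => Equiv.ext <| by
      rintro ⟨p, g⟩
      exact (PrincipalBundle.Hom.equivariant (FramedGBundle.Hom.hom f) (p.1 y.2) g).symm

end Counit

/-! ### The caloron correspondence for vector bundles -/

section SigmaEquivalence

universe u w

variable {I : Type*} {C D : I → Type u} [∀ i, Category.{w} (C i)] [∀ i, Category.{w} (D i)]
  (F : ∀ i, C i ⥤ D i) (G : ∀ i, D i ⥤ C i)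

/-- Natural isomorphisms `id ≅ Gᵢ ∘ Fᵢ` for all `i` give one for the functors between the disjoint
unions of categories. -/
def sigmaUnitIso (η : ∀ i, 𝟭 (C i) ≅ F i ⋙ G i) :
    𝟭 (Σ i, C i) ≅ Sigma.Functor.sigma F ⋙ Sigma.Functor.sigma G :=
  NatIso.ofComponents
    (fun X => ((Sigma.incl X.1).mapIso ((η X.1).app X.2) :
      X ≅ (Sigma.incl X.1).obj ((G X.1).obj ((F X.1).obj X.2)))) (by
    rintro ⟨i, X⟩ ⟨_, Y⟩ ⟨f⟩
    exact congrArg Sigma.SigmaHom.mk ((η i).hom.naturality f))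

/-- Equivalences between the summands give an equivalence between disjoint unions of categories. -/
def sigmaEquivalence (η : ∀ i, 𝟭 (C i) ≅ F i ⋙ G i) (ε : ∀ i, G i ⋙ F i ≅ 𝟭 (D i)) :
    (Σ i, C i) ≌ Σ i, D i :=
  CategoryTheory.Equivalence.mk (Sigma.Functor.sigma F) (Sigma.Functor.sigma G)
    (sigmaUnitIso F G η) (sigmaUnitIso G F fun i => (ε i).symm).symm

end SigmaEquivalence


section VectorIso

variable (hC : CaloronWellDefined.{v} E M) (hI : InvCaloronWellDefined.{v} E M) (n : ℕ)

/-- `𝓕 ∘ 𝓥 ≅ 𝓒 ∘ 𝓕`. -/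
def vectorCaloronFrameIso : vectorCaloron hC n ⋙ framedFrameFunctor E M n ≅
    frameFunctor (omegaModel E M n) ⋙ caloron hC n :=
  Functor.isoWhiskerLeft (frameFunctor (omegaModel E M n) ⋙ caloron hC n)
    (framedFrameAssocIso E M n).symm

/-- `𝓕 ∘ 𝓥⁻¹ ≅ 𝓒⁻¹ ∘ 𝓕`. -/
def vectorInvCaloronFrameIso : vectorInvCaloron hI n ⋙ frameFunctor (omegaModel E M n) ≅
    framedFrameFunctor E M n ⋙ invCaloron hI n :=
  Functor.isoWhiskerLeft (framedFrameFunctor E M n ⋙ invCaloron hI n)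
    (frameAssocIso (omegaModel E M n)).symm

/-- `𝓥⁻¹ ∘ 𝓥 ≅ id`. -/
def vectorUnitIso :
    𝟭 (OmegaVectorBundle.{v} E M n) ≅ vectorCaloron hC n ⋙ vectorInvCaloron hI n :=
  (assocFrameIso (omegaModel E M n)).symm ≪≫
    Functor.isoWhiskerRight (Functor.isoWhiskerLeft (frameFunctor (omegaModel E M n))
      (caloronUnitIso hC n hI)) (assocFunctor (omegaModel E M n)) ≪≫
    Functor.isoWhiskerRight (vectorCaloronFrameIso hC n).symm
      (invCaloron hI n ⋙ assocFunctor (omegaModel E M n))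

/-- `𝓥 ∘ 𝓥⁻¹ ≅ id`. -/
def vectorCounitIso :
    vectorInvCaloron hI n ⋙ vectorCaloron hC n ≅ 𝟭 (FramedVectorBundle.{v} E M n) :=
  Functor.isoWhiskerRight (vectorInvCaloronFrameIso hI n)
      (caloron hC n ⋙ framedAssocFunctor E M n) ≪≫
    Functor.isoWhiskerRight (Functor.isoWhiskerLeft (framedFrameFunctor E M n)
      (caloronCounitIso hI hC n)) (framedAssocFunctor E M n) ≪≫
    framedAssocFrameIso E M n

/-- The caloron transform as an equivalence of groupoids, in rank `n`. -/
def vectorCaloronEquivalence : OmegaVectorBundle.{v} E M n ≌ FramedVectorBundle.{v} E M n :=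
  CategoryTheory.Equivalence.mk (vectorCaloron hC n) (vectorInvCaloron hI n)
    (vectorUnitIso hC hI n) (vectorCounitIso hC hI n)

/-- The caloron transform as an equivalence of groupoids, in all ranks. -/
def vectorCaloronTotalEquivalence : OmegaVect.{v} E M ≌ FrVect.{v} E M :=
  sigmaEquivalence (vectorCaloron hC) (vectorInvCaloron hI) (vectorUnitIso hC hI)
    (vectorCounitIso hC hI)

end VectorIso

end CaloronIso

end Caloron

end

theorem mainTheorem9 {E : Type*} [NormedAddCommGroup E] [NormedSpace ℝ E] [FiniteDimensional ℝ E]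
    {M : Type*} [TopologicalSpace M] [ChartedSpace E M] [IsManifold 𝓘(ℝ, E) ∞ M]
    [T2Space M] [ParacompactSpace M] :
    ∃ (hC : Caloron.CaloronWellDefined.{v} E M) (hI : Caloron.InvCaloronWellDefined.{v} E M),
      (∃ e : Caloron.OmegaVect.{v} E M ≌ Caloron.FrVect.{v} E M,
        e.functor = Caloron.vectorCaloronTotal hC ∧
          e.inverse = Caloron.vectorInvCaloronTotal hI) ∧
      ∀ n : ℕ,
        (∃ e : Caloron.OmegaVectorBundle.{v} E M n ≌ Caloron.FramedVectorBundle.{v} E M n,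
          e.functor = Caloron.vectorCaloron hC n ∧ e.inverse = Caloron.vectorInvCaloron hI n) ∧
        Nonempty (Caloron.vectorCaloron hC n ⋙ Caloron.framedFrameFunctor E M n ≅
          Caloron.frameFunctor (Caloron.omegaModel E M n) ⋙ Caloron.caloron hC n) ∧
        Nonempty (Caloron.vectorInvCaloron hI n ⋙
            Caloron.frameFunctor (Caloron.omegaModel E M n) ≅
          Caloron.framedFrameFunctor E M n ⋙ Caloron.invCaloron hI n) := by
  exact ⟨Caloron.caloronWellDefined, Caloron.invCaloronWellDefined,
    ⟨Caloron.vectorCaloronTotalEquivalence _ _, rfl, rfl⟩, fun n =>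
    ⟨⟨Caloron.vectorCaloronEquivalence _ _ n, rfl, rfl⟩,
      ⟨Caloron.vectorCaloronFrameIso _ n⟩, ⟨Caloron.vectorInvCaloronFrameIso _ n⟩⟩⟩
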